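/- Let $d\ge 1$, $\rho_0>0$ and $0<\rho_1<2\rho_0<\rho_2<\infty$. **Lipschitz sets.** Let $\mathcal O(\mathbb R^d)$ be the family of bounded nonempty Borel sets $D\subset\mathbb R^d$ that are Lipschitz: near each of its boundary points, and in suitable rotated coordinates $(u,y)\in\mathbb R^{d-1}\times\mathbb R$, $D$ contains all points with $y<g(u)$ and no point with $y>g(u)$, for some Lipschitz function $g:\mathbb R^{d-1}\to\mathbb R$. For $R>0$ let $D_R=\{Rx : x\in D\}$, $D_{R,0}=D_R$, and for $r>0$ let $D_{R,r}=\{x\in D_R : \mathrm{dist}(x,\mathbb R^d\setminus D_R)>r\}$. Let $\mathcal D(D)=\{D_{R,r} : R>0,\ r\ge 0,\ D_{R,r}\in\mathcal O(\mathbb R^d)\}$. **Admissible sets.** Let $\mathcal A_{\rho_1,\rho_2}$ be the set of locally finite $\zeta\subset\mathbb R^d$ such that no $d+1$ points of $\zeta$ lie in one hyperplane, no $d+2$ points of $\zeta$ lie in one hypersphere, $|x-y|\ge\rho_1$ for all $x\ne y$ in $\zeta$, and every open ball of radius $\rho_2$ contains a point of $\zeta$. Locally finite point sets carry the $\sigma$-algebra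 generated by the maps $\zeta\mapsto\#(\zeta\cap B)$, $B$ Borel. **Random parking.** Let $\mathcal P$ be a Poisson point process of unit intensity on $\mathbb R^d\times\mathbb R^+$, where $\mathbb R^+=[0,\infty)$. Draw an oriented edge from a point $(X,T)$ of $\mathcal P$ to a point $(X',T')$ of $\mathcal P$ if the open balls of radius $\rho_0$ centred at $X$ and $X'$ intersect and either $T<T'$, or $T=T'$ and $X$ precedes $X'$ lexicographically. For a Borel set $A\subset\mathbb R^d$, start with the vertex set $\mathcal P\cap(A\times\mathbb R^+)$ and repeat the following step for $i=1,2,\dots$: let $F_i(A)$ be the set of the roots (vertices without parent) of the graph restricted to the current vertex set, and remove these roots and all their offspring from the vertex set. The random parking measure $\xi^A$ is the projection of $\bigcup_i F_i(A)$ to $\mathbb R^d$ (identified with its set of points). Put $\xi=\xi^{\mathbb R^d}$. All the $\xi^A$ are built from the same $\mathcal P$. **Functionals.** Let $D\in\mathcal O(\mathbb R^d)$ and let $S:\mathcal D(D)\times\mathcal A_{\rho_1,\rho_2}\to\mathbb R^+$ be measurable in its second argument. Suppose that 1. ($S$ is local) $S(\hat D,\zeta)=S(\hat D,\tilde\zeta)$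 whenever $\hat D\in\mathcal D(D)$, $\zeta,\tilde\zeta\in\mathcal A_{\rho_1,\rho_2}$ and $\zeta\cap\hat D=\tilde\zeta\cap\hat D$; 2. ($S$ is insensitive to boundary effects) there is $\alpha\in(0,1)$ with $$\limsup_{R\to\infty}\ \sup_{\zeta\in\mathcal A_{\rho_1,\rho_2}}\frac{|S(D_R,\zeta)-S(D_{R,R^\alpha},\zeta)|}{R^d}=0;$$ 3. ($S$ has the averaging property with respect to $D$) for every random locally finite point set $\zeta$ which is stationary and ergodic under the translations of $\mathbb R^d$ and almost surely belongs to $\mathcal A_{\rho_1,\rho_2}$, there is a deterministic constant $\overline S(\zeta)\in\mathbb R$ such that almost surely $S(D_R,\zeta)/|D_R|\to\overline S(\zeta)$ as $R\to\infty$. For a point set $\zeta\subset\hat D$, where $\hat D\in\mathcal D(D)$, that can be written as $\zeta=\zeta^*\cap\hat D$ with $\zeta^*\in\mathcal A_{\rho_1,\rho_2}$, put $S(\hat D,\zeta)=S(\hat D,\zeta^*)$; by locality this does not depend on the choice of $\zeta^*$. **Theorem.** Almost surely, $\xi\in\mathcal A_{\rho_1,\rho_2}$ and, for every $R>0$, $\xi^{D_R}$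 is of the form $\zeta^*\cap D_R$ with $\zeta^*\in\mathcal A_{\rho_1,\rho_2}$ (so that the quantities below are defined). Moreover, with the deterministic constant $\overline S=\overline S(\xi)$ given by the averaging property, almost surely $$\lim_{R\to\infty}\frac{S(D_R,\xi^{D_R})}{|D_R|}=\lim_{R\to\infty}\frac{S(D_R,\xi)}{|D_R|}=\overline S .$$ -/

import Mathlib

open MeasureTheory ProbabilityTheory Filter Set
open scoped Topology NNReal ENNReal Pointwise

noncomputable section

namespace RandomParking

/-- Euclidean space `ℝ^d`. -/
abbrev E (d : ℕ) : Type := EuclideanSpace ℝ (Fin d)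

/-- Locally finite point sets in `X`. -/
@[ext]
structure PointConfig (X : Type*) [TopologicalSpace X] where
  carrier : Set X
  locallyFinite : ∀ K : Set X, IsCompact K → (carrier ∩ K).Finite

namespace PointConfig

/-- The number of points of `ζ` in `B`. -/
def count {X : Type*} [TopologicalSpace X] (ζ : PointConfig X) (B : Set X) : ℕ∞ :=
  (ζ.carrier ∩ B).encard

/-- The usual σ-algebra on locally finite point sets: the one generated by the counting maps
`ζ ↦ #(ζ ∩ B)`, `B` measurable. -/
instance instMeasurableSpace {X : Type*} [TopologicalSpace X] [MeasurableSpace X] :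
    MeasurableSpace (PointConfig X) :=
  ⨆ (B : Set X) (_ : MeasurableSet B), MeasurableSpace.comap (fun ζ => ζ.count B) ⊤

/-- The translate `x + ζ`. -/
def translate {d : ℕ} (x : E d) (ζ : PointConfig (E d)) : PointConfig (E d) where
  carrier := (fun y => x + y) '' ζ.carrier
  locallyFinite K hK := by
    have h := (ζ.locallyFinite _ (hK.image (continuous_const_add (-x)))).image (fun y => x + y)
    refine h.subset ?_
    rintro _ ⟨⟨y, hy, rfl⟩, hyK⟩
    exact ⟨y, ⟨hy, ⟨x + y, hyK, by simp⟩⟩, rfl⟩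

end PointConfig

/-- `N` is a Poisson point process with (diffuse, σ-finite) intensity measure `μ`: the numbers of
points in pairwise disjoint sets are independent, and the number of points in a set `B` of finite
measure is Poisson distributed with parameter `μ B`. -/
structure IsPoissonProcess {Ω X : Type*} [MeasurableSpace Ω] [TopologicalSpace X]
    [MeasurableSpace X] (N : Ω → PointConfig X) (μ : Measure X) (P : Measure Ω) : Prop where
  measurable : Measurable N
  map_count : ∀ B : Set X, MeasurableSet B → μ B ≠ ∞ →
    P.map (fun ω => (N ω).count B) = (poissonMeasure (μ B).toNNReal).map (fun n : ℕ => (n : ℕ∞))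
  indep : ∀ (n : ℕ) (B : Fin n → Set X), (∀ i, MeasurableSet (B i)) →
    Pairwise (fun i j => Disjoint (B i) (B j)) →
    iIndepFun (fun i ω => (N ω).count (B i)) P

/-! ### The graphical construction of random parking -/

/-- Space-time `ℝ^d × ℝ⁺`. -/
abbrev SpaceTime (d : ℕ) : Type := E d × ℝ≥0

/-- Lebesgue measure on `ℝ^d × ℝ⁺`. -/
def lebesgue (d : ℕ) : Measure (SpaceTime d) :=
  (volume : Measure (E d)).prod ((volume : Measure ℝ).comap NNReal.toReal)

/-- Strict lexicographic order on `ℝ^d`. -/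
def LexLT {d : ℕ} (x y : E d) : Prop := ∃ i, (∀ j < i, x j = y j) ∧ x i < y i

/-- The oriented edge `p → q`: the balls of radius `ρ₀` around the two locations overlap, and `p`
arrives before `q` (ties being broken lexicographically). -/
def Edge {d : ℕ} (ρ₀ : ℝ) (p q : SpaceTime d) : Prop :=
  (Metric.ball q.1 ρ₀ ∩ Metric.ball p.1 ρ₀).Nonempty ∧
    (p.2 < q.2 ∨ (p.2 = q.2 ∧ LexLT p.1 q.1))

/-- The roots (vertices without parent) of the graph restricted to the vertex set `V`. -/
def roots {d : ℕ} (ρ₀ : ℝ) (V : Set (SpaceTime d)) : Set (SpaceTime d) :=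
  {q ∈ V | ∀ p ∈ V, ¬ Edge ρ₀ p q}

/-- The offspring, in the vertex set `V`, of the roots of the graph restricted to `V`. -/
def rootOffspring {d : ℕ} (ρ₀ : ℝ) (V : Set (SpaceTime d)) : Set (SpaceTime d) :=
  {q ∈ V | ∃ p ∈ roots ρ₀ V, Edge ρ₀ p q}

/-- The vertices that remain after `n` steps of removing the roots and their offspring, starting
from the vertex set `V`. -/
def remaining {d : ℕ} (ρ₀ : ℝ) (V : Set (SpaceTime d)) : ℕ → Set (SpaceTime d)
  | 0 => V
  | n + 1 => remaining ρ₀ V n \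
      (roots ρ₀ (remaining ρ₀ V n) ∪ rootOffspring ρ₀ (remaining ρ₀ V n))

/-- The accepted vertices: the union over all steps of the sets of roots. -/
def accepted {d : ℕ} (ρ₀ : ℝ) (V : Set (SpaceTime d)) : Set (SpaceTime d) :=
  ⋃ n, roots ρ₀ (remaining ρ₀ V n)

theorem remaining_antitone {d : ℕ} (ρ₀ : ℝ) (V : Set (SpaceTime d)) :
    Antitone (remaining ρ₀ V) :=
  antitone_nat_of_succ_le fun _ => sdiff_subset

theorem accepted_not_edge {d : ℕ} {ρ₀ : ℝ} {V : Set (SpaceTime d)} {p q : SpaceTime d}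
    (hp : p ∈ accepted ρ₀ V) (hq : q ∈ accepted ρ₀ V) : ¬ Edge ρ₀ p q := by
  intro h
  obtain ⟨i, hi⟩ := mem_iUnion.1 hp
  obtain ⟨j, hj⟩ := mem_iUnion.1 hq
  rcases le_or_gt j i with hji | hij
  · exact hj.2 p (remaining_antitone ρ₀ V hji hi.1) h
  · have h1 : q ∈ remaining ρ₀ V (i + 1) := remaining_antitone ρ₀ V hij hj.1
    exact h1.2 (Or.inr ⟨remaining_antitone ρ₀ V hij.le hj.1, p, hi, h⟩)

theorem lexLT_or_lexLT {d : ℕ} {x y : E d} (h : x ≠ y) : LexLT x y ∨ LexLT y x := by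
  have hx : toLex (x : Fin d → ℝ) ≠ toLex (y : Fin d → ℝ) := by
    intro hxy
    exact h (by ext i; exact congrFun (toLex.injective hxy) i)
  rcases lt_or_gt_of_ne hx with h | h
  · exact Or.inl h
  · exact Or.inr h

theorem accepted_separated {d : ℕ} {ρ₀ : ℝ} {V : Set (SpaceTime d)} {p q : SpaceTime d}
    (hp : p ∈ accepted ρ₀ V) (hq : q ∈ accepted ρ₀ V) (hpq : p.1 ≠ q.1) :
    ρ₀ ≤ dist p.1 q.1 := by
  by_contra! hlt
  have hpos : 0 < ρ₀ := dist_nonneg.trans_lt hlt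
  have hne : (Metric.ball q.1 ρ₀ ∩ Metric.ball p.1 ρ₀).Nonempty :=
    ⟨q.1, Metric.mem_ball_self hpos, by rwa [Metric.mem_ball, dist_comm]⟩
  have hne' : (Metric.ball p.1 ρ₀ ∩ Metric.ball q.1 ρ₀).Nonempty := by rwa [inter_comm]
  rcases lt_trichotomy p.2 q.2 with h | h | h
  · exact accepted_not_edge hp hq ⟨hne, Or.inl h⟩
  · rcases lexLT_or_lexLT hpq with h' | h'
    · exact accepted_not_edge hp hq ⟨hne, Or.inr ⟨h, h'⟩⟩
    · exact accepted_not_edge hq hp ⟨hne', Or.inr ⟨h.symm, h'⟩⟩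
  · exact accepted_not_edge hq hp ⟨hne', Or.inl h⟩

theorem finite_inter_of_separated {X : Type*} [PseudoMetricSpace X] {s K : Set X} {r : ℝ}
    (hr : 0 < r) (hs : ∀ x ∈ s, ∀ y ∈ s, x ≠ y → r ≤ dist x y) (hK : IsCompact K) :
    (s ∩ K).Finite := by
  obtain ⟨t, ht, hcov⟩ := Metric.totallyBounded_iff.1 hK.totallyBounded (r / 2) (by positivity)
  choose! f hf using fun x (hx : x ∈ K) => mem_iUnion₂.1 (hcov hx)
  refine Set.Finite.of_finite_image (f := f) (ht.subset ?_) ?_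
  · rintro _ ⟨x, hx, rfl⟩
    exact (hf x hx.2).1
  · intro x hx y hy hxy
    by_contra hne
    have h1 := Metric.mem_ball.1 (hf x hx.2).2
    have h2 := Metric.mem_ball.1 (hf y hy.2).2
    rw [← hxy] at h2
    have h3 := hs x hx.1 y hy.1 hne
    have h4 := dist_triangle_right x y (f x)
    linarith

/-- The random parking point set `ξ^A` of parameter `ρ₀` in `A`, as a function of the space-time
configuration `N`: the projection to `ℝ^d` of the accepted points among `N ∩ (A × ℝ⁺)`. -/
def parking {d : ℕ} {ρ₀ : ℝ} (hρ₀ : 0 < ρ₀) (A : Set (E d)) (N : PointConfig (SpaceTime d)) :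
    PointConfig (E d) where
  carrier := Prod.fst '' accepted ρ₀ (N.carrier ∩ (A ×ˢ univ))
  locallyFinite K hK := by
    refine finite_inter_of_separated hρ₀ ?_ hK
    rintro _ ⟨p, hp, rfl⟩ _ ⟨q, hq, rfl⟩ hpq
    exact accepted_separated hp hq hpq

/-! ### Admissible point sets -/

/-- No `d + 1` points lie in the same hyperplane, and no `d + 2` points in the same
hypersphere. -/
def IsGeneral {d : ℕ} (s : Set (E d)) : Prop :=
  (∀ t : Finset (E d), (t : Set (E d)) ⊆ s → t.card = d + 1 →
    ¬ ∃ (v : E d) (c : ℝ), v ≠ 0 ∧ ∀ x ∈ t, inner ℝ v x = c) ∧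
  (∀ t : Finset (E d), (t : Set (E d)) ⊆ s → t.card = d + 2 →
    ¬ ∃ (z : E d) (r : ℝ), ∀ x ∈ t, dist x z = r)

/-- The class of general point sets of `ℝ^d` which satisfy the hard-core condition with constant
`ρ₁` and the empty space condition with constant `ρ₂`. -/
def admissible (d : ℕ) (ρ₁ ρ₂ : ℝ) : Set (PointConfig (E d)) :=
  {ζ | IsGeneral ζ.carrier ∧
    (∀ x ∈ ζ.carrier, ∀ y ∈ ζ.carrier, x ≠ y → ρ₁ ≤ dist x y) ∧
    (∀ z : E d, (Metric.ball z ρ₂ ∩ ζ.carrier).Nonempty)}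

/-! ### Lipschitz sets and the family of dilated and shrunk sets -/

/-- Bounded nonempty Lipschitz sets: near each boundary point, and for some unit vector `e` (the
vertical direction), `D` is the region below the graph of a Lipschitz function defined on the
hyperplane orthogonal to `e`; the part of the boundary which belongs to `D` is arbitrary. -/
def IsLipschitzSet {d : ℕ} (D : Set (E d)) : Prop :=
  D.Nonempty ∧ Bornology.IsBounded D ∧ MeasurableSet D ∧
  ∀ x ∈ frontier D, ∃ (e : E d) (K : ℝ≥0) (g : (ℝ ∙ e)ᗮ → ℝ), ‖e‖ = 1 ∧ LipschitzWith K g ∧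
    ∃ U ∈ 𝓝 x, ∀ p ∈ U,
      (inner ℝ e p < g ((ℝ ∙ e)ᗮ.orthogonalProjectionOnto p) → p ∈ D) ∧
      (g ((ℝ ∙ e)ᗮ.orthogonalProjectionOnto p) < inner ℝ e p → p ∉ D)

/-- `D_{R,r}`: the set of points of the dilated set `R • D` at distance more than `r` from its
complement; `D_{R,0} = R • D`. -/
def shrink {d : ℕ} (D : Set (E d)) (R r : ℝ) : Set (E d) :=
  if r = 0 then R • D else {x ∈ R • D | r < Metric.infDist x (R • D)ᶜ}

/-- The collection `𝒟(D)`. -/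
def dilates {d : ℕ} (D : Set (E d)) : Set (Set (E d)) :=
  {A | ∃ R r : ℝ, 0 < R ∧ 0 ≤ r ∧ A = shrink D R r ∧ IsLipschitzSet A}

/-! ### Properties of functionals

A functional on `𝒟(D) × 𝒜_{ρ₁,ρ₂}` is a function `S : Set (E d) → PointConfig (E d) → ℝ` of which
only the values on `dilates D` and `admissible d ρ₁ ρ₂` matter. -/

/-- Measurability in the point set. -/
def IsMeasurableFunctional {d : ℕ} (ρ₁ ρ₂ : ℝ) (D : Set (E d))
    (S : Set (E d) → PointConfig (E d) → ℝ) : Prop :=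
  ∀ A ∈ dilates D, Measurable fun ζ : admissible d ρ₁ ρ₂ => S A ζ

def IsLocal {d : ℕ} (ρ₁ ρ₂ : ℝ) (D : Set (E d))
    (S : Set (E d) → PointConfig (E d) → ℝ) : Prop :=
  ∀ A ∈ dilates D, ∀ ζ ∈ admissible d ρ₁ ρ₂, ∀ ζ' ∈ admissible d ρ₁ ρ₂,
    ζ.carrier ∩ A = ζ'.carrier ∩ A → S A ζ = S A ζ'

def IsInsensitiveToBoundary {d : ℕ} (ρ₁ ρ₂ : ℝ) (D : Set (E d))
    (S : Set (E d) → PointConfig (E d) → ℝ) : Prop :=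
  ∃ α : ℝ, 0 < α ∧ α < 1 ∧
    limsup (fun R : ℝ => ⨆ ζ ∈ admissible d ρ₁ ρ₂,
      ENNReal.ofReal (|S (R • D) ζ - S (shrink D R (R ^ α)) ζ| / R ^ d)) atTop = 0

/-- The law `Q` of a random point set is invariant under all translations. -/
def IsStationary {d : ℕ} (Q : Measure (PointConfig (E d))) : Prop :=
  ∀ x : E d, Q.map (PointConfig.translate x) = Q

/-- Every translation invariant event has probability `0` or `1`. -/
def IsErgodic {d : ℕ} (Q : Measure (PointConfig (E d))) : Prop :=
  ∀ I : Set (PointConfig (E d)), MeasurableSet I →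
    (∀ x : E d, PointConfig.translate x ⁻¹' I = I) → Q I = 0 ∨ Q I = 1

/-- `c` is the almost sure limit of `S(D_R, ζ) / |D_R|`, `ζ` having law `Q`. -/
def HasAverage {d : ℕ} (D : Set (E d)) (S : Set (E d) → PointConfig (E d) → ℝ)
    (Q : Measure (PointConfig (E d))) (c : ℝ) : Prop :=
  ∀ᵐ ζ ∂Q, Tendsto (fun R : ℝ => S (R • D) ζ / volume.real (R • D)) atTop (𝓝 c)

/-- The averaging property with respect to `D`: every stationary ergodic random point set (given
through its law `Q`) which almost surely is in `𝒜_{ρ₁,ρ₂}` has a deterministic average. -/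
def HasAveragingProperty {d : ℕ} (ρ₁ ρ₂ : ℝ) (D : Set (E d))
    (S : Set (E d) → PointConfig (E d) → ℝ) : Prop :=
  ∀ Q : Measure (PointConfig (E d)), IsProbabilityMeasure Q → IsStationary Q → IsErgodic Q →
    (∀ᵐ ζ ∂Q, ζ ∈ admissible d ρ₁ ρ₂) → ∃ c : ℝ, HasAverage D S Q c

/-- `ζ'` is an admissible point set of `ℝ^d` which extends the point set `ζ` of `A`. -/
def IsExtension {d : ℕ} (ρ₁ ρ₂ : ℝ) (A : Set (E d)) (ζ ζ' : PointConfig (E d)) : Prop :=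
  ζ' ∈ admissible d ρ₁ ρ₂ ∧ ζ'.carrier ∩ A = ζ.carrier

open Classical in
/-- `S(A, ζ)` for a point set `ζ` only defined in `A`: the value at some admissible extension of `ζ`
(for a local functional, any of them gives the same value; the value is `0` if there is none). -/
def valueIn {d : ℕ} (ρ₁ ρ₂ : ℝ) (S : Set (E d) → PointConfig (E d) → ℝ) (A : Set (E d))
    (ζ : PointConfig (E d)) : ℝ :=
  if h : ∃ ζ', IsExtension ρ₁ ρ₂ A ζ ζ' then S A h.choose else 0

end RandomParking

end

/-! The core is stabilization: almost surely, for all large `R`, the constructions in `R • D` and in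
the whole space accept the same points at depth more than `R ^ α` inside `R • D`
(`eventually_accepted_above_iff`). Since `S` is local and insensitive to the boundary, its values
per unit volume on the two point sets then have the same limit (`tendsto_sub_div_volume`). The
averaging property identifies that limit: the law of `ξ` is the image of the Poisson law under a
measurable map that commutes with translations, so it inherits stationarity and ergodicity.

Stabilization rests on the fact that disagreement is hereditary: a point of `A` whose status differs
in the two constructions has a parent whose status differs (`exists_disagreeing_parent`).
Disagreement therefore has to travel to the boundary along a backward chain of edges, and such
chains are shown to be short. Space is cut into cells of side `2 * ρ₀`, so that an edge joins equal
or adjacent cells. For a small time step `τ`, the cells with an arrival in a given slab of duration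
`τ` form a subcritical finite-range percolation. A Peierls estimate and Borel–Cantelli show that
paths of such cells started within distance `n` of the origin have extent `O(log n)`.

Arrival times are unbounded, so slabs alone do not suffice. A point at which the constructions
disagree is accepted in one of them; if it arrives after `M * τ`, its cell belongs to `lateCells`.
Membership there is defined through an arbitrary blocking set in adjacent cells, hence is a local
event independent of the domain, and its probability tends to `0` by a compactness argument
(`exists_notMem_lateCells`). For `M` large, the late cells are subcritical too. A backward chain
thus crosses at most `M + 1` phases, each of logarithmic extent (`near_of_chain`), and `log R` is
negligible against `R ^ α`. The same argument without the late phase shows that every point has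
finitely many ancestors (`finite_ancestors`), so each point is decided after finitely many steps.

Admissibility comes from three sources: general position holds almost surely for the Poisson points
by a Fubini argument (`HasPoissonVoids.ae_genPos`), accepted points are `2 * ρ₀`-separated, and the
Poisson points are dense in space. The parking set in `A` is extended to an admissible set by a
maximal separated choice of Poisson points outside `A` (`exists_isExtension`). Finally, small
erosions of a Lipschitz set are Lipschitz (`IsLipschitzSet.exists_erosion`), so that locality may be
applied to the eroded domains. -/

noncomputable section

namespace RandomParking

namespace PointConfig

/-! ### Measurability on the space of point configurations. -/

section Measurability

set_option linter.unusedSectionVars false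

variable {X : Type*} [TopologicalSpace X] [MeasurableSpace X]

theorem measurable_count {B : Set X} (hB : MeasurableSet B) :
    Measurable fun ζ : PointConfig X => ζ.count B := by
  have h : MeasurableSpace.comap (fun ζ : PointConfig X => ζ.count B) ⊤ ≤
      instMeasurableSpace := le_iSup₂_of_le B hB le_rfl
  exact fun s _ => h _ ⟨s, trivial, rfl⟩

theorem measurableSet_void {B : Set X} (hB : MeasurableSet B) :
    MeasurableSet {ζ : PointConfig X | ζ.carrier ∩ B = ∅} := by
  have h : {ζ : PointConfig X | ζ.carrier ∩ B = ∅} = (fun ζ => ζ.count B) ⁻¹' {0} := by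
    ext ζ; simp [count]
  rw [h]
  exact measurable_count hB trivial

/-- The events that there is no point in `B`, for `B` contained in some `W n`. -/
def voids (W : ℕ → Set X) : Set (Set (PointConfig X)) :=
  {A | ∃ B : Set X, MeasurableSet B ∧ (∃ n, B ⊆ W n) ∧ A = {ζ | ζ.carrier ∩ B = ∅}}

theorem isPiSystem_voids {W : ℕ → Set X} (hW : Monotone W) : IsPiSystem (voids W) := by
  rintro _ ⟨B, hB, ⟨n, hn⟩, rfl⟩ _ ⟨B', hB', ⟨n', hn'⟩, rfl⟩ -
  refine ⟨B ∪ B', hB.union hB', ⟨max n n', union_subset (hn.trans (hW (le_max_left _ _)))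
    (hn'.trans (hW (le_max_right _ _)))⟩, ?_⟩
  ext ζ
  simp [inter_union_distrib_left]

theorem exists_disjoint_basis [T2Space X] {b : Set (Set X)}
    (hb : TopologicalSpace.IsTopologicalBasis b) {k : ℕ} {x : Fin k → X}
    (hx : Function.Injective x) :
    ∃ U : Fin k → b, (∀ i, x i ∈ (U i : Set X)) ∧
      Pairwise fun i j => Disjoint (U i : Set X) (U j) := by
  obtain ⟨V, hV, hd⟩ := (Set.finite_range x).t2_separation
  choose U hU hxU hUV using fun i => hb.exists_subset_of_mem_open (hV (x i)).1 (hV (x i)).2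
  refine ⟨fun i => ⟨U i, hU i⟩, hxU, fun i j hij => ?_⟩
  exact (hd (mem_range_self i) (mem_range_self j) (hx.ne hij)).mono (hUV i) (hUV j)

/-- Distinct points of a Hausdorff space are separated by disjoint basic open sets. With a countable
basis, the right-hand side is a countable union of finite intersections of complements of void
events; this is what reduces counting to voids. -/
theorem le_count_iff [T2Space X] {b : Set (Set X)}
    (hb : TopologicalSpace.IsTopologicalBasis b) {W : ℕ → Set X} (hW : Monotone W)
    (hcov : ⋃ n, W n = univ) (ζ : PointConfig X) (B : Set X) (k : ℕ) :
    (k : ℕ∞) ≤ ζ.count B ↔ ∃ (n : ℕ) (U : Fin k → b),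
      (Pairwise fun i j => Disjoint (U i : Set X) (U j)) ∧
      ∀ i, ¬ ζ.carrier ∩ (B ∩ (U i : Set X) ∩ W n) = ∅ := by
  constructor
  · intro h
    obtain ⟨t, ht, hcard⟩ := Set.exists_subset_encard_eq h
    have hfin : t.Finite := Set.finite_of_encard_eq_coe hcard
    have hc : hfin.toFinset.card = k := by
      rw [hfin.encard_eq_coe_toFinset_card] at hcard
      exact_mod_cast hcard
    let f := (hfin.toFinset.equivFinOfCardEq hc).symm
    have hinj : Function.Injective fun i => (f i : X) :=
      Subtype.val_injective.comp f.injective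
    have hmem : ∀ i, (f i : X) ∈ ζ.carrier ∩ B := fun i =>
      ht (hfin.mem_toFinset.1 (f i).2)
    obtain ⟨U, hU, hd⟩ := exists_disjoint_basis hb hinj
    have hn : ∀ i, ∃ n, (f i : X) ∈ W n := fun i => mem_iUnion.1 (hcov ▸ mem_univ _)
    choose n hn using hn
    refine ⟨Finset.univ.sup n, U, hd, fun i => Set.Nonempty.ne_empty ⟨f i, (hmem i).1,
      ⟨(hmem i).2, hU i⟩, hW (Finset.le_sup (Finset.mem_univ i)) (hn i)⟩⟩
  · rintro ⟨n, U, hd, hU⟩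
    choose x hx using fun i => Set.nonempty_iff_ne_empty.2 (hU i)
    have hinj : Function.Injective x := by
      intro i j hij
      by_contra hne
      exact Set.disjoint_left.1 (hd hne) (hx i).2.1.2 (hij ▸ (hx j).2.1.2)
    have hsub : range x ⊆ ζ.carrier ∩ B := by
      rintro _ ⟨i, rfl⟩
      exact ⟨(hx i).1, (hx i).2.1.1⟩
    calc (k : ℕ∞) = (range x).encard := by
          rw [← Set.image_univ, hinj.encard_image, Set.encard_univ]; simp
      _ ≤ _ := Set.encard_le_encard hsub

/-- The σ-algebra on point configurations is generated by the void events. -/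
theorem instMeasurableSpace_eq_generateFrom [T2Space X] [SecondCountableTopology X]
    [OpensMeasurableSpace X] {W : ℕ → Set X} (hW : Monotone W) (hcov : ⋃ n, W n = univ)
    (hWm : ∀ n, MeasurableSet (W n)) :
    (instMeasurableSpace : MeasurableSpace (PointConfig X)) =
      MeasurableSpace.generateFrom (voids W) := by
  refine le_antisymm (iSup₂_le fun B hB => ?_) (MeasurableSpace.generateFrom_le ?_)
  · let m := MeasurableSpace.generateFrom (voids W)
    suffices h : Measurable[m] fun ζ : PointConfig X => ζ.count B by
      rintro _ ⟨s, -, rfl⟩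
      exact h trivial
    have hb := TopologicalSpace.isBasis_countableBasis X
    have key : ∀ k : ℕ, MeasurableSet[m] {ζ : PointConfig X | (k : ℕ∞) ≤ ζ.count B} := by
      intro k
      simp_rw [le_count_iff hb hW hcov, ofPred_exists, ofPred_and]
      have : Countable (Fin k → TopologicalSpace.countableBasis X) := inferInstance
      refine MeasurableSet.iUnion fun n => MeasurableSet.iUnion fun U =>
        (MeasurableSet.const _).inter ?_
      simp_rw [ofPred_forall]
      refine MeasurableSet.iInter fun i => MeasurableSet.compl ?_
      refine MeasurableSpace.measurableSet_generateFrom ⟨_, (hB.inter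
        (hb.isOpen (U i).2).measurableSet).inter (hWm n), ⟨n, inter_subset_right⟩, rfl⟩
    refine @measurable_to_countable' _ _ _ _ m _ fun y => ?_
    induction y using ENat.recTopCoe with
    | top =>
      have : (fun ζ : PointConfig X => ζ.count B) ⁻¹' {⊤} =
          ⋂ k : ℕ, {ζ : PointConfig X | (k : ℕ∞) ≤ ζ.count B} := by
        ext ζ
        simp only [mem_preimage, mem_singleton_iff, mem_iInter, mem_ofPred_eq]
        exact ⟨fun h k => h ▸ le_top, fun h => ENat.eq_top_iff_forall_ge.2 h⟩
      rw [this]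
      exact MeasurableSet.iInter key
    | coe k =>
      have : (fun ζ : PointConfig X => ζ.count B) ⁻¹' {(k : ℕ∞)} =
          {ζ : PointConfig X | (k : ℕ∞) ≤ ζ.count B} \
            {ζ : PointConfig X | ((k + 1 : ℕ) : ℕ∞) ≤ ζ.count B} := by
        ext ζ
        simp only [mem_preimage, mem_singleton_iff, Set.mem_sdiff, mem_ofPred_eq, not_le]
        constructor
        · intro h
          rw [h]
          exact ⟨le_rfl, by exact_mod_cast Nat.lt_succ_self k⟩
        · rintro ⟨h1, h2⟩
          refine le_antisymm ?_ h1
          rw [Nat.cast_add, Nat.cast_one] at h2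
          exact Order.le_of_lt_add_one h2
      rw [this]
      exact (key k).diff (key (k + 1))
  · rintro _ ⟨B, hB, -, rfl⟩
    exact measurableSet_void hB

theorem measurable_of_void [T2Space X] [SecondCountableTopology X] [OpensMeasurableSpace X]
    {α : Type*} [MeasurableSpace α] {f : α → PointConfig X}
    (hf : ∀ B, MeasurableSet B → MeasurableSet {a | (f a).carrier ∩ B = ∅}) : Measurable f := by
  rw [instMeasurableSpace_eq_generateFrom (W := fun _ => (univ : Set X)) monotone_const
    (iUnion_const _) fun _ => MeasurableSet.univ]
  refine measurable_generateFrom ?_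
  rintro _ ⟨B, hB, -, rfl⟩
  exact hf B hB

/-- In a compact neighbourhood of `x` there are only finitely many other points, and these can be
removed from its interior. -/
theorem isolated [T2Space X] [LocallyCompactSpace X] {b : Set (Set X)}
    (hb : TopologicalSpace.IsTopologicalBasis b) (ζ : PointConfig X) {x : X}
    (hx : x ∈ ζ.carrier) : ∃ U ∈ b, ζ.carrier ∩ U = {x} := by
  obtain ⟨K, hK, hxK⟩ := exists_compact_mem_nhds x
  have hfin : ((ζ.carrier ∩ K) \ {x}).Finite := (ζ.locallyFinite K hK).subset sdiff_subset
  have hV : interior K \ ((ζ.carrier ∩ K) \ {x}) ∈ 𝓝 x :=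
    (isOpen_interior.sdiff hfin.isClosed).mem_nhds ⟨mem_interior_iff_mem_nhds.2 hxK, by simp⟩
  obtain ⟨U, hU, hxU, hUV⟩ := hb.mem_nhds_iff.1 hV
  refine ⟨U, hU, Subset.antisymm ?_ (by simpa using ⟨hx, hxU⟩)⟩
  rintro y ⟨hy, hyU⟩
  by_contra hne
  exact (hUV hyU).2 ⟨⟨hy, interior_subset (hUV hyU).1⟩, hne⟩

/-- A measurable enumeration of the points of a configuration. -/
theorem exists_enumeration [T2Space X] [LocallyCompactSpace X] [SecondCountableTopology X]
    [OpensMeasurableSpace X] [Nonempty X] :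
    ∃ (ι : Type) (_ : Countable ι) (e : ι → PointConfig X → X) (s : ι → Set (PointConfig X)),
      (∀ i, Measurable (e i)) ∧ (∀ i, MeasurableSet (s i)) ∧
      ∀ (ζ : PointConfig X) (x : X), x ∈ ζ.carrier ↔ ∃ i, ζ ∈ s i ∧ e i ζ = x := by
  classical
  have hb := TopologicalSpace.isBasis_countableBasis X
  have hne : (TopologicalSpace.countableBasis X).Nonempty := by
    obtain ⟨U, hU, -⟩ := hb.mem_nhds_iff.1 (univ_mem (f := 𝓝 (Classical.arbitrary X)))
    exact ⟨U, hU⟩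
  obtain ⟨u, hu⟩ := (TopologicalSpace.countable_countableBasis X).exists_eq_range hne
  have hum : ∀ i, MeasurableSet (u i) := fun i => (hb.isOpen (hu ▸ mem_range_self i)).measurableSet
  let x₀ : X := Classical.arbitrary X
  -- The `i`-th entry is the unique point in the `i`-th basic open set, when there is exactly one.
  -- Points may be listed several times, which is harmless.
  let s : ℕ → Set (PointConfig X) := fun i => {ζ | ζ.count (u i) = 1}
  have hs : ∀ i, MeasurableSet (s i) := fun i => measurable_count (hum i) (t := {1}) trivial
  have hex : ∀ (i : ℕ) (ζ : PointConfig X), ∃ x, ζ ∈ s i → ζ.carrier ∩ u i = {x} := by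
    intro i ζ
    by_cases h : ζ ∈ s i
    · obtain ⟨x, hx⟩ := Set.encard_eq_one.1 h
      exact ⟨x, fun _ => hx⟩
    · exact ⟨x₀, fun h' => absurd h' h⟩
  choose f hf using hex
  refine ⟨ℕ, inferInstance, fun i ζ => if ζ ∈ s i then f i ζ else x₀, s, fun i => ?_, hs, ?_⟩
  · intro B hB
    -- On `s i`, the selected point lies in `B` exactly when the configuration meets `u i ∩ B`,
    -- which is a non-void event.
    have : (fun ζ => if ζ ∈ s i then f i ζ else x₀) ⁻¹' B =
        (s i ∩ {ζ | ζ.carrier ∩ (u i ∩ B) = ∅}ᶜ) ∪ ((s i)ᶜ ∩ {_ζ | x₀ ∈ B}) := by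
      ext ζ
      by_cases h : ζ ∈ s i
      · have := hf i ζ h
        simp only [mem_preimage, h, if_true, mem_union, mem_inter_iff, true_and, mem_compl_iff,
          mem_ofPred_eq, not_true, false_and, or_false, ← inter_assoc, this]
        simp
      · simp [h]
    rw [this]
    exact ((hs i).inter (measurableSet_void ((hum i).inter hB)).compl).union
      ((hs i).compl.inter (MeasurableSet.const _))
  · intro ζ x
    constructor
    · intro hx
      obtain ⟨U, hU, hxU⟩ := isolated hb ζ hx
      rw [hu] at hU
      obtain ⟨i, rfl⟩ := hU
      have hi : ζ ∈ s i := by simp [s, count, hxU]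
      refine ⟨i, hi, ?_⟩
      simp only [hi, if_true]
      have := hf i ζ hi
      rw [hxU] at this
      exact (Set.singleton_injective this).symm
    · rintro ⟨i, hi, rfl⟩
      simp only [hi, if_true]
      have : f i ζ ∈ ζ.carrier ∩ u i := by rw [hf i ζ hi]; rfl
      exact this.1

/-- Existential quantification over tuples of points of a configuration preserves
measurability. -/
theorem measurableSet_exists_tuple [T2Space X] [LocallyCompactSpace X]
    [SecondCountableTopology X] [OpensMeasurableSpace X] [Nonempty X]
    {ι Y : Type*} [Finite ι] [MeasurableSpace Y] {c : Y → PointConfig X} (hc : Measurable c)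
    {U : (ι → X) → Y → Prop} (hU : MeasurableSet {p : (ι → X) × Y | U p.1 p.2}) :
    MeasurableSet {y : Y | ∃ x : ι → X, (∀ i, x i ∈ (c y).carrier) ∧ U x y} := by
  obtain ⟨κ, _, e, s, he, hs, hes⟩ := exists_enumeration (X := X)
  -- The enumeration replaces quantification over tuples of points by a countable union over tuples
  -- of indices.
  have : {y : Y | ∃ x : ι → X, (∀ i, x i ∈ (c y).carrier) ∧ U x y} =
      ⋃ σ : ι → κ, {y | (∀ i, c y ∈ s (σ i)) ∧ U (fun i => e (σ i) (c y)) y} := by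
    ext y
    simp only [mem_ofPred_eq, mem_iUnion]
    constructor
    · rintro ⟨x, hx, hxU⟩
      choose σ h1 h2 using fun i => (hes (c y) (x i)).1 (hx i)
      have : (fun i => e (σ i) (c y)) = x := funext h2
      exact ⟨σ, h1, this ▸ hxU⟩
    · rintro ⟨σ, h1, h2⟩
      exact ⟨_, fun i => (hes _ _).2 ⟨σ i, h1 i, rfl⟩, h2⟩
  rw [this]
  refine MeasurableSet.iUnion fun σ => ?_
  rw [ofPred_and, ofPred_forall]
  refine (MeasurableSet.iInter fun i => hc (hs (σ i))).inter ?_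
  exact (((measurable_pi_lambda _ fun i => (he (σ i)).comp hc).prodMk measurable_id) hU)

theorem measurableSet_exists_mem [T2Space X] [LocallyCompactSpace X]
    [SecondCountableTopology X] [OpensMeasurableSpace X] [Nonempty X]
    {Y : Type*} [MeasurableSpace Y] {c : Y → PointConfig X} (hc : Measurable c)
    {U : X → Y → Prop} (hU : MeasurableSet {p : X × Y | U p.1 p.2}) :
    MeasurableSet {y : Y | ∃ x ∈ (c y).carrier, U x y} := by
  have hm : Measurable fun p : (Unit → X) × Y => (p.1 (), p.2) := by fun_prop
  have h := measurableSet_exists_tuple (ι := Unit) hc (U := fun x y => U (x ()) y) (hm hU)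
  convert h using 1
  ext y
  exact ⟨fun ⟨x, h1, h2⟩ => ⟨fun _ => x, fun _ => h1, h2⟩, fun ⟨x, h1, h2⟩ => ⟨x (), h1 (), h2⟩⟩

theorem measurableSet_forall_mem [T2Space X] [LocallyCompactSpace X]
    [SecondCountableTopology X] [OpensMeasurableSpace X] [Nonempty X]
    {Y : Type*} [MeasurableSpace Y] {c : Y → PointConfig X} (hc : Measurable c)
    {U : X → Y → Prop} (hU : MeasurableSet {p : X × Y | U p.1 p.2}) :
    MeasurableSet {y : Y | ∀ x ∈ (c y).carrier, U x y} := by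
  have h := (measurableSet_exists_mem hc (U := fun x y => ¬ U x y) hU.compl).compl
  convert h using 1
  ext y
  simp

theorem countable_carrier [T2Space X] [LocallyCompactSpace X] [SecondCountableTopology X]
    [OpensMeasurableSpace X] (ζ : PointConfig X) : ζ.carrier.Countable := by
  cases isEmpty_or_nonempty X
  · exact Set.Subsingleton.countable Set.subsingleton_of_subsingleton
  obtain ⟨κ, _, e, s, -, -, hes⟩ := exists_enumeration (X := X)
  refine (Set.countable_range fun i => e i ζ).mono fun x hx => ?_
  obtain ⟨i, -, hi⟩ := (hes ζ x).1 hx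
  exact ⟨i, hi⟩

/-- The points of `ζ` in `W`. -/
def restrict (W : Set X) (ζ : PointConfig X) : PointConfig X where
  carrier := ζ.carrier ∩ W
  locallyFinite K hK := (ζ.locallyFinite K hK).subset
    (inter_subset_inter_left _ inter_subset_left)

theorem measurable_restrict [T2Space X] [SecondCountableTopology X] [OpensMeasurableSpace X]
    {W : Set X} (hW : MeasurableSet W) : Measurable (restrict W) :=
  measurable_of_void fun B hB => by
    simpa only [restrict, inter_assoc] using measurableSet_void (hW.inter hB)

end Measurability

end PointConfig

/-! ### Poisson processes through their void probabilities. -/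

/-- The law `Q` of a random point configuration has the void probabilities of a Poisson process of
intensity `μ`. -/
structure HasPoissonVoids {X : Type*} [TopologicalSpace X] [MeasurableSpace X]
    (Q : Measure (PointConfig X)) (μ : Measure X) : Prop where
  prob : IsProbabilityMeasure Q
  void : ∀ B : Set X, MeasurableSet B → μ B ≠ ∞ →
    Q {ζ | ζ.carrier ∩ B = ∅} = ENNReal.ofReal (Real.exp (-(μ B).toReal))

/-- Everything that follows about the process is deduced from its void probabilities alone,
including the independence over disjoint regions. -/
theorem IsPoissonProcess.hasPoissonVoids {Ω X : Type*} [MeasurableSpace Ω] [TopologicalSpace X]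
    [MeasurableSpace X] {N : Ω → PointConfig X} {μ : Measure X} {P : Measure Ω}
    [IsProbabilityMeasure P] (h : IsPoissonProcess N μ P) : HasPoissonVoids (P.map N) μ where
  prob := Measure.isProbabilityMeasure_map h.measurable.aemeasurable
  void B hB hμ := by
    rw [Measure.map_apply h.measurable (PointConfig.measurableSet_void hB)]
    have h1 : N ⁻¹' {ζ | ζ.carrier ∩ B = ∅} = (fun ω => (N ω).count B) ⁻¹' {0} := by
      ext ω; simp [PointConfig.count]
    have h2 : (fun n : ℕ => (n : ℕ∞)) ⁻¹' {0} = {0} := by ext n; simp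
    have h3 : Measurable fun ω => (N ω).count B :=
      (PointConfig.measurable_count hB).comp h.measurable
    rw [h1, ← Measure.map_apply h3 trivial, h.map_count B hB hμ, Measure.map_apply (measurable_of_countable _) (measurableSet_singleton 0), h2,
      poissonMeasure_singleton]
    simp only [pow_zero, mul_one, Nat.factorial_zero, Nat.cast_one, div_one]
    rfl

namespace HasPoissonVoids

variable {X : Type*} [TopologicalSpace X] [MeasurableSpace X] {Q : Measure (PointConfig X)}
  {μ : Measure X}

/-- Rényi's uniqueness theorem: the void events in sets of finite measure form a π-system that
generates the σ-algebra. -/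
theorem ext [T2Space X] [SecondCountableTopology X] [OpensMeasurableSpace X] [SigmaFinite μ]
    {Q' : Measure (PointConfig X)} (h : HasPoissonVoids Q μ) (h' : HasPoissonVoids Q' μ) :
    Q = Q' := by
  have := h.prob
  have := h'.prob
  refine ext_of_generate_finite _ (PointConfig.instMeasurableSpace_eq_generateFrom
    (monotone_spanningSets μ) (iUnion_spanningSets μ) (measurableSet_spanningSets μ))
    (PointConfig.isPiSystem_voids (monotone_spanningSets μ)) ?_ (by simp)
  rintro _ ⟨B, hB, ⟨n, hn⟩, rfl⟩
  have : μ B ≠ ∞ := ((measure_mono hn).trans_lt (measure_spanningSets_lt_top μ n)).ne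
  rw [h.void B hB this, h'.void B hB this]

/-- This is `1 - exp (-x) ≤ x`. It serves both for null sets (general position) and for small
densities (percolation). -/
theorem hit (h : HasPoissonVoids Q μ) {B : Set X} (hB : MeasurableSet B) :
    Q {ζ | (ζ.carrier ∩ B).Nonempty} ≤ μ B := by
  by_cases hμ : μ B = ∞
  · simp [hμ]
  have := h.prob
  have hc : {ζ : PointConfig X | (ζ.carrier ∩ B).Nonempty} = {ζ | ζ.carrier ∩ B = ∅}ᶜ := by
    ext ζ; simp [nonempty_iff_ne_empty]
  rw [hc, prob_compl_eq_one_sub (PointConfig.measurableSet_void hB), h.void B hB hμ,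
    ← ENNReal.ofReal_one, ← ENNReal.ofReal_sub _ (Real.exp_pos _).le]
  rw [← ENNReal.ofReal_toReal hμ]
  rw [ENNReal.toReal_ofReal ENNReal.toReal_nonneg]
  refine ENNReal.ofReal_le_ofReal ?_
  linarith [Real.add_one_le_exp (-(μ B).toReal)]

/-- Exhaust `B` by subsets of finite measure; their void probabilities `exp (-m)` tend to `0`. -/
theorem void_eq_zero [SigmaFinite μ] (h : HasPoissonVoids Q μ) {B : Set X}
    (hB : MeasurableSet B) (hμ : μ B = ∞) : Q {ζ | ζ.carrier ∩ B = ∅} = 0 := by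
  have ht : Tendsto (fun n => μ (B ∩ spanningSets μ n)) atTop (𝓝 ∞) := by
    have := tendsto_measure_iUnion_atTop (μ := μ) (s := fun n => B ∩ spanningSets μ n)
      fun m n hmn => inter_subset_inter_right _ (monotone_spanningSets μ hmn)
    rwa [← inter_iUnion, iUnion_spanningSets, inter_univ, hμ] at this
  have hfin : ∀ n, μ (B ∩ spanningSets μ n) ≠ ∞ := fun n =>
    ((measure_mono inter_subset_right).trans_lt (measure_spanningSets_lt_top μ n)).ne
  have ht' : Tendsto (fun n => (μ (B ∩ spanningSets μ n)).toReal) atTop atTop := by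
    refine tendsto_atTop.2 fun r => ?_
    filter_upwards [ht.eventually (lt_mem_nhds (ENNReal.ofReal_lt_top (r := r)))] with n hn
    exact (ENNReal.ofReal_le_iff_le_toReal (hfin n)).1 hn.le
  have hlim : Tendsto (fun n => ENNReal.ofReal (Real.exp (-(μ (B ∩ spanningSets μ n)).toReal)))
      atTop (𝓝 0) := by
    rw [← ENNReal.ofReal_zero]
    exact ENNReal.tendsto_ofReal (Real.tendsto_exp_neg_atTop_nhds_zero.comp ht')
  refine le_antisymm (ge_of_tendsto' hlim fun n => ?_) bot_le
  rw [← h.void _ (hB.inter (measurableSet_spanningSets μ n)) (hfin n)]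
  refine measure_mono fun ζ hζ => ?_
  have hζ' : ζ.carrier ∩ B = ∅ := hζ
  change ζ.carrier ∩ (B ∩ spanningSets μ n) = ∅
  rw [← inter_assoc, hζ', empty_inter]

/-- The restrictions of a Poisson process to disjoint sets are independent. -/
theorem iIndep_restrict [T2Space X] [SecondCountableTopology X] [OpensMeasurableSpace X]
    [SigmaFinite μ] (h : HasPoissonVoids Q μ) {ι : Type*} {W : ι → Set X}
    (hW : ∀ i, MeasurableSet (W i)) (hd : Pairwise fun i j => Disjoint (W i) (W j)) :
    iIndep (fun i => MeasurableSpace.comap (PointConfig.restrict (W i))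
      PointConfig.instMeasurableSpace) Q := by
  classical
  have := h.prob
  have hmono := monotone_spanningSets μ
  refine iIndepSets.iIndep (fun i => (PointConfig.measurable_restrict (hW i)).comap_le)
    (fun i => preimage (PointConfig.restrict (W i)) '' PointConfig.voids (spanningSets μ))
    (fun i => (PointConfig.isPiSystem_voids hmono).comap _) (fun i => ?_) ?_
  · rw [PointConfig.instMeasurableSpace_eq_generateFrom hmono (iUnion_spanningSets μ)
      (measurableSet_spanningSets μ), MeasurableSpace.comap_generateFrom]
  · rw [iIndepSets_iff]
    intro s f hf
    choose! g hg hgf using hf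
    have hg' : ∀ i ∈ s, ∃ B : Set X, MeasurableSet B ∧ (∃ n, B ⊆ spanningSets μ n) ∧
        g i = {ζ | ζ.carrier ∩ B = ∅} := hg
    choose! B hB hn hgB using hg'
    choose! n hn using hn
    have hfin : ∀ i ∈ s, μ (W i ∩ B i) ≠ ∞ := fun i hi =>
      ((measure_mono (inter_subset_right.trans (hn i hi))).trans_lt
        (measure_spanningSets_lt_top μ _)).ne
    have hfi : ∀ i ∈ s, f i = {ζ | ζ.carrier ∩ (W i ∩ B i) = ∅} := by
      intro i hi
      rw [← hgf i hi, hgB i hi]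
      ext ζ
      simp [PointConfig.restrict, inter_assoc]
    have hm : ∀ i ∈ s, MeasurableSet (W i ∩ B i) := fun i hi => (hW i).inter (hB i hi)
    have hInter : ⋂ i ∈ s, f i = {ζ | ζ.carrier ∩ (⋃ i ∈ s, W i ∩ B i) = ∅} := by
      rw [iInter₂_congr hfi]
      ext ζ
      simp [inter_iUnion₂]
    -- Independence of void events in disjoint sets is additivity of `μ` turned into a product by
    -- the exponential.
    have hμ : μ (⋃ i ∈ s, W i ∩ B i) = ∑ i ∈ s, μ (W i ∩ B i) :=
      measure_biUnion_finset (fun i _ j _ hij => (hd hij).mono inter_subset_left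
        inter_subset_left) hm
    have hμfin : μ (⋃ i ∈ s, W i ∩ B i) ≠ ∞ := by
      rw [hμ]
      exact ENNReal.sum_ne_top.2 hfin
    rw [hInter, h.void _ (s.measurableSet_biUnion hm) hμfin, hμ, ENNReal.toReal_sum hfin,
      ← Finset.sum_neg_distrib, Real.exp_sum,
      ENNReal.ofReal_prod_of_nonneg fun _ _ => (Real.exp_pos _).le]
    exact Finset.prod_congr rfl fun i hi => by rw [hfi i hi, h.void _ (hm i hi) (hfin i hi)]

theorem indep_restrict [T2Space X] [SecondCountableTopology X] [OpensMeasurableSpace X]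
    [SigmaFinite μ] (h : HasPoissonVoids Q μ) {W W' : Set X} (hW : MeasurableSet W)
    (hW' : MeasurableSet W') (hd : Disjoint W W') :
    Indep (MeasurableSpace.comap (PointConfig.restrict W) PointConfig.instMeasurableSpace)
      (MeasurableSpace.comap (PointConfig.restrict W') PointConfig.instMeasurableSpace) Q := by
  refine (h.iIndep_restrict (W := ![W, W']) (fun i => ?_) fun i j hij => ?_).indep
    (i := 0) (j := 1) (by simp)
  · fin_cases i
    · exact hW
    · exact hW'
  · fin_cases i <;> fin_cases j
    · exact absurd rfl hij
    · exact hd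
    · exact hd.symm
    · exact absurd rfl hij

end HasPoissonVoids

/-! ### Spatial stationarity and ergodicity of the space-time Poisson process. -/

section SpaceTimeShift

variable {d : ℕ}

theorem volume_comap_toReal (s : Set ℝ≥0) :
    (volume : Measure ℝ).comap NNReal.toReal s = volume (NNReal.toReal '' s) :=
  NNReal.isClosedEmbedding_coe.measurableEmbedding.comap_apply _ _

instance : SigmaFinite ((volume : Measure ℝ).comap NNReal.toReal) := by
  refine ⟨⟨⟨fun n : ℕ => Iio (n : ℝ≥0), fun _ => trivial, fun n => ?_, ?_⟩⟩⟩
  · rw [volume_comap_toReal]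
    refine (measure_mono (t := Icc (0 : ℝ) n) ?_).trans_lt measure_Icc_lt_top
    rintro _ ⟨t, ht, rfl⟩
    exact ⟨t.2, by exact_mod_cast (mem_Iio.1 ht).le⟩
  · exact eq_univ_of_forall fun t => mem_iUnion.2 (exists_nat_gt t)

instance : SigmaFinite (lebesgue d) := by
  unfold lebesgue
  infer_instance

/-- Translation in space. -/
def shiftPoint (x : E d) : SpaceTime d ≃ₜ SpaceTime d :=
  (Homeomorph.addLeft x).prodCongr (Homeomorph.refl _)

@[simp] theorem shiftPoint_fst (x : E d) (p : SpaceTime d) : (shiftPoint x p).1 = x + p.1 := rfl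

@[simp] theorem shiftPoint_snd (x : E d) (p : SpaceTime d) : (shiftPoint x p).2 = p.2 := rfl

theorem measurePreserving_shiftPoint (x : E d) :
    MeasurePreserving (shiftPoint x) (lebesgue d) (lebesgue d) :=
  (measurePreserving_add_left volume x).prod (MeasurePreserving.id _)

/-- Spatial translation of a space-time configuration. -/
def shift (x : E d) (ζ : PointConfig (SpaceTime d)) : PointConfig (SpaceTime d) where
  carrier := shiftPoint x '' ζ.carrier
  locallyFinite K hK := by
    have h := ζ.locallyFinite _ ((shiftPoint x).isCompact_preimage.2 hK)
    rw [← image_inter_preimage (shiftPoint x) ζ.carrier K]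
    exact h.image _

theorem shift_void (x : E d) (ζ : PointConfig (SpaceTime d)) (B : Set (SpaceTime d)) :
    (shift x ζ).carrier ∩ B = ∅ ↔ ζ.carrier ∩ shiftPoint x ⁻¹' B = ∅ := by
  rw [← image_eq_empty (f := shiftPoint x) (s := ζ.carrier ∩ _), image_inter_preimage]
  rfl

theorem measurable_shift (x : E d) : Measurable (shift x) :=
  PointConfig.measurable_of_void fun B hB => by
    simp_rw [shift_void]
    exact PointConfig.measurableSet_void ((shiftPoint x).continuous.measurable hB)

theorem restrict_shift (W : Set (SpaceTime d)) (x : E d) (ζ : PointConfig (SpaceTime d)) :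
    PointConfig.restrict W (shift x ζ) =
      shift x (PointConfig.restrict (shiftPoint x ⁻¹' W) ζ) :=
  PointConfig.ext (image_inter_preimage _ _ _).symm

variable {Q : Measure (PointConfig (SpaceTime d))}

/-- Lebesgue measure is translation invariant, so the shifted law has the same void probabilities
and `HasPoissonVoids.ext` applies. -/
theorem HasPoissonVoids.map_shift (h : HasPoissonVoids Q (lebesgue d)) (x : E d) :
    Q.map (shift x) = Q := by
  have := h.prob
  refine HasPoissonVoids.ext (μ := lebesgue d) ⟨Measure.isProbabilityMeasure_map
    (measurable_shift x).aemeasurable, fun B hB hμ => ?_⟩ h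
  have hp := (measurePreserving_shiftPoint x).measure_preimage hB.nullMeasurableSet
  rw [Measure.map_apply (measurable_shift x) (PointConfig.measurableSet_void hB), ← hp,
    ← h.void _ ((shiftPoint x).continuous.measurable hB) (hp ▸ hμ)]
  congr 1
  ext ζ
  exact shift_void x ζ B

theorem exists_norm_gt (hd : 1 ≤ d) (r : ℝ) : ∃ x : E d, r < ‖x‖ := by
  have : Nonempty (Fin d) := ⟨⟨0, hd⟩⟩
  exact NormedSpace.exists_lt_norm ℝ (E d) r

/-- Spatial ergodicity of the Poisson process. -/
theorem HasPoissonVoids.ergodic (hd : 1 ≤ d) (h : HasPoissonVoids Q (lebesgue d))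
    {J : Set (PointConfig (SpaceTime d))} (hJ : MeasurableSet J)
    (hinv : ∀ x : E d, shift x ⁻¹' J = J) : Q J = 0 ∨ Q J = 1 := by
  have := h.prob
  let W : ℕ → Set (SpaceTime d) := fun n => Metric.ball 0 n ×ˢ univ
  have hWm : ∀ n, MeasurableSet (W n) := fun n => measurableSet_ball.prod MeasurableSet.univ
  have hWmono : Monotone W := fun m n hmn =>
    prod_mono (Metric.ball_subset_ball (by exact_mod_cast hmn)) Subset.rfl
  have hWcov : ⋃ n, W n = univ := by
    refine eq_univ_of_forall fun p => ?_
    obtain ⟨n, hn⟩ := exists_nat_gt ‖p.1‖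
    exact mem_iUnion.2 ⟨n, by simpa [W] using hn⟩
  let m : ℕ → MeasurableSpace (PointConfig (SpaceTime d)) := fun n =>
    MeasurableSpace.comap (PointConfig.restrict (W n)) PointConfig.instMeasurableSpace
  have hm : ∀ n, m n ≤ PointConfig.instMeasurableSpace := fun n =>
    (PointConfig.measurable_restrict (hWm n)).comap_le
  have hmm : Monotone m := by
    intro k n hkn
    have : PointConfig.restrict (W k) =
        PointConfig.restrict (W k) ∘ PointConfig.restrict (W n) := by
      funext ζ
      refine PointConfig.ext ?_
      change ζ.carrier ∩ W k = ζ.carrier ∩ W n ∩ W k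
      rw [inter_assoc, inter_eq_self_of_subset_right (hWmono hkn)]
    change MeasurableSpace.comap _ _ ≤ _
    rw [this, ← MeasurableSpace.comap_comp]
    exact MeasurableSpace.comap_mono (PointConfig.measurable_restrict (hWm k)).comap_le
  -- Events that depend only on the points above some ball. They form a generating algebra, hence
  -- approximate every event in measure.
  let 𝒜 : Set (Set (PointConfig (SpaceTime d))) := {A | ∃ n, MeasurableSet[m n] A}
  have h𝒜 : IsSetAlgebra 𝒜 :=
    { empty_mem := ⟨0, @MeasurableSet.empty _ (m 0)⟩
      compl_mem := fun s ⟨n, hs⟩ => ⟨n, hs.compl⟩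
      union_mem := fun s t ⟨n, hs⟩ ⟨k, ht⟩ => ⟨max n k,
        (hmm (le_max_left n k) _ hs).union (hmm (le_max_right n k) _ ht)⟩ }
  have hgen : PointConfig.instMeasurableSpace = MeasurableSpace.generateFrom 𝒜 := by
    refine le_antisymm ?_ (MeasurableSpace.generateFrom_le fun A ⟨n, hA⟩ => hm n _ hA)
    rw [PointConfig.instMeasurableSpace_eq_generateFrom hWmono hWcov hWm]
    refine MeasurableSpace.generateFrom_mono ?_
    rintro _ ⟨B, hB, ⟨n, hn⟩, rfl⟩
    refine ⟨n, _, PointConfig.measurableSet_void hB, ?_⟩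
    ext ζ
    change ζ.carrier ∩ W n ∩ B = ∅ ↔ ζ.carrier ∩ B = ∅
    rw [inter_assoc, inter_eq_self_of_subset_right hn]
  have hdense := Measure.MeasureDense.of_generateFrom_isSetAlgebra_finite (μ := Q) h𝒜 hgen
  have hshift : ∀ (x : E d) (A : Set (PointConfig (SpaceTime d))), MeasurableSet A →
      Q.real (shift x ⁻¹' A) = Q.real A := fun x A hA => by
    conv_rhs => rw [← h.map_shift x]
    rw [measureReal_def, measureReal_def, Measure.map_apply (measurable_shift x) hA]
  -- Mixing: a local approximation `A` of `J` is independent of a far translate of itself, while by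
  -- invariance both `A` and its translate approximate `J`. Hence `Q J` is nearly its own square.
  have key : ∀ ε : ℝ, 0 < ε → |Q.real J - Q.real J * Q.real J| ≤ 4 * ε := by
    intro ε hε
    obtain ⟨A, ⟨n, A', hA', rfl⟩, hJA⟩ := hdense.approx J hJ (measure_ne_top _ _) ε hε
    have hJA' : Q.real (symmDiff J (PointConfig.restrict (W n) ⁻¹' A')) ≤ ε :=
      ENNReal.toReal_le_of_le_ofReal hε.le hJA.le
    set A := PointConfig.restrict (W n) ⁻¹' A' with hAdef
    have hAm : MeasurableSet A := PointConfig.measurable_restrict (hWm n) hA'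
    -- A translation by more than the diameter bound `2 * n` of the ball makes the two windows
    -- disjoint.
    obtain ⟨x, hx⟩ := exists_norm_gt hd (2 * n : ℝ)
    have hdisj : Disjoint (W n) (shiftPoint x ⁻¹' W n) := by
      rw [Set.disjoint_left]
      rintro p ⟨hp, -⟩ ⟨hp', -⟩
      rw [mem_ball_zero_iff] at hp
      have hp'' : ‖x + p.1‖ < n := by simpa using hp'
      have := norm_sub_le (x + p.1) p.1
      rw [add_sub_cancel_right] at this
      linarith
    have hind := h.indep_restrict (hWm n) ((shiftPoint x).continuous.measurable (hWm n)) hdisj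
    have hprod : Q (A ∩ shift x ⁻¹' A) = Q A * Q (shift x ⁻¹' A) := by
      refine (Indep_iff _ _ _).1 hind _ _ ⟨A', hA', rfl⟩
        ⟨shift x ⁻¹' A', measurable_shift x hA', ?_⟩
      rw [hAdef, ← preimage_comp, ← preimage_comp]
      congr 1
      funext ζ
      exact (restrict_shift (W n) x ζ).symm
    have hprod' : Q.real (A ∩ shift x ⁻¹' A) = Q.real A * Q.real A := by
      rw [measureReal_def, hprod, ENNReal.toReal_mul]
      congr 1
      exact hshift x A hAm
    have h1 : |Q.real J - Q.real (A ∩ shift x ⁻¹' A)| ≤ 2 * ε := by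
      refine (abs_measureReal_sub_le_measureReal_symmDiff hJ.nullMeasurableSet
        (hAm.inter (measurable_shift x hAm)).nullMeasurableSet).trans ?_
      have hs : Q.real (shift x ⁻¹' (symmDiff J A)) ≤ ε := by
        rw [hshift x _ (hJ.symmDiff hAm)]
        exact hJA'
      have hsub : symmDiff J (A ∩ shift x ⁻¹' A) ⊆
          symmDiff J A ∪ shift x ⁻¹' (symmDiff J A) := by
        intro ζ hζ
        have hz : shift x ζ ∈ J ↔ ζ ∈ J := by
          conv_rhs => rw [← hinv x]
          rfl
        simp only [Set.mem_symmDiff, mem_inter_iff, mem_preimage, mem_union] at hζ ⊢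
        tauto
      calc Q.real (symmDiff J (A ∩ shift x ⁻¹' A)) ≤ _ := measureReal_mono hsub
        _ ≤ _ := measureReal_union_le _ _
        _ ≤ 2 * ε := by linarith
    have h2 : |Q.real J - Q.real A| ≤ ε :=
      (abs_measureReal_sub_le_measureReal_symmDiff hJ.nullMeasurableSet
        hAm.nullMeasurableSet).trans hJA'
    have h3 : |Q.real A * Q.real A - Q.real J * Q.real J| ≤ 2 * ε := by
      have hA1 : Q.real A ≤ 1 := measureReal_le_one
      have hJ1 : Q.real J ≤ 1 := measureReal_le_one
      have hA0 : 0 ≤ Q.real A := measureReal_nonneg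
      have hJ0 : 0 ≤ Q.real J := measureReal_nonneg
      have : Q.real A * Q.real A - Q.real J * Q.real J =
        (Q.real A + Q.real J) * (Q.real A - Q.real J) := by ring
      rw [this, abs_mul, abs_of_nonneg (by positivity), abs_sub_comm]
      exact mul_le_mul (by linarith) h2 (abs_nonneg _) (by norm_num)
    rw [hprod'] at h1
    calc _ ≤ _ := abs_sub_le _ (Q.real A * Q.real A) _
      _ ≤ _ := by linarith
  have hzero : Q.real J - Q.real J * Q.real J = 0 := by
    rw [← abs_eq_zero]
    refine le_antisymm (le_of_forall_pos_le_add fun ε hε => ?_) (abs_nonneg _)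
    have := key (ε / 4) (by positivity)
    linarith
  have hf : Q.real J * (1 - Q.real J) = 0 := by linarith
  rcases mul_eq_zero.1 hf with h0 | h1
  · left
    exact (measureReal_eq_zero_iff).1 h0
  · right
    have : Q.real J = 1 := by linarith
    rw [← ENNReal.ofReal_toReal (measure_ne_top Q J)]
    rw [measureReal_def] at this
    rw [this, ENNReal.ofReal_one]

end SpaceTimeShift

/-! ### The parking graph: decision of every point, equivariance and measurability. -/

section Graph

variable {d : ℕ} {ρ₀ : ℝ}

/-- The order of arrival. -/
def Prec (p q : SpaceTime d) : Prop := p.2 < q.2 ∨ (p.2 = q.2 ∧ LexLT p.1 q.1)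

theorem lexLT_iff {x y : E d} :
    LexLT x y ↔ toLex (x : Fin d → ℝ) < toLex (y : Fin d → ℝ) := Iff.rfl

theorem Prec.trans {p q r : SpaceTime d} (h : Prec p q) (h' : Prec q r) : Prec p r := by
  rcases h with h | ⟨h1, h2⟩ <;> rcases h' with h' | ⟨h1', h2'⟩
  · exact Or.inl (h.trans h')
  · exact Or.inl (h1' ▸ h)
  · exact Or.inl (h1.trans_lt h')
  · exact Or.inr ⟨h1.trans h1', lexLT_iff.2 ((lexLT_iff.1 h2).trans (lexLT_iff.1 h2'))⟩

theorem Prec.irrefl (p : SpaceTime d) : ¬ Prec p p := by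
  rintro (h | ⟨-, h⟩)
  · exact lt_irrefl _ h
  · exact lt_irrefl _ (lexLT_iff.1 h)

theorem Prec.le {p q : SpaceTime d} (h : Prec p q) : p.2 ≤ q.2 := by
  rcases h with h | h
  · exact h.le
  · exact h.1.le

theorem prec_or_prec {p q : SpaceTime d} (h : p ≠ q) : Prec p q ∨ Prec q p := by
  rcases lt_trichotomy p.2 q.2 with h2 | h2 | h2
  · exact Or.inl (Or.inl h2)
  · rcases lexLT_or_lexLT (x := p.1) (y := q.1) (fun h1 => h (Prod.ext h1 h2)) with h1 | h1
    · exact Or.inl (Or.inr ⟨h2, h1⟩)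
    · exact Or.inr (Or.inr ⟨h2.symm, h1⟩)
  · exact Or.inr (Or.inl h2)

/-- Two balls of radius `ρ₀` meet exactly when they both contain the midpoint of their centres. -/
theorem edge_iff {p q : SpaceTime d} : Edge ρ₀ p q ↔ dist p.1 q.1 < 2 * ρ₀ ∧ Prec p q := by
  refine and_congr_left fun _ => ⟨?_, fun h => ?_⟩
  · rintro ⟨z, hz, hz'⟩
    rw [Metric.mem_ball] at hz hz'
    linarith [dist_triangle_left p.1 q.1 z]
  · refine ⟨midpoint ℝ q.1 p.1, ?_, ?_⟩
    · rw [Metric.mem_ball, dist_midpoint_left, dist_comm]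
      norm_num
      linarith
    · rw [Metric.mem_ball, dist_midpoint_right, dist_comm]
      norm_num
      linarith

/-- The ancestors of `p` in the graph with vertex set `V`. -/
def ancestors (ρ₀ : ℝ) (V : Set (SpaceTime d)) (p : SpaceTime d) : Set (SpaceTime d) :=
  {q | Relation.TransGen (fun a b => a ∈ V ∧ Edge ρ₀ a b) q p}

theorem prec_of_mem_ancestors {V : Set (SpaceTime d)} {p q : SpaceTime d}
    (h : q ∈ ancestors ρ₀ V p) : Prec q p :=
  Relation.TransGen.trans_induction_on (motive := fun {a b} _ => Prec a b) h
    (fun h => h.2.2) fun _ _ => Prec.trans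

/-- Strictness holds because `q` is not its own ancestor, `Prec` being irreflexive. The number of
ancestors, when finite, is therefore a rank that decreases from a point to its parents. -/
theorem ancestors_ssubset {V : Set (SpaceTime d)} {p q : SpaceTime d}
    (h : q ∈ ancestors ρ₀ V p) : ancestors ρ₀ V q ⊂ ancestors ρ₀ V p := by
  refine ⟨fun r hr => Relation.TransGen.trans hr h, fun hsub => ?_⟩
  exact Prec.irrefl q (prec_of_mem_ancestors (hsub h))

theorem ancestors_mono {V V' : Set (SpaceTime d)} (h : V ⊆ V') (p : SpaceTime d) :
    ancestors ρ₀ V p ⊆ ancestors ρ₀ V' p :=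
  fun _ hq => Relation.TransGen.mono (fun _ _ hab => ⟨h hab.1, hab.2⟩) _ _ hq

/-- Parents have fewer ancestors, so by induction they have all disappeared one step earlier; a
point that is still present is then a root and disappears as well. -/
theorem notMem_remaining {V : Set (SpaceTime d)} (n : ℕ) {p : SpaceTime d}
    (hfin : (ancestors ρ₀ V p).Finite) (hn : (ancestors ρ₀ V p).ncard ≤ n) :
    p ∉ remaining ρ₀ V (n + 1) := by
  induction n generalizing p with
  | zero =>
    intro hp
    have h0 : ancestors ρ₀ V p = ∅ := (ncard_eq_zero hfin).1 (by omega)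
    refine hp.2 (Or.inl ⟨hp.1, fun q hq hqp => ?_⟩)
    have : q ∈ ancestors ρ₀ V p := Relation.TransGen.single ⟨hq, hqp⟩
    simp [h0] at this
  | succ n ih =>
    intro hp
    refine hp.2 (Or.inl ⟨hp.1, fun q hq hqp => ?_⟩)
    have hq' : q ∈ ancestors ρ₀ V p :=
      Relation.TransGen.single ⟨remaining_antitone ρ₀ V (Nat.zero_le _) hq, hqp⟩
    have hss := ancestors_ssubset hq'
    refine ih (hfin.subset hss.subset) ?_ hq
    have := ncard_lt_ncard hss hfin
    omega

/-- A vertex with finitely many ancestors is either accepted or blocked by an accepted parent. -/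
theorem accepted_or_blocked {V : Set (SpaceTime d)} {p : SpaceTime d} (hp : p ∈ V)
    (hfin : (ancestors ρ₀ V p).Finite) :
    p ∈ accepted ρ₀ V ∨ ∃ q ∈ accepted ρ₀ V, Edge ρ₀ q p := by
  classical
  -- The point is removed at some first step, and removal happens only to roots and to offspring of
  -- roots.
  have hex : ∃ n, p ∉ remaining ρ₀ V n := ⟨_, notMem_remaining _ hfin le_rfl⟩
  obtain ⟨n, hn⟩ : ∃ n, Nat.find hex = n + 1 := by
    refine Nat.exists_eq_succ_of_ne_zero fun h0 => ?_
    have := Nat.find_spec hex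
    rw [h0] at this
    exact this hp
  have h1 : p ∈ remaining ρ₀ V n := by
    by_contra h
    have := Nat.find_min' hex h
    omega
  have h2 : p ∉ remaining ρ₀ V (n + 1) := hn ▸ Nat.find_spec hex
  have h3 : p ∈ roots ρ₀ (remaining ρ₀ V n) ∪ rootOffspring ρ₀ (remaining ρ₀ V n) := by
    by_contra h
    exact h2 ⟨h1, h⟩
  rcases h3 with h3 | ⟨-, q, hq, hqp⟩
  · exact Or.inl (mem_iUnion.2 ⟨n, h3⟩)
  · exact Or.inr ⟨q, mem_iUnion.2 ⟨n, hq⟩, hqp⟩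

theorem accepted_subset (V : Set (SpaceTime d)) : accepted ρ₀ V ⊆ V := by
  intro p hp
  obtain ⟨n, hn⟩ := mem_iUnion.1 hp
  exact remaining_antitone ρ₀ V (Nat.zero_le n) hn.1

/-- Distinct points are always comparable for `Prec`, so the absence of edges is purely a matter of
distance. This gives the sharp constant, in contrast with `accepted_separated`. -/
theorem two_mul_le_dist {A : Set (SpaceTime d)} (hA : ∀ p ∈ A, ∀ q ∈ A, ¬ Edge ρ₀ p q)
    {p q : SpaceTime d} (hp : p ∈ A) (hq : q ∈ A) (hpq : p ≠ q) : 2 * ρ₀ ≤ dist p.1 q.1 := by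
  by_contra! h
  rcases prec_or_prec hpq with h' | h'
  · exact hA p hp q hq (edge_iff.2 ⟨h, h'⟩)
  · exact hA q hq p hp (edge_iff.2 ⟨dist_comm p.1 q.1 ▸ h, h'⟩)

/-- A packing bound: edge-free points have separated, in particular distinct, projections. No bound
on the arrival times is needed. -/
theorem finite_of_edge_free (hρ₀ : 0 < ρ₀) {A : Set (SpaceTime d)}
    (hA : ∀ p ∈ A, ∀ q ∈ A, ¬ Edge ρ₀ p q) {K : Set (E d)} (hK : Bornology.IsBounded K)
    (hAK : ∀ p ∈ A, p.1 ∈ K) : A.Finite := by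
  refine Set.Finite.of_finite_image (f := Prod.fst)
    ((finite_inter_of_separated (s := Prod.fst '' A) (r := 2 * ρ₀) (by positivity) ?_
      hK.isCompact_closure).subset ?_) ?_
  · rintro _ ⟨p, hp, rfl⟩ _ ⟨q, hq, rfl⟩ hne
    exact two_mul_le_dist hA hp hq fun h => hne (h ▸ rfl)
  · rintro _ ⟨p, hp, rfl⟩
    exact ⟨mem_image_of_mem _ hp, subset_closure (hAK p hp)⟩
  · intro p hp q hq hpq
    by_contra hne
    have := two_mul_le_dist hA hp hq hne
    rw [hpq, dist_self] at this
    linarith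

theorem edge_shiftPoint (x : E d) {p q : SpaceTime d} :
    Edge ρ₀ (shiftPoint x p) (shiftPoint x q) ↔ Edge ρ₀ p q := by
  simp only [edge_iff, Prec, LexLT, shiftPoint_fst, shiftPoint_snd, dist_add_left,
    PiLp.add_apply, add_right_inj, add_lt_add_iff_left]

theorem roots_shiftPoint (x : E d) (V : Set (SpaceTime d)) :
    roots ρ₀ (shiftPoint x '' V) = shiftPoint x '' roots ρ₀ V := by
  ext p
  constructor
  · rintro ⟨⟨q, hq, rfl⟩, h⟩
    exact ⟨q, ⟨hq, fun r hr hrq => h _ (mem_image_of_mem _ hr) ((edge_shiftPoint x).2 hrq)⟩, rfl⟩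
  · rintro ⟨q, ⟨hq, h⟩, rfl⟩
    refine ⟨mem_image_of_mem _ hq, ?_⟩
    rintro _ ⟨r, hr, rfl⟩ hrq
    exact h r hr ((edge_shiftPoint x).1 hrq)

theorem rootOffspring_shiftPoint (x : E d) (V : Set (SpaceTime d)) :
    rootOffspring ρ₀ (shiftPoint x '' V) = shiftPoint x '' rootOffspring ρ₀ V := by
  ext p
  constructor
  · rintro ⟨⟨q, hq, rfl⟩, r, hr, h⟩
    rw [roots_shiftPoint] at hr
    obtain ⟨r, hr, rfl⟩ := hr
    exact ⟨q, ⟨hq, r, hr, (edge_shiftPoint x).1 h⟩, rfl⟩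
  · rintro ⟨q, ⟨hq, r, hr, h⟩, rfl⟩
    refine ⟨mem_image_of_mem _ hq, shiftPoint x r, ?_, (edge_shiftPoint x).2 h⟩
    rw [roots_shiftPoint]
    exact mem_image_of_mem _ hr

theorem remaining_shiftPoint (x : E d) (V : Set (SpaceTime d)) (n : ℕ) :
    remaining ρ₀ (shiftPoint x '' V) n = shiftPoint x '' remaining ρ₀ V n := by
  induction n with
  | zero => rfl
  | succ n ih =>
    rw [remaining, ih, roots_shiftPoint, rootOffspring_shiftPoint, ← image_union,
      ← image_sdiff (shiftPoint x).injective]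
    rfl

theorem accepted_shiftPoint (x : E d) (V : Set (SpaceTime d)) :
    accepted ρ₀ (shiftPoint x '' V) = shiftPoint x '' accepted ρ₀ V := by
  simp only [accepted, remaining_shiftPoint, roots_shiftPoint, image_iUnion]

/-- Edges depend only on relative positions and on times, so every step of the construction commutes
with spatial translations. -/
theorem parking_shift (hρ₀ : 0 < ρ₀) (x : E d) (ζ : PointConfig (SpaceTime d)) :
    parking hρ₀ univ (shift x ζ) = (parking hρ₀ univ ζ).translate x := by
  refine PointConfig.ext ?_
  change Prod.fst '' accepted ρ₀ (shiftPoint x '' ζ.carrier ∩ univ ×ˢ univ) =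
    (fun y => x + y) '' (Prod.fst '' accepted ρ₀ (ζ.carrier ∩ univ ×ˢ univ))
  rw [univ_prod_univ, inter_univ, inter_univ, accepted_shiftPoint, image_image, image_image]
  rfl

theorem parking_univ_carrier (hρ₀ : 0 < ρ₀) (ζ : PointConfig (SpaceTime d)) :
    (parking hρ₀ univ ζ).carrier = Prod.fst '' accepted ρ₀ ζ.carrier := by
  change Prod.fst '' accepted ρ₀ (ζ.carrier ∩ univ ×ˢ univ) = _
  rw [univ_prod_univ, inter_univ]

theorem measurableSet_lexLT : MeasurableSet {p : E d × E d | LexLT p.1 p.2} := by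
  have hm : ∀ j, Measurable fun p : E d × E d => p.1 j := fun j => by fun_prop
  have hm' : ∀ j, Measurable fun p : E d × E d => p.2 j := fun j => by fun_prop
  have : {p : E d × E d | LexLT p.1 p.2} =
      ⋃ i, ((⋂ j, ⋂ (_ : j < i), {p | p.1 j = p.2 j}) ∩ {p | p.1 i < p.2 i}) := by
    ext p
    simp [LexLT]
  rw [this]
  exact MeasurableSet.iUnion fun i => (MeasurableSet.iInter fun j => MeasurableSet.iInter fun _ =>
    measurableSet_eq_fun (hm j) (hm' j)).inter (measurableSet_lt (hm i) (hm' i))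

theorem measurableSet_edge (ρ₀ : ℝ) :
    MeasurableSet {p : SpaceTime d × SpaceTime d | Edge ρ₀ p.1 p.2} := by
  simp only [edge_iff, Prec, ofPred_and, ofPred_or]
  have h : Measurable fun p : SpaceTime d × SpaceTime d => (p.1.1, p.2.1) := by fun_prop
  exact (measurableSet_lt (by fun_prop) measurable_const).inter
    ((measurableSet_lt (by fun_prop) (by fun_prop)).union
      ((measurableSet_eq_fun (by fun_prop) (by fun_prop)).inter (h measurableSet_lexLT)))

theorem Edge.measurableSet {Y : Type*} [MeasurableSpace Y] {f g : Y → SpaceTime d}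
    (hf : Measurable f) (hg : Measurable g) : MeasurableSet {y | Edge ρ₀ (f y) (g y)} :=
  (hf.prodMk hg) (measurableSet_edge ρ₀)

theorem measurableSet_mem_carrier {Y : Type*} [MeasurableSpace Y] {f : Y → SpaceTime d}
    {c : Y → PointConfig (SpaceTime d)} (hf : Measurable f) (hc : Measurable c) :
    MeasurableSet {y | f y ∈ (c y).carrier} := by
  have := PointConfig.measurableSet_exists_mem hc (U := fun x y => x = f y)
    (measurableSet_eq_fun measurable_fst (hf.comp measurable_snd))
  simpa using this

/-- Measurability is stated jointly in a point and a configuration so that the steps of the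
construction can be iterated. Since `V ζ ⊆ ζ.carrier`, the quantifier over possible parents runs
over the points of the configuration. -/
theorem measurableSet_roots {V : PointConfig (SpaceTime d) → Set (SpaceTime d)}
    (hV : ∀ ζ, V ζ ⊆ ζ.carrier)
    (hVm : MeasurableSet {p : SpaceTime d × PointConfig (SpaceTime d) | p.1 ∈ V p.2}) :
    MeasurableSet {p : SpaceTime d × PointConfig (SpaceTime d) | p.1 ∈ roots ρ₀ (V p.2)} := by
  have h1 : {p : SpaceTime d × PointConfig (SpaceTime d) | p.1 ∈ roots ρ₀ (V p.2)} =
      {p | p.1 ∈ V p.2} ∩ {p | ∀ q ∈ p.2.carrier, q ∈ V p.2 → ¬ Edge ρ₀ q p.1} := by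
    ext p
    exact and_congr_right fun _ => ⟨fun h q _ hq => h q hq, fun h q hq => h q (hV _ hq) hq⟩
  rw [h1]
  refine hVm.inter (PointConfig.measurableSet_forall_mem (c := Prod.snd) measurable_snd
    (U := fun q p => q ∈ V p.2 → ¬ Edge ρ₀ q p.1) ?_)
  have hm : Measurable fun p : SpaceTime d × (SpaceTime d × PointConfig (SpaceTime d)) =>
      (p.1, p.2.2) := by fun_prop
  exact MeasurableSet.imp (hm hVm)
    (Edge.measurableSet measurable_fst (measurable_fst.comp measurable_snd)).compl

theorem measurableSet_rootOffspring {V : PointConfig (SpaceTime d) → Set (SpaceTime d)}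
    (hV : ∀ ζ, V ζ ⊆ ζ.carrier)
    (hVm : MeasurableSet {p : SpaceTime d × PointConfig (SpaceTime d) | p.1 ∈ V p.2}) :
    MeasurableSet {p : SpaceTime d × PointConfig (SpaceTime d) |
      p.1 ∈ rootOffspring ρ₀ (V p.2)} := by
  have h1 : {p : SpaceTime d × PointConfig (SpaceTime d) | p.1 ∈ rootOffspring ρ₀ (V p.2)} =
      {p | p.1 ∈ V p.2} ∩ {p | ∃ q ∈ p.2.carrier, q ∈ roots ρ₀ (V p.2) ∧ Edge ρ₀ q p.1} := by
    ext p
    exact and_congr_right fun _ => ⟨fun ⟨q, h, h'⟩ => ⟨q, hV _ h.1, h, h'⟩,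
      fun ⟨q, _, h⟩ => ⟨q, h⟩⟩
  rw [h1]
  refine hVm.inter (PointConfig.measurableSet_exists_mem (c := Prod.snd) measurable_snd
    (U := fun q p => q ∈ roots ρ₀ (V p.2) ∧ Edge ρ₀ q p.1) ?_)
  have hm : Measurable fun p : SpaceTime d × (SpaceTime d × PointConfig (SpaceTime d)) =>
      (p.1, p.2.2) := by fun_prop
  exact MeasurableSet.inter (hm (measurableSet_roots hV hVm))
    (Edge.measurableSet measurable_fst (measurable_fst.comp measurable_snd))

theorem measurableSet_remaining (n : ℕ) :
    MeasurableSet {p : SpaceTime d × PointConfig (SpaceTime d) |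
      p.1 ∈ remaining ρ₀ p.2.carrier n} := by
  induction n with
  | zero => exact measurableSet_mem_carrier measurable_fst measurable_snd
  | succ n ih =>
    have hV : ∀ ζ : PointConfig (SpaceTime d), remaining ρ₀ ζ.carrier n ⊆ ζ.carrier :=
      fun ζ => remaining_antitone ρ₀ ζ.carrier (Nat.zero_le n)
    exact ih.diff ((measurableSet_roots hV ih).union (measurableSet_rootOffspring hV ih))

theorem measurableSet_accepted :
    MeasurableSet {p : SpaceTime d × PointConfig (SpaceTime d) |
      p.1 ∈ accepted ρ₀ p.2.carrier} := by
  simp only [accepted, mem_iUnion, ofPred_exists]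
  exact MeasurableSet.iUnion fun n => measurableSet_roots
    (fun ζ => remaining_antitone ρ₀ ζ.carrier (Nat.zero_le n)) (measurableSet_remaining n)

theorem measurable_parking (hρ₀ : 0 < ρ₀) :
    Measurable (parking hρ₀ (univ : Set (E d))) := by
  refine PointConfig.measurable_of_void fun B hB => ?_
  have : {ζ | (parking hρ₀ univ ζ).carrier ∩ B = ∅} =
      {ζ : PointConfig (SpaceTime d) | ∃ p ∈ ζ.carrier, p ∈ accepted ρ₀ ζ.carrier ∧ p.1 ∈ B}ᶜ := by
    ext ζ
    rw [mem_compl_iff, mem_ofPred_eq, ← not_nonempty_iff_eq_empty, parking_univ_carrier]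
    refine not_congr ⟨?_, ?_⟩
    · rintro ⟨_, ⟨p, hp, rfl⟩, hpB⟩
      exact ⟨p, accepted_subset _ hp, hp, hpB⟩
    · rintro ⟨p, -, hp, hpB⟩
      exact ⟨p.1, mem_image_of_mem _ hp, hpB⟩
  rw [this]
  refine (PointConfig.measurableSet_exists_mem measurable_id
    (U := fun p ζ => p ∈ accepted ρ₀ ζ.carrier ∧ p.1 ∈ B) ?_).compl
  exact measurableSet_accepted.inter ((measurable_fst.comp measurable_fst) hB)

theorem measurable_translate (x : E d) : Measurable (PointConfig.translate x) := by
  refine PointConfig.measurable_of_void fun B hB => ?_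
  have : ∀ ζ : PointConfig (E d), (ζ.translate x).carrier ∩ B = ∅ ↔
      ζ.carrier ∩ (fun y => x + y) ⁻¹' B = ∅ := fun ζ => by
    rw [← image_eq_empty (f := fun y => x + y) (s := ζ.carrier ∩ _), image_inter_preimage]
    rfl
  simp_rw [this]
  exact PointConfig.measurableSet_void (measurable_const_add x hB)

variable {Q : Measure (PointConfig (SpaceTime d))}

theorem isStationary_parking (h : HasPoissonVoids Q (lebesgue d)) (hρ₀ : 0 < ρ₀) :
    IsStationary (Q.map (parking hρ₀ univ)) := by
  intro x
  rw [Measure.map_map (measurable_translate x) (measurable_parking hρ₀)]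
  have : PointConfig.translate x ∘ parking hρ₀ univ = parking hρ₀ univ ∘ shift x :=
    funext fun ζ => (parking_shift hρ₀ x ζ).symm
  rw [this, ← Measure.map_map (measurable_parking hρ₀) (measurable_shift x), h.map_shift]

/-- By equivariance, invariant events pull back to shift-invariant events of the Poisson process. -/
theorem isErgodic_parking (hd : 1 ≤ d) (h : HasPoissonVoids Q (lebesgue d)) (hρ₀ : 0 < ρ₀) :
    IsErgodic (Q.map (parking hρ₀ univ)) := by
  intro I hI hinv
  rw [Measure.map_apply (measurable_parking hρ₀) hI]
  refine h.ergodic hd (measurable_parking hρ₀ hI) fun x => ?_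
  conv_rhs => rw [← hinv x]
  ext ζ
  simp only [mem_preimage, parking_shift]

end Graph

/-! ### General position and density of the Poisson points. -/

section GeneralPosition

variable {d : ℕ} {F : Type*} [NormedAddCommGroup F] [NormedSpace ℝ F]

/-- Finite-dimensional subspaces are closed and rational coefficients are dense. Membership in a
span is thus expressed by countable operations, which yields its measurability in `v` and `w`. -/
theorem mem_span_range_iff_forall_exists_rat [FiniteDimensional ℝ F] {m : ℕ} (v : Fin m → F)
    (w : F) : w ∈ Submodule.span ℝ (range v) ↔
      ∀ k : ℕ, ∃ c : Fin m → ℚ, ‖w - ∑ i, (c i : ℝ) • v i‖ < 1 / (k + 1) := by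
  constructor
  · intro h k
    obtain ⟨c, hc⟩ := (Submodule.mem_span_range_iff_exists_fun ℝ).1 h
    have hcont : Continuous fun c : Fin m → ℝ => ‖w - ∑ i, c i • v i‖ := by fun_prop
    have hden : DenseRange (Pi.map fun (_ : Fin m) (q : ℚ) => (q : ℝ)) :=
      DenseRange.piMap fun _ => Rat.denseRange_cast
    obtain ⟨q, hq⟩ := hden.exists_mem_open (s := {c | ‖w - ∑ i, c i • v i‖ < 1 / (k + 1 : ℝ)})
      (isOpen_lt hcont continuous_const) ⟨c, by
        simp only [mem_ofPred_eq, hc, sub_self, norm_zero]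
        positivity⟩
    exact ⟨q, hq⟩
  · intro h
    have hcl : IsClosed (Submodule.span ℝ (range v) : Set F) :=
      Submodule.closed_of_finiteDimensional _
    rw [← SetLike.mem_coe, ← hcl.closure_eq, Metric.mem_closure_iff]
    intro ε hε
    obtain ⟨k, hk⟩ := exists_nat_one_div_lt hε
    obtain ⟨c, hc⟩ := h k
    refine ⟨∑ i, (c i : ℝ) • v i, Submodule.sum_mem _ fun i _ => Submodule.smul_mem _ _
      (Submodule.subset_span (mem_range_self i)), ?_⟩
    rw [dist_eq_norm]
    exact hc.trans hk

theorem measurableSet_mem_span [FiniteDimensional ℝ F] [MeasurableSpace F] [BorelSpace F]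
    {m : ℕ} {Y : Type*} [MeasurableSpace Y] {w : Y → F} {v : Fin m → Y → F} (hw : Measurable w)
    (hv : ∀ i, Measurable (v i)) :
    MeasurableSet {y | w y ∈ Submodule.span ℝ (range fun i => v i y)} := by
  simp only [mem_span_range_iff_forall_exists_rat, ofPred_forall, ofPred_exists]
  refine MeasurableSet.iInter fun k => MeasurableSet.iUnion fun c => ?_
  refine measurableSet_lt (Measurable.norm (hw.sub ?_)) measurable_const
  exact Finset.measurable_sum _ fun i _ => (hv i).const_smul _

/-- No point of `s` is sent by `φ` to the span of the images of `m` other points. -/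
def GenPos (φ : E d → F) (m : ℕ) (s : Set (E d)) : Prop :=
  ∀ x ∈ s, ∀ y : Fin m → E d, (∀ i, y i ∈ s) → (∀ i, y i ≠ x) →
    φ x ∉ Submodule.span ℝ (range fun i => φ (y i))

theorem GenPos.mono {φ : E d → F} {m : ℕ} {s t : Set (E d)} (h : GenPos φ m t) (hst : s ⊆ t) :
    GenPos φ m s :=
  fun x hx y hy => h x (hst hx) y fun i => hst (hy i)

/-- The `m + 1` images lie in the kernel of a nonzero functional on a space of dimension `m + 1`, so
they are dependent and one of them lies in the span of the other `m`. -/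
theorem GenPos.false_of_card_eq [FiniteDimensional ℝ F] {φ : E d → F} {m : ℕ} {s : Set (E d)}
    (h : GenPos φ m s) (hF : Module.finrank ℝ F = m + 1) {t : Finset (E d)}
    (hts : (t : Set (E d)) ⊆ s) (ht : t.card = m + 1) {f : F →ₗ[ℝ] ℝ} (hf : f ≠ 0)
    (hft : ∀ x ∈ t, f (φ x) = 0) : False := by
  classical
  have hli : ¬ LinearIndependent ℝ fun x : t => φ x := by
    intro hli
    have h1 := finrank_span_eq_card hli
    rw [Fintype.card_coe, ht, ← hF] at h1
    have h2 := Submodule.eq_top_of_finrank_eq h1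
    have h3 : Submodule.span ℝ (range fun x : t => φ x) ≤ LinearMap.ker f := by
      rw [Submodule.span_le]
      rintro _ ⟨x, rfl⟩
      exact hft x x.2
    rw [h2, top_le_iff, LinearMap.ker_eq_top] at h3
    exact hf h3
  rw [linearIndependent_iff_notMem_span] at hli
  push Not at hli
  obtain ⟨x, hx⟩ := hli
  have hcard : (t.erase x.1).card = m := by rw [Finset.card_erase_of_mem x.2, ht]; rfl
  let e := ((t.erase x.1).equivFinOfCardEq hcard).symm
  refine h x (hts x.2) (fun i => (e i : E d))
    (fun i => hts (Finset.mem_of_mem_erase (e i).2)) (fun i => Finset.ne_of_mem_erase (e i).2) ?_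
  refine Submodule.span_mono ?_ hx
  rintro _ ⟨y, ⟨-, hy⟩, rfl⟩
  have hy' : (y : E d) ∈ t.erase x.1 :=
    Finset.mem_erase.2 ⟨fun h => hy (Subtype.ext h), y.2⟩
  refine ⟨e.symm ⟨y, hy'⟩, ?_⟩
  simp

theorem measurableSet_genPos [FiniteDimensional ℝ F] [MeasurableSpace F] [BorelSpace F]
    {φ : E d → F} (hφ : Continuous φ) (m : ℕ) :
    MeasurableSet {ζ : PointConfig (E d) | GenPos φ m ζ.carrier} := by
  refine PointConfig.measurableSet_forall_mem measurable_id ?_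
  have h1 := PointConfig.measurableSet_exists_tuple (X := E d) (ι := Fin m)
    (Y := E d × PointConfig (E d)) measurable_snd
    (U := fun y p => (∀ i, y i ≠ p.1) ∧ φ p.1 ∈ Submodule.span ℝ (range fun i => φ (y i))) ?_
  · convert h1.compl using 1
    ext p
    simp
  · simp only [ofPred_and, ofPred_forall]
    refine MeasurableSet.inter (MeasurableSet.iInter fun i => ?_) ?_
    · exact (measurableSet_eq_fun (by fun_prop) (by fun_prop)).compl
    · exact measurableSet_mem_span (hφ.measurable.comp (by fun_prop))
        fun i => hφ.measurable.comp (by fun_prop)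

theorem lebesgue_prod_univ_eq_zero {s : Set (E d)} (hs : volume s = 0) :
    lebesgue d (s ×ˢ univ) = 0 := by
  rw [lebesgue, Measure.prod_prod, hs, zero_mul]

variable {Q : Measure (PointConfig (SpaceTime d))}

/-- Fubini with spatial independence: given the points outside an open set `U`, the positions
spanned by `m` of them form a countable union of null sets, which the independent points above `U`
almost surely avoid. Countably many `U` suffice to isolate a point from `m` others. -/
theorem HasPoissonVoids.ae_genPos (h : HasPoissonVoids Q (lebesgue d)) [FiniteDimensional ℝ F]
    [MeasurableSpace F] [BorelSpace F] {φ : E d → F} (hφ : Continuous φ)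
    (hnull : ∀ V : Submodule ℝ F, V ≠ ⊤ → volume (φ ⁻¹' V) = 0) {m : ℕ}
    (hm : m < Module.finrank ℝ F) : ∀ᵐ ζ ∂Q, GenPos φ m (Prod.fst '' ζ.carrier) := by
  have := h.prob
  have hb := TopologicalSpace.isBasis_countableBasis (E d)
  let Bad : SpaceTime d → PointConfig (SpaceTime d) → Prop := fun x η =>
    ∃ y : Fin m → SpaceTime d, (∀ i, y i ∈ η.carrier) ∧
      φ x.1 ∈ Submodule.span ℝ (range fun i => φ (y i).1)
  have hBad : MeasurableSet {p : SpaceTime d × PointConfig (SpaceTime d) | Bad p.1 p.2} := by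
    refine PointConfig.measurableSet_exists_tuple (X := SpaceTime d) (ι := Fin m)
      (Y := SpaceTime d × PointConfig (SpaceTime d)) measurable_snd
      (U := fun y p => φ p.1.1 ∈ Submodule.span ℝ (range fun i => φ (y i).1)) ?_
    exact measurableSet_mem_span (hφ.measurable.comp (by fun_prop))
      fun i => hφ.measurable.comp (by fun_prop)
  have hBadnull : ∀ η, lebesgue d {x | Bad x η} = 0 := by
    intro η
    have hc : (Set.pi univ fun _ : Fin m => η.carrier).Countable :=
      Set.countable_univ_pi fun _ => PointConfig.countable_carrier η
    -- A configuration has countably many `m`-tuples, and `m` vectors do not span `F`.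
    refine measure_mono_null (t := ⋃ y ∈ Set.pi univ fun _ : Fin m => η.carrier,
      (φ ⁻¹' Submodule.span ℝ (range fun i => φ (y i).1)) ×ˢ univ) ?_
      ((measure_biUnion_null_iff hc).2 fun y _ => lebesgue_prod_univ_eq_zero (hnull _ ?_))
    · rintro x ⟨y, hy, hx⟩
      exact mem_iUnion₂.2 ⟨y, fun i _ => hy i, hx, trivial⟩
    · intro htop
      have h1 := finrank_range_le_card (R := ℝ) fun i => φ (y i).1
      rw [Set.finrank, htop, finrank_top, Fintype.card_fin] at h1
      omega
  have key : ∀ U ∈ TopologicalSpace.countableBasis (E d), ∀ᵐ ζ ∂Q,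
      ¬ ∃ x ∈ (PointConfig.restrict (U ×ˢ univ) ζ).carrier,
        Bad x (PointConfig.restrict (Uᶜ ×ˢ univ) ζ) := by
    intro U hU
    have hUm := (hb.isOpen hU).measurableSet
    have hU1 : MeasurableSet (U ×ˢ (univ : Set ℝ≥0)) := hUm.prod MeasurableSet.univ
    have hU2 : MeasurableSet (Uᶜ ×ˢ (univ : Set ℝ≥0)) := hUm.compl.prod MeasurableSet.univ
    have hf := PointConfig.measurable_restrict hU1
    have hg := PointConfig.measurable_restrict hU2
    have hind : IndepFun (PointConfig.restrict (Uᶜ ×ˢ (univ : Set ℝ≥0)))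
        (PointConfig.restrict (U ×ˢ (univ : Set ℝ≥0))) Q := by
      rw [IndepFun_iff_Indep]
      refine h.indep_restrict hU2 hU1 (Set.disjoint_left.2 ?_)
      rintro p ⟨hp, -⟩ ⟨hp', -⟩
      exact hp hp'
    rw [indepFun_iff_map_prod_eq_prod_map_map hg.aemeasurable hf.aemeasurable] at hind
    have hS : MeasurableSet {p : PointConfig (SpaceTime d) × PointConfig (SpaceTime d) |
        ∃ x ∈ p.2.carrier, Bad x p.1} := by
      refine PointConfig.measurableSet_exists_mem measurable_snd (U := fun x p => Bad x p.1) ?_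
      exact (measurable_fst.prodMk (measurable_fst.comp measurable_snd)) hBad
    have hzero : Q.map (fun ζ => (PointConfig.restrict (Uᶜ ×ˢ (univ : Set ℝ≥0)) ζ,
        PointConfig.restrict (U ×ˢ (univ : Set ℝ≥0)) ζ))
        {p | ∃ x ∈ p.2.carrier, Bad x p.1} = 0 := by
      have := Measure.isProbabilityMeasure_map hf.aemeasurable (μ := Q)
      rw [hind, Measure.measure_prod_null hS]
      refine Eventually.of_forall fun η => ?_
      have hBη : MeasurableSet {x | Bad x η} := (measurable_id.prodMk measurable_const) hBad
      change Q.map _ (Prod.mk η ⁻¹' _) = 0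
      rw [Measure.map_apply hf (measurable_prodMk_left hS)]
      refine le_antisymm ((measure_mono ?_).trans ((h.hit hBη).trans (hBadnull η).le)) bot_le
      rintro ζ ⟨x, hx, hxB⟩
      exact ⟨x, hx.1, hxB⟩
    rw [Measure.map_apply (hg.prodMk hf) hS] at hzero
    exact measure_eq_zero_iff_ae_notMem.1 hzero
  have hall := (ae_ball_iff (TopologicalSpace.countable_countableBasis (E d))).2 key
  filter_upwards [hall] with ζ hζ
  rintro _ ⟨x, hx, rfl⟩ y hy hyx hspan
  choose z hz hzy using hy
  -- The neighbourhood `U` of `x.1` avoids all `y i`, so the spanning points belong to the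
  -- restriction to the complement of `U`.
  obtain ⟨U, hU, hxU, hUV⟩ := hb.mem_nhds_iff.1
    ((finite_range y).isClosed.isOpen_compl.mem_nhds (show x.1 ∈ (range y)ᶜ from by
      rintro ⟨i, hi⟩
      exact hyx i hi))
  refine hζ U hU ⟨x, ⟨hx, hxU, trivial⟩, z, fun i => ⟨hz i, fun hzU => ?_, trivial⟩, ?_⟩
  · exact hUV hzU ⟨i, (hzy i).symm⟩
  · simpa only [hzy] using hspan

/-- Such a set is empty or contained in a hyperplane when `a = 0`, and is contained in a sphere
otherwise. -/
theorem volume_quadric_eq_zero (hd : 1 ≤ d) {v : E d} {a b : ℝ} (h : v ≠ 0 ∨ a ≠ 0 ∨ b ≠ 0) :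
    volume {x : E d | inner ℝ v x + a * ‖x‖ ^ 2 + b = 0} = 0 := by
  have : Nonempty (Fin d) := ⟨⟨0, hd⟩⟩
  by_cases ha : a = 0
  · by_cases hv : v = 0
    · have hb : b ≠ 0 := by tauto
      have : {x : E d | inner ℝ v x + a * ‖x‖ ^ 2 + b = 0} = ∅ := by
        ext x
        simp [ha, hv, hb]
      rw [this, measure_empty]
    · have hker : (innerₛₗ ℝ v).ker ≠ ⊤ := by
        intro htop
        have : v ∈ (innerₛₗ ℝ v).ker := htop ▸ Submodule.mem_top
        simp [hv] at this
      rcases eq_empty_or_nonempty {x : E d | inner ℝ v x + a * ‖x‖ ^ 2 + b = 0} with he | ⟨x₀, h₀⟩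
      · rw [he, measure_empty]
      refine measure_mono_null (t := (fun x => -x₀ + x) ⁻¹' (innerₛₗ ℝ v).ker) ?_ ?_
      · intro x hx
        simp only [mem_ofPred_eq, ha, zero_mul, add_zero] at hx h₀
        simp only [mem_preimage, SetLike.mem_coe, LinearMap.mem_ker, innerₛₗ_apply_apply,
          inner_add_right, inner_neg_right]
        linarith
      · rw [measure_preimage_add]
        exact Measure.addHaar_submodule _ _ hker
  -- Centre and radius come from completing the square. `√` of a negative number is `0`, which is
  -- harmless since the existence of a point makes the radicand a square.
  · refine measure_mono_null (t := Metric.sphere (-(1 / (2 * a)) • v)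
      √(‖(1 / (2 * a)) • v‖ ^ 2 - b / a)) ?_ (Measure.addHaar_sphere _ _ _)
    intro x hx
    simp only [mem_ofPred_eq] at hx
    have hsq : ‖(1 / (2 * a)) • v‖ ^ 2 - b / a = ‖x + (1 / (2 * a)) • v‖ ^ 2 := by
      rw [norm_add_sq_real, real_inner_smul_right, real_inner_comm]
      have : ‖x‖ ^ 2 + 2 * (1 / (2 * a) * inner ℝ v x) = -(b / a) := by
        field_simp
        linarith
      linarith
    rw [mem_sphere_iff_norm, neg_smul, sub_neg_eq_add, hsq, Real.sqrt_sq (norm_nonneg _)]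

/-- Lift which turns hyperplanes into linear subspaces. -/
def hyperplaneLift (x : E d) : E d × ℝ := (x, 1)

/-- Lift which turns spheres into linear subspaces. -/
def sphereLift (x : E d) : E d × ℝ × ℝ := (x, ‖x‖ ^ 2, 1)

theorem continuous_hyperplaneLift : Continuous (hyperplaneLift (d := d)) := by
  unfold hyperplaneLift; fun_prop

theorem continuous_sphereLift : Continuous (sphereLift (d := d)) := by
  unfold sphereLift; fun_prop

theorem exists_inner_eq (f : E d →ₗ[ℝ] ℝ) : ∃ v : E d, ∀ x, f x = inner ℝ v x :=
  ⟨(InnerProductSpace.toDual ℝ (E d)).symm (LinearMap.toContinuousLinearMap f), fun x => by simp⟩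

theorem volume_hyperplaneLift_preimage (hd : 1 ≤ d) (V : Submodule ℝ (E d × ℝ)) (hV : V ≠ ⊤) :
    volume (hyperplaneLift ⁻¹' (V : Set (E d × ℝ))) = 0 := by
  obtain ⟨f, hf, hVf⟩ := V.exists_le_ker_of_lt_top hV.lt_top
  obtain ⟨v, hv⟩ := exists_inner_eq (f ∘ₗ LinearMap.inl ℝ (E d) ℝ)
  have hf' : ∀ p : E d × ℝ, f p = inner ℝ v p.1 + p.2 * f (0, 1) := by
    intro p
    rw [← hv, ← smul_eq_mul, ← map_smul, LinearMap.comp_apply, ← map_add]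
    simp
  refine measure_mono_null ?_ (volume_quadric_eq_zero hd (v := v) (a := 0) (b := f (0, 1)) ?_)
  · intro x hx
    have := hVf hx
    rw [LinearMap.mem_ker, hf'] at this
    simpa [hyperplaneLift] using this
  · by_contra! hcon
    refine hf (LinearMap.ext fun p => ?_)
    rw [hf', hcon.1, hcon.2.2]
    simp

theorem volume_sphereLift_preimage (hd : 1 ≤ d) (V : Submodule ℝ (E d × ℝ × ℝ)) (hV : V ≠ ⊤) :
    volume (sphereLift ⁻¹' (V : Set (E d × ℝ × ℝ))) = 0 := by
  obtain ⟨f, hf, hVf⟩ := V.exists_le_ker_of_lt_top hV.lt_top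
  obtain ⟨v, hv⟩ := exists_inner_eq (f ∘ₗ LinearMap.inl ℝ (E d) (ℝ × ℝ))
  have hf' : ∀ p : E d × ℝ × ℝ, f p = inner ℝ v p.1 + p.2.1 * f (0, 1, 0) +
      p.2.2 * f (0, 0, 1) := by
    intro p
    rw [← hv, ← smul_eq_mul, ← smul_eq_mul, ← map_smul, ← map_smul, LinearMap.comp_apply,
      ← map_add, ← map_add]
    simp
  refine measure_mono_null ?_ (volume_quadric_eq_zero hd (v := v) (a := f (0, 1, 0))
    (b := f (0, 0, 1)) ?_)
  · intro x hx
    have := hVf hx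
    rw [LinearMap.mem_ker, hf'] at this
    simpa [sphereLift, mul_comm] using this
  · by_contra! hcon
    refine hf (LinearMap.ext fun p => ?_)
    rw [hf', hcon.1, hcon.2.1, hcon.2.2]
    simp

/-- After lifting, a hyperplane `⟪v, x⟫ = c` is cut out by the functional `(v, -c)`, and a sphere of
centre `z` and radius `r` by `(-2z, 1, ‖z‖² - r²)`; both functionals are nonzero. -/
theorem isGeneral_of_genPos {s : Set (E d)} (h₁ : GenPos hyperplaneLift d s)
    (h₂ : GenPos sphereLift (d + 1) s) : IsGeneral s := by
  constructor
  · rintro t hts ht ⟨v, c, hv, hvc⟩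
    refine h₁.false_of_card_eq (by simp) hts ht
      (f := (innerₛₗ ℝ v).coprod ((-c) • LinearMap.id)) (fun h0 => hv ?_) fun x hx => ?_
    · have := LinearMap.congr_fun h0 (v, 0)
      simpa using this
    · simp [hyperplaneLift, hvc x hx]
  · rintro t hts ht ⟨z, r, hzr⟩
    refine h₂.false_of_card_eq (by simp) hts ht
      (f := (innerₛₗ ℝ ((-2 : ℝ) • z)).coprod (LinearMap.id.coprod
        ((‖z‖ ^ 2 - r ^ 2) • LinearMap.id))) (fun h0 => ?_) fun x hx => ?_
    · have := LinearMap.congr_fun h0 (0, 1, 0)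
      simp at this
    · have h1 := hzr x hx
      have h2 : ‖x - z‖ ^ 2 = r ^ 2 := by rw [← dist_eq_norm, h1]
      rw [norm_sub_sq_real, real_inner_comm] at h2
      simp [sphereLift]
      linarith

theorem volume_comap_toReal_univ :
    (volume : Measure ℝ).comap NNReal.toReal univ = ∞ := by
  have : NNReal.toReal '' univ = Ici 0 := by
    ext x
    simp only [image_univ, mem_range, mem_Ici]
    exact ⟨fun ⟨y, hy⟩ => hy ▸ y.2, fun hx => ⟨⟨x, hx⟩, rfl⟩⟩
  rw [volume_comap_toReal, this, Real.volume_Ici]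

/-- The spatial projection of a Poisson process of infinite time horizon is dense. -/
theorem HasPoissonVoids.ae_dense (h : HasPoissonVoids Q (lebesgue d)) :
    ∀ᵐ ζ ∂Q, ∀ (x : E d) (r : ℝ), 0 < r → ∃ p ∈ ζ.carrier, dist p.1 x < r := by
  have hb := TopologicalSpace.isBasis_countableBasis (E d)
  have key : ∀ U ∈ TopologicalSpace.countableBasis (E d), ∀ᵐ ζ ∂Q,
      ¬ ζ.carrier ∩ (U ×ˢ univ) = ∅ := by
    intro U hU
    have hpos : volume U ≠ 0 :=
      ((hb.isOpen hU).measure_pos volume (TopologicalSpace.nonempty_of_mem_countableBasis hU)).ne'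
    refine measure_eq_zero_iff_ae_notMem.1 (h.void_eq_zero
      ((hb.isOpen hU).measurableSet.prod MeasurableSet.univ) ?_)
    rw [lebesgue, Measure.prod_prod, volume_comap_toReal_univ, ENNReal.mul_top hpos]
  filter_upwards [(ae_ball_iff (TopologicalSpace.countable_countableBasis (E d))).2 key]
    with ζ hζ x r hr
  obtain ⟨U, hU, hxU, hUr⟩ := hb.mem_nhds_iff.1 (Metric.ball_mem_nhds x hr)
  obtain ⟨p, hp, hpU, -⟩ := nonempty_iff_ne_empty.2 (hζ U hU)
  exact ⟨p, hp, hUr hpU⟩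

end GeneralPosition

/-! ### Subcritical percolation of sparse random sets of cells. -/

section Percolation

/-- Indices of the cells of a cubic grid. -/
abbrev Cell (d : ℕ) : Type := Fin d → ℤ

variable {d : ℕ}

/-- The sup-distance of two cells is at most `k`. -/
def Near (k : ℤ) (x y : Cell d) : Prop := ∀ i, |x i - y i| ≤ k

theorem Near.symm {k : ℤ} {x y : Cell d} (h : Near k x y) : Near k y x :=
  fun i => abs_sub_comm (x i) (y i) ▸ h i

theorem Near.trans {k l : ℤ} {x y z : Cell d} (h : Near k x y) (h' : Near l y z) :
    Near (k + l) x z :=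
  fun i => (abs_sub_le _ _ _).trans (add_le_add (h i) (h' i))

theorem Near.mono {k l : ℤ} {x y : Cell d} (h : Near k x y) (hkl : k ≤ l) : Near l x y :=
  fun i => (h i).trans hkl

theorem near_self {k : ℤ} (hk : 0 ≤ k) (x : Cell d) : Near k x x :=
  fun i => by simpa using hk

/-- `y` can be reached from `x` by a path of adjacent cells of `S`. -/
def Reach (S : Set (Cell d)) : Cell d → Cell d → Prop :=
  Relation.ReflTransGen fun a b => Near 1 a b ∧ b ∈ S

/-- Cut the path at its last visit to the cube of radius `2` about `x`: the next cell is at distance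
at most `3`, and the rest of the path avoids the cube. -/
theorem Reach.exists_escape {S : Set (Cell d)} {x y : Cell d} (h : Reach S x y)
    (hxy : ¬ Near 2 x y) :
    ∃ x' ∈ S ∩ {z | ¬ Near 2 x z}, Near 3 x x' ∧ Reach (S ∩ {z | ¬ Near 2 x z}) x' y := by
  have key : ∀ a, Reach S a y → (Reach (S ∩ {z | ¬ Near 2 x z}) a y ∧ ¬ Near 2 x a) ∨
      ∃ x' ∈ S ∩ {z | ¬ Near 2 x z}, Near 3 x x' ∧ Reach (S ∩ {z | ¬ Near 2 x z}) x' y := by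
    intro a ha
    induction ha using Relation.ReflTransGen.head_induction_on with
    | refl => exact Or.inl ⟨Relation.ReflTransGen.refl, hxy⟩
    | @head a b hab _ ih =>
      rcases ih with ⟨ih, hb⟩ | ih
      · by_cases ha : Near 2 x a
        · exact Or.inr ⟨b, ⟨hab.2, hb⟩, ha.trans hab.1, ih⟩
        · exact Or.inl ⟨Relation.ReflTransGen.head ⟨hab.1, hab.2, hb⟩ ih, ha⟩
      · exact Or.inr ih
  rcases key x h with h | h
  · exact absurd (near_self (by norm_num) x) h.2
  · exact h

/-- Sequences of `k + 1` cells starting at `x` with steps of size at most `3`. -/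
def chains : (k : ℕ) → Cell d → Finset (Fin (k + 1) → Cell d)
  | 0, x => {fun _ => x}
  | k + 1, x => (Finset.Icc (x - 3) (x + 3)).biUnion fun x' =>
      (chains k x').image fun w => (Fin.cons x w : Fin (k + 2) → Cell d)

theorem card_Icc_sub_add (x : Cell d) (n : ℕ) :
    (Finset.Icc (x - (n : Cell d)) (x + (n : Cell d))).card = (2 * n + 1) ^ d := by
  rw [Pi.card_Icc]
  have : ∀ i, (Finset.Icc ((x - (n : Cell d)) i) ((x + (n : Cell d)) i)).card = 2 * n + 1 := by
    intro i
    rw [Int.card_Icc]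
    simp
    omega
  rw [Finset.prod_congr rfl fun i _ => this i]
  simp

theorem Near.mem_Icc {n : ℕ} {x y : Cell d} (h : Near n x y) :
    y ∈ Finset.Icc (x - (n : Cell d)) (x + (n : Cell d)) := by
  rw [Finset.mem_Icc]
  constructor <;> intro i <;> have := abs_le.1 (h i) <;> simp <;> omega

theorem card_chains_le (k : ℕ) (x : Cell d) : (chains k x).card ≤ (7 ^ d) ^ k := by
  induction k generalizing x with
  | zero => simp [chains]
  | succ k ih =>
    have h := Finset.card_biUnion_le_card_mul (Finset.Icc (x - 3) (x + 3)) (fun x' =>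
      (chains k x').image fun w => (Fin.cons x w : Fin (k + 2) → Cell d)) ((7 ^ d) ^ k)
      fun x' _ => Finset.card_image_le.trans (ih x')
    have h3 : (Finset.Icc (x - 3) (x + 3)).card = 7 ^ d := card_Icc_sub_add x 3
    rw [h3] at h
    exact h.trans_eq (by ring)

/-- Iterate `Reach.exists_escape`, deleting the cube about each chosen cell from `S`; this is why
`S` varies in the induction. The chosen cells are then pairwise far apart, as the sparsity estimate
requires. -/
theorem Reach.exists_chain {S : Set (Cell d)} (k : ℕ) {x y : Cell d} (hx : x ∈ S)
    (h : Reach S x y) (hxy : ¬ Near (3 * k) x y) :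
    ∃ w ∈ chains k x, (∀ i, w i ∈ S) ∧ Pairwise fun i j => ¬ Near 2 (w i) (w j) := by
  induction k generalizing x S with
  | zero => exact ⟨fun _ => x, by simp [chains], fun _ => hx, fun i j hij =>
      absurd (Subsingleton.elim (α := Fin 1) i j) hij⟩
  | succ k ih =>
    push_cast at hxy
    obtain ⟨x', hx', h3, hr⟩ := h.exists_escape fun h2 => hxy (h2.mono (by omega))
    obtain ⟨w, hw, hwS, hwp⟩ := ih hx' hr fun hk => hxy ((h3.trans hk).mono (by omega))
    refine ⟨Fin.cons x w, ?_, ?_, ?_⟩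
    · exact Finset.mem_biUnion.2 ⟨x', Near.mem_Icc (n := 3) h3, Finset.mem_image_of_mem _ hw⟩
    · intro i
      refine Fin.cases hx (fun i => (hwS i).1) i
    · intro i j
      refine Fin.cases (Fin.cases (fun h => absurd rfl h) (fun j _ => ?_) j)
        (fun i => Fin.cases (fun _ => ?_) (fun j hij => ?_) j) i
      · exact (hwS j).2
      · exact fun h => (hwS i).2 h.symm
      · exact hwp fun h => hij (congrArg Fin.succ h)

/-- The random set `S` of cells is sparse: well separated cells belong to `S` with the probability
given by independent choices with density at most `p`. -/
def IsSparse {Ω : Type*} [MeasurableSpace Ω] (Q : Measure Ω) (S : Ω → Set (Cell d))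
    (p : ℝ≥0∞) : Prop :=
  ∀ (n : ℕ) (w : Fin n → Cell d), (Pairwise fun i j => ¬ Near 2 (w i) (w j)) →
    Q {ω | ∀ i, w i ∈ S ω} ≤ p ^ n

variable {Ω : Type*} [MeasurableSpace Ω] {Q : Measure Ω} {S : Ω → Set (Cell d)} {p : ℝ≥0∞}

/-- Peierls bound: at most `7 ^ (d * k)` chains start at `x`, and each separated one is contained in
`S` with probability at most `p ^ (k + 1)`. -/
theorem IsSparse.measure_reach_le (hS : IsSparse Q S p) (hp : p * 7 ^ d ≤ 2⁻¹) (x : Cell d)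
    (k : ℕ) : Q {ω | x ∈ S ω ∧ ∃ y, Reach (S ω) x y ∧ ¬ Near (3 * k) x y} ≤ 2⁻¹ ^ k := by
  classical
  let T := (chains k x).filter fun w : Fin (k + 1) → Cell d => Pairwise fun i j =>
    ¬ Near 2 (w i) (w j)
  have hsub : {ω | x ∈ S ω ∧ ∃ y, Reach (S ω) x y ∧ ¬ Near (3 * k) x y} ⊆
      ⋃ w ∈ T, {ω | ∀ i, w i ∈ S ω} := by
    rintro ω ⟨hx, y, hr, hy⟩
    obtain ⟨w, hw, hwS, hwp⟩ := hr.exists_chain k hx hy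
    exact mem_iUnion₂.2 ⟨w, Finset.mem_filter.2 ⟨hw, hwp⟩, hwS⟩
  have hp1 : p ≤ 1 := by
    calc p = p * 1 := (mul_one p).symm
      _ ≤ p * 7 ^ d := by gcongr; exact one_le_pow₀ (by norm_num)
      _ ≤ 2⁻¹ := hp
      _ ≤ 1 := by norm_num
  calc _ ≤ _ := measure_mono hsub
    _ ≤ ∑ w ∈ T, Q {ω | ∀ i, w i ∈ S ω} := measure_biUnion_finset_le _ _
    _ ≤ ∑ _w ∈ T, p ^ (k + 1) := Finset.sum_le_sum fun w hw => hS _ w (Finset.mem_filter.1 hw).2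
    _ = T.card * p ^ (k + 1) := by rw [Finset.sum_const, nsmul_eq_mul]
    _ ≤ ((7 ^ d) ^ k : ℕ) * p ^ k := by
        gcongr ?_ * ?_
        · exact_mod_cast (Finset.card_filter_le _ _).trans (card_chains_le k x)
        · exact pow_le_pow_right_of_le_one' hp1 (Nat.le_succ k)
    _ = (p * 7 ^ d) ^ k := by push_cast; rw [mul_pow, mul_comm]
    _ ≤ 2⁻¹ ^ k := by gcongr

/-- A logarithmic bound for the reach of paths started at distance at most `n` from the origin. -/
def reachBound (d n : ℕ) : ℕ := 3 * ((d + 2) * Nat.clog 2 (n + 1))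

/-- Paths of `S` started at distance at most `n` from the origin have logarithmic length. -/
def HasLogReach (S : Set (Cell d)) : Prop :=
  ∀ᶠ n : ℕ in atTop, ∀ x y, Near n 0 x → x ∈ S → Reach S x y → Near (reachBound d n) x y

/-- Borel–Cantelli over `n`, with a union bound over the starting cells in the cube of radius `n`.
-/
theorem IsSparse.ae_hasLogReach (hS : IsSparse Q S p) (hp : p * 7 ^ d ≤ 2⁻¹) :
    ∀ᵐ ω ∂Q, HasLogReach (S ω) := by
  let A : ℕ → Set Ω := fun n => {ω | ∃ x y, Near n 0 x ∧ x ∈ S ω ∧ Reach (S ω) x y ∧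
    ¬ Near (reachBound d n) x y}
  have hA : ∀ n, Q (A n) ≤ ENNReal.ofReal (2 ^ d * (1 / ((n + 1 : ℕ) : ℝ) ^ 2)) := by
    intro n
    -- With this `k`, `2 ^ (-k) ≤ (n + 1) ^ (-(d + 2))`: the exponent `d` pays for the `(2 * n + 1)
    -- ^ d` starting cells, and the additional `2` makes the bounds summable.
    set k := (d + 2) * Nat.clog 2 (n + 1) with hk
    have hsub : A n ⊆ ⋃ x ∈ Finset.Icc ((0 : Cell d) - (n : Cell d)) (0 + (n : Cell d)),
        {ω | x ∈ S ω ∧ ∃ y, Reach (S ω) x y ∧ ¬ Near (3 * k) x y} := by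
      rintro ω ⟨x, y, hx, hxS, hr, hn⟩
      refine mem_iUnion₂.2 ⟨x, hx.mem_Icc, hxS, y, hr, ?_⟩
      simpa [reachBound, hk] using hn
    have h1 : Q (A n) ≤ ((2 * n + 1) ^ d : ℕ) * 2⁻¹ ^ k := by
      calc Q (A n) ≤ _ := measure_mono hsub
        _ ≤ _ := measure_biUnion_finset_le _ _
        _ ≤ ∑ x ∈ Finset.Icc ((0 : Cell d) - (n : Cell d)) (0 + (n : Cell d)), 2⁻¹ ^ k :=
          Finset.sum_le_sum fun x _ => hS.measure_reach_le hp x k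
        _ = _ := by rw [Finset.sum_const, nsmul_eq_mul, card_Icc_sub_add]
    refine h1.trans ?_
    have h2 : (((2 * n + 1) ^ d : ℕ) : ℝ≥0∞) * 2⁻¹ ^ k =
        ENNReal.ofReal ((2 * n + 1) ^ d * (1 / 2) ^ k) := by
      rw [ENNReal.ofReal_mul (by positivity), ENNReal.ofReal_pow (by positivity),
        ENNReal.ofReal_pow (by positivity), one_div, ENNReal.ofReal_inv_of_pos two_pos]
      push_cast
      congr 3
      · rw [← ENNReal.ofReal_natCast]
        rw [ENNReal.ofReal_add (by positivity) (by positivity), ENNReal.ofReal_mul (by positivity)]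
        simp
      · simp
    rw [h2]
    refine ENNReal.ofReal_le_ofReal ?_
    have h3 : ((n + 1 : ℕ) : ℝ) ^ (d + 2) ≤ 2 ^ k := by
      rw [hk, mul_comm, pow_mul]
      gcongr
      exact_mod_cast Nat.le_pow_clog one_lt_two (n + 1)
    calc (2 * (n : ℝ) + 1) ^ d * (1 / 2) ^ k ≤
          (2 * ((n + 1 : ℕ) : ℝ)) ^ d * (1 / ((n + 1 : ℕ) : ℝ) ^ (d + 2)) := by
          rw [one_div_pow]
          gcongr
          push_cast
          linarith
      _ = 2 ^ d * (1 / ((n + 1 : ℕ) : ℝ) ^ 2) := by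
          have : ((n + 1 : ℕ) : ℝ) ≠ 0 := by positivity
          rw [mul_pow, pow_add]
          field_simp
  have hsum : ∑' n, Q (A n) ≠ ∞ := by
    have hs : Summable fun n : ℕ => (2 : ℝ) ^ d * (1 / ((n + 1 : ℕ) : ℝ) ^ 2) :=
      ((summable_nat_add_iff 1).2 (Real.summable_one_div_nat_pow.2 one_lt_two)).mul_left _
    refine ne_top_of_le_ne_top ?_ (ENNReal.tsum_le_tsum hA)
    rw [← ENNReal.ofReal_tsum_of_nonneg (fun n => by positivity) hs]
    exact ENNReal.ofReal_ne_top
  filter_upwards [ae_eventually_notMem hsum] with ω hω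
  filter_upwards [hω] with n hn x y hx hxS hr
  by_contra hcon
  exact hn ⟨x, y, hx, hxS, hr, hcon⟩

end Percolation

/-! ### Arrival cells and late cells of the Poisson process, and their sparsity. -/

section Cells

variable {d : ℕ} {s : ℝ}

/-- The cell of side `s` which contains `x`. -/
def cellOf (s : ℝ) (x : E d) : Cell d := fun i => ⌊x i / s⌋

/-- The corner of a cell of side `s`. -/
def corner (s : ℝ) (z : Cell d) : E d := WithLp.toLp 2 fun i => s * z i

theorem cellOf_neg_corner_add (hs : 0 < s) (z : Cell d) (x : E d) :
    cellOf s (-corner s z + x) = cellOf s x - z := by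
  funext i
  simp only [cellOf, corner, PiLp.add_apply, PiLp.neg_apply, Pi.sub_apply]
  rw [← Int.floor_sub_intCast]
  congr 1
  field_simp
  ring

theorem measurable_cellOf (s : ℝ) : Measurable (cellOf (d := d) s) :=
  measurable_pi_lambda _ fun i => Int.measurable_floor.comp (by fun_prop)

theorem near_cellOf (hs : 0 < s) {x y : E d} (h : dist x y ≤ s) :
    Near 1 (cellOf s x) (cellOf s y) := by
  intro i
  have h1 : |x i - y i| ≤ s := by
    have := PiLp.norm_apply_le (x - y) i
    rw [Real.norm_eq_abs, ← dist_eq_norm] at this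
    exact this.trans h
  rw [abs_le] at h1
  have h2 : x i / s ≤ y i / s + 1 := by
    rw [div_add_one hs.ne']
    gcongr
    linarith
  have h3 : y i / s ≤ x i / s + 1 := by
    rw [div_add_one hs.ne']
    gcongr
    linarith
  have h4 := Int.floor_le_floor h2
  have h5 := Int.floor_le_floor h3
  rw [Int.floor_add_one] at h4 h5
  simp only [cellOf, abs_le]
  omega

theorem dist_le_of_near (hs : 0 < s) {k : ℕ} {x y : E d}
    (h : Near k (cellOf s x) (cellOf s y)) : dist x y ≤ d * (s * (k + 1)) := by
  have h1 : ∀ i, |x i - y i| ≤ s * (k + 1) := by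
    intro i
    have h2 := abs_le.1 (h i)
    have hx1 := Int.floor_le (x i / s)
    have hx2 := Int.lt_floor_add_one (x i / s)
    have hy1 := Int.floor_le (y i / s)
    have hy2 := Int.lt_floor_add_one (y i / s)
    simp only [cellOf] at h2
    have h3 : ((-(k : ℤ) : ℤ) : ℝ) ≤ ((⌊x i / s⌋ - ⌊y i / s⌋ : ℤ) : ℝ) := Int.cast_le.2 h2.1
    have h4 : ((⌊x i / s⌋ - ⌊y i / s⌋ : ℤ) : ℝ) ≤ (((k : ℤ) : ℤ) : ℝ) := Int.cast_le.2 h2.2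
    push_cast at h3 h4
    have h5 : |x i / s - y i / s| ≤ k + 1 := by
      rw [abs_le]
      constructor <;> linarith
    rw [← sub_div, abs_div, abs_of_pos hs, div_le_iff₀ hs] at h5
    linarith
  rw [EuclideanSpace.dist_eq]
  refine (Real.sqrt_le_left (by positivity)).2 ?_
  calc ∑ i, dist (x i) (y i) ^ 2 ≤ ∑ _i : Fin d, (s * (k + 1)) ^ 2 := by
        refine Finset.sum_le_sum fun i _ => ?_
        rw [Real.dist_eq]
        exact pow_le_pow_left₀ (abs_nonneg _) (h1 i) 2
    _ = d * (s * (k + 1)) ^ 2 := by simp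
    _ ≤ (d : ℝ) ^ 2 * (s * (k + 1)) ^ 2 := by
        gcongr
        exact_mod_cast Nat.le_self_pow two_ne_zero d
    _ = _ := by ring

theorem isBounded_near (hs : 0 < s) (k : ℕ) (z : Cell d) :
    Bornology.IsBounded {x : E d | Near k z (cellOf s x)} := by
  refine Metric.isBounded_iff.2 ⟨d * (s * ((2 * k : ℕ) + 1)), fun x hx y hy => ?_⟩
  refine dist_le_of_near hs ?_
  have := hx.symm.trans hy
  push_cast
  exact this.mono (by omega)

/-- The space-time points whose cell is adjacent to the cell of the origin. -/
def window (d : ℕ) (s : ℝ) : Set (SpaceTime d) := {p | Near 1 0 (cellOf s p.1)}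

theorem measurableSet_near (k : ℤ) (z : Cell d) : MeasurableSet {x : E d | Near k z (cellOf s x)} :=
  measurable_cellOf s (t := {y | Near k z y}) (Set.to_countable _).measurableSet

theorem measurableSet_window : MeasurableSet (window d s) :=
  measurable_fst (measurableSet_near 1 0)

variable {Q : Measure (PointConfig (SpaceTime d))}

/-- The field of cells around which a local event occurs is sparse. -/
theorem HasPoissonVoids.isSparse (h : HasPoissonVoids Q (lebesgue d)) (hs : 0 < s)
    {Λ : Set (PointConfig (SpaceTime d))} (hΛ : MeasurableSet Λ)
    (hloc : ∀ ζ, PointConfig.restrict (window d s) ζ ∈ Λ ↔ ζ ∈ Λ) :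
    IsSparse Q (fun ζ => {z | shift (-corner s z) ζ ∈ Λ}) (Q Λ) := by
  intro n w hw
  -- The windows have radius `1`, so those around cells which are not within distance `2` are
  -- disjoint; this is the reason for the `2` in `IsSparse`.
  have hind := h.iIndep_restrict (W := fun i => shiftPoint (-corner s (w i)) ⁻¹' window d s)
    (fun i => (shiftPoint _).continuous.measurable measurableSet_window) fun i j hij => by
      refine Set.disjoint_left.2 fun p hp hp' => hw hij ?_
      simp only [mem_preimage, window, mem_ofPred_eq, shiftPoint_fst,
        cellOf_neg_corner_add hs] at hp hp'
      intro k
      have h1 := abs_le.1 (hp k)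
      have h2 := abs_le.1 (hp' k)
      simp only [Pi.zero_apply, Pi.sub_apply] at h1 h2
      rw [abs_le]
      omega
  have hset : {ζ | ∀ i, w i ∈ {z | shift (-corner s z) ζ ∈ Λ}} =
      ⋂ i, shift (-corner s (w i)) ⁻¹' Λ := by
    ext ζ
    simp
  rw [hset, hind.meas_iInter]
  · calc ∏ i, Q (shift (-corner s (w i)) ⁻¹' Λ) = ∏ _i : Fin n, Q Λ := by
          refine Finset.prod_congr rfl fun i _ => ?_
          rw [← Measure.map_apply (measurable_shift _) hΛ, h.map_shift]
      _ = Q Λ ^ n := by simp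
      _ ≤ _ := le_rfl
  · intro i
    refine ⟨shift (-corner s (w i)) ⁻¹' Λ, measurable_shift _ hΛ, ?_⟩
    ext ζ
    rw [mem_preimage, mem_preimage, ← restrict_shift, hloc, mem_preimage]

theorem Reach.mono {S S' : Set (Cell d)} (h : S ⊆ S') {x y : Cell d} (hr : Reach S x y) :
    Reach S' x y :=
  Relation.ReflTransGen.mono (fun _ _ hab => ⟨hab.1, h hab.2⟩) _ _ hr

theorem HasLogReach.mono {S S' : Set (Cell d)} (h : S ⊆ S') (hS : HasLogReach S') :
    HasLogReach S := by
  filter_upwards [hS] with n hn x y hx hxS hr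
  exact hn x y hx (h hxS) (hr.mono h)

/-- The cells which contain a point arriving in the time interval `[a, b)`. -/
def arrivalCells (s : ℝ) (a b : ℝ≥0) (ζ : PointConfig (SpaceTime d)) : Set (Cell d) :=
  {z | ∃ p ∈ ζ.carrier, cellOf s p.1 = z ∧ a ≤ p.2 ∧ p.2 < b}

/-- By `hit`, a cell receives a point during `[a, b)` with probability at most its volume times `b -
a`. -/
theorem HasPoissonVoids.ae_hasLogReach_arrivalCells (h : HasPoissonVoids Q (lebesgue d))
    (hs : 0 < s) {a b : ℝ≥0}
    (hab : volume {x : E d | cellOf s x = 0} * ENNReal.ofReal (b - a) * 7 ^ d ≤ 2⁻¹) :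
    ∀ᵐ ζ ∂Q, HasLogReach (arrivalCells s a b ζ) := by
  let B : Set (SpaceTime d) := {x : E d | cellOf s x = 0} ×ˢ Ico a b
  have hBm : MeasurableSet B :=
    (measurable_cellOf s (measurableSet_singleton 0)).prod measurableSet_Ico
  have hB : lebesgue d B ≤ volume {x : E d | cellOf s x = 0} * ENNReal.ofReal (b - a) := by
    rw [lebesgue, Measure.prod_prod, volume_comap_toReal]
    gcongr
    rw [← Real.volume_Ico]
    refine measure_mono ?_
    rintro _ ⟨t, ht, rfl⟩
    exact ⟨NNReal.coe_le_coe.2 ht.1, NNReal.coe_lt_coe.2 ht.2⟩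
  have hsparse := h.isSparse hs (Λ := {ζ | ζ.carrier ∩ B = ∅}ᶜ)
    (PointConfig.measurableSet_void hBm).compl fun ζ => by
      refine not_congr ?_
      change ζ.carrier ∩ window d s ∩ B = ∅ ↔ ζ.carrier ∩ B = ∅
      have hBW : B ⊆ window d s := by
        rintro p ⟨hp, -⟩
        have hp' : cellOf s p.1 = 0 := hp
        change Near 1 0 (cellOf s p.1)
        rw [hp']
        exact near_self zero_le_one 0
      rw [inter_assoc, inter_eq_self_of_subset_right hBW]
  have hc : {ζ : PointConfig (SpaceTime d) | ζ.carrier ∩ B = ∅}ᶜ =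
      {ζ | (ζ.carrier ∩ B).Nonempty} := by
    ext ζ; simp [nonempty_iff_ne_empty]
  have hp : Q {ζ : PointConfig (SpaceTime d) | ζ.carrier ∩ B = ∅}ᶜ * 7 ^ d ≤ 2⁻¹ := by
    rw [hc]
    exact (mul_le_mul_left ((h.hit hBm).trans hB) _).trans hab
  filter_upwards [hsparse.ae_hasLogReach hp] with ζ hζ
  refine hζ.mono ?_
  rintro z ⟨p, hp, hz, hap, hpb⟩
  refine Set.Nonempty.ne_empty ⟨shiftPoint (-corner s z) p, mem_image_of_mem _ hp, ?_, hap, hpb⟩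
  simp [cellOf_neg_corner_add hs, hz]

/-- The cells `z` which contain a point of arrival time at least `t` that belongs to an edge-free
set of points of the cells adjacent to `z` which blocks all other points of `z`. -/
def lateCells (ρ₀ s : ℝ) (t : ℝ≥0) (ζ : PointConfig (SpaceTime d)) : Set (Cell d) :=
  {z | ∃ (n : ℕ) (x : Fin n → SpaceTime d), (∀ i, x i ∈ ζ.carrier) ∧
    ((∀ i, Near 1 z (cellOf s (x i).1)) ∧ (∀ i j, ¬ Edge ρ₀ (x i) (x j)) ∧
      (∃ i, cellOf s (x i).1 = z ∧ t ≤ (x i).2) ∧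
      ∀ p ∈ ζ.carrier, cellOf s p.1 = z → (∃ i, p = x i) ∨ ∃ i, Edge ρ₀ (x i) p)}

variable {ρ₀ : ℝ}

theorem mem_lateCells_of_finite {t : ℝ≥0} {ζ : PointConfig (SpaceTime d)} {z : Cell d}
    {A : Set (SpaceTime d)} (hA : A.Finite) (hAζ : A ⊆ ζ.carrier)
    (hAz : ∀ a ∈ A, Near 1 z (cellOf s a.1)) (hAE : ∀ a ∈ A, ∀ b ∈ A, ¬ Edge ρ₀ a b)
    {q : SpaceTime d} (hq : q ∈ A) (hqz : cellOf s q.1 = z) (hqt : t ≤ q.2)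
    (hdom : ∀ p ∈ ζ.carrier, cellOf s p.1 = z → p ∈ A ∨ ∃ a ∈ A, Edge ρ₀ a p) :
    z ∈ lateCells ρ₀ s t ζ := by
  have := hA.to_subtype
  obtain ⟨n, ⟨e⟩⟩ := Finite.exists_equiv_fin A
  have hx : ∀ a ∈ A, ∃ i, (e.symm i : SpaceTime d) = a := fun a ha => ⟨e ⟨a, ha⟩, by simp⟩
  refine ⟨n, fun i => e.symm i, fun i => hAζ (e.symm i).2, fun i => hAz _ (e.symm i).2,
    fun i j => hAE _ (e.symm i).2 _ (e.symm j).2, ?_, fun p hp hpz => ?_⟩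
  · obtain ⟨i, rfl⟩ := hx q hq
    exact ⟨i, hqz, hqt⟩
  · rcases hdom p hp hpz with h | ⟨a, ha, h⟩
    · obtain ⟨i, hi⟩ := hx p h
      exact Or.inl ⟨i, hi.symm⟩
    · obtain ⟨i, rfl⟩ := hx a ha
      exact Or.inr ⟨i, h⟩

theorem measurableSet_mem_lateCells (t : ℝ≥0) (z : Cell d) :
    MeasurableSet {ζ : PointConfig (SpaceTime d) | z ∈ lateCells ρ₀ s t ζ} := by
  simp only [lateCells, mem_ofPred_eq]
  rw [ofPred_exists]
  refine MeasurableSet.iUnion fun n => ?_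
  refine PointConfig.measurableSet_exists_tuple (X := SpaceTime d) (ι := Fin n)
    (Y := PointConfig (SpaceTime d)) (c := fun ζ => ζ) measurable_id
    (U := fun x ζ => (∀ i, Near 1 z (cellOf s (x i).1)) ∧ (∀ i j, ¬ Edge ρ₀ (x i) (x j)) ∧
      (∃ i, cellOf s (x i).1 = z ∧ t ≤ (x i).2) ∧
      ∀ p ∈ ζ.carrier, cellOf s p.1 = z → (∃ i, p = x i) ∨ ∃ i, Edge ρ₀ (x i) p) ?_
  have hx : ∀ i, Measurable fun y : (Fin n → SpaceTime d) × PointConfig (SpaceTime d) => y.1 i :=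
    fun i => by fun_prop
  simp only [ofPred_and, ofPred_forall, ofPred_exists]
  refine (MeasurableSet.iInter fun i => ?_).inter
    ((MeasurableSet.iInter fun i => MeasurableSet.iInter fun j => ?_).inter
      ((MeasurableSet.iUnion fun i => ?_).inter ?_))
  · exact (measurable_fst.comp (hx i)) (measurableSet_near 1 z)
  · exact (Edge.measurableSet (hx i) (hx j)).compl
  · exact (((measurable_cellOf s).comp (measurable_fst.comp (hx i)))
      (measurableSet_singleton z)).inter
      (measurableSet_le measurable_const (measurable_snd.comp (hx i)))
  · have := PointConfig.measurableSet_forall_mem (X := SpaceTime d)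
      (Y := (Fin n → SpaceTime d) × PointConfig (SpaceTime d)) measurable_snd
      (U := fun p y => cellOf s p.1 = z → (∃ i, p = y.1 i) ∨ ∃ i, Edge ρ₀ (y.1 i) p) ?_
    · simpa only [ofPred_forall] using this
    · refine MeasurableSet.imp (((measurable_cellOf s).comp (measurable_fst.comp measurable_fst))
        (measurableSet_singleton z)) ?_
      simp only [ofPred_or, ofPred_exists]
      refine (MeasurableSet.iUnion fun i => ?_).union (MeasurableSet.iUnion fun i => ?_)
      · exact measurableSet_eq_fun measurable_fst ((hx i).comp measurable_snd)
      · exact Edge.measurableSet ((hx i).comp measurable_snd) measurable_fst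

/-- The blocking set lies in adjacent cells and only needs to block points of the cell itself, so
the event is determined by the window. -/
theorem zero_mem_lateCells_restrict (t : ℝ≥0) (ζ : PointConfig (SpaceTime d)) :
    (0 : Cell d) ∈ lateCells ρ₀ s t (PointConfig.restrict (window d s) ζ) ↔
      (0 : Cell d) ∈ lateCells ρ₀ s t ζ := by
  constructor
  · rintro ⟨n, x, hx, hn, hE, hl, hdom⟩
    refine ⟨n, x, fun i => (hx i).1, hn, hE, hl, fun p hp hp0 => hdom p ⟨hp, ?_⟩ hp0⟩
    change Near 1 0 (cellOf s p.1)
    rw [hp0]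
    exact near_self zero_le_one 0
  · rintro ⟨n, x, hx, hn, hE, hl, hdom⟩
    exact ⟨n, x, fun i => ⟨hx i, hn i⟩, hn, hE, hl, fun p hp hp0 => hdom p hp.1 hp0⟩

theorem mem_lateCells_shift (hs : 0 < s) {t : ℝ≥0} {ζ : PointConfig (SpaceTime d)} {z : Cell d}
    (h : z ∈ lateCells ρ₀ s t ζ) :
    (0 : Cell d) ∈ lateCells ρ₀ s t (shift (-corner s z) ζ) := by
  obtain ⟨n, x, hx, hn, hE, ⟨i, hi, hit⟩, hdom⟩ := h
  refine ⟨n, fun i => shiftPoint (-corner s z) (x i), fun i => mem_image_of_mem _ (hx i),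
    fun i => ?_, fun i j => ?_, ⟨i, ?_, hit⟩, ?_⟩
  · rw [shiftPoint_fst, cellOf_neg_corner_add hs]
    intro k
    simpa [abs_sub_comm] using hn i k
  · rw [edge_shiftPoint]
    exact hE i j
  · simp [cellOf_neg_corner_add hs, hi]
  · rintro _ ⟨p, hp, rfl⟩ hp0
    rw [shiftPoint_fst, cellOf_neg_corner_add hs, sub_eq_zero] at hp0
    rcases hdom p hp hp0 with ⟨i, hi⟩ | ⟨i, hi⟩
    · exact Or.inl ⟨i, by rw [hi]⟩
    · exact Or.inr ⟨i, (edge_shiftPoint _).2 hi⟩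

/-- Every cell is saturated after a finite time which does not depend on its environment. -/
theorem exists_notMem_lateCells (hρ₀ : 0 < ρ₀) (hs : 0 < s) (ζ : PointConfig (SpaceTime d))
    (z : Cell d) {t : ℕ → ℝ≥0} (ht : Tendsto t atTop atTop) :
    ∃ n, z ∉ lateCells ρ₀ s (t n) ζ := by
  by_contra! hcon
  choose k x hx hn hE hl hdom using hcon
  let A : ℕ → Set (SpaceTime d) := fun n => range (x n)
  -- Compactness: if the cell is late at all times `t n`, the witnessing sets `A n` have a limit `L`
  -- along a nonprincipal ultrafilter. It is still edge-free, hence finite.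
  let 𝒰 : Ultrafilter ℕ := hyperfilter ℕ
  let L : Set (SpaceTime d) := {a | ∀ᶠ n in 𝒰, a ∈ A n}
  have hLE : ∀ a ∈ L, ∀ b ∈ L, ¬ Edge ρ₀ a b := by
    intro a ha b hb
    obtain ⟨n, ⟨i, hi⟩, ⟨j, hj⟩⟩ := (Eventually.and ha hb).exists
    rw [← hi, ← hj]
    exact hE n i j
  have hLz : ∀ a ∈ L, Near 1 z (cellOf s a.1) := by
    intro a ha
    obtain ⟨n, i, hi⟩ := Eventually.exists ha
    rw [← hi]
    exact hn n i
  have hLfin : L.Finite := finite_of_edge_free hρ₀ hLE (isBounded_near hs 1 z) hLz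
  have hLdom : ∀ p ∈ ζ.carrier, cellOf s p.1 = z → p ∈ L ∨ ∃ a ∈ L, Edge ρ₀ a p := by
    intro p hp hpz
    -- Possible blockers of `p` arrive no later than `p` and lie in adjacent cells, so they are
    -- finitely many. The ultrafilter then selects a single blocker, and `L` inherits the blocking
    -- property.
    let G : Set (SpaceTime d) := ζ.carrier ∩
      (closure {x : E d | Near (1 : ℕ) z (cellOf s x)} ×ˢ Icc 0 p.2)
    have hG : G.Finite :=
      ζ.locallyFinite _ ((isBounded_near hs 1 z).isCompact_closure.prod isCompact_Icc)
    have h1 : ∀ᶠ n in 𝒰, p ∈ A n ∨ ∃ a ∈ G, a ∈ A n ∧ Edge ρ₀ a p := by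
      refine Eventually.of_forall fun n => ?_
      rcases hdom n p hp hpz with ⟨i, hi⟩ | ⟨i, hi⟩
      · exact Or.inl ⟨i, hi.symm⟩
      · exact Or.inr ⟨x n i, ⟨hx n i, subset_closure (hn n i), zero_le, (edge_iff.1 hi).2.le⟩,
          ⟨i, rfl⟩, hi⟩
    rw [Ultrafilter.eventually_or] at h1
    rcases h1 with h1 | h1
    · exact Or.inl h1
    · rw [Ultrafilter.eventually_exists_mem_iff hG] at h1
      obtain ⟨a, -, ha⟩ := h1
      exact Or.inr ⟨a, ha.mono fun n hn => hn.1, ha.exists.choose_spec.2⟩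
  obtain ⟨T, hT⟩ : ∃ T : ℝ≥0, ∀ a ∈ L, a.2 ≤ T := by
    obtain ⟨T, hT⟩ := (hLfin.image Prod.snd).bddAbove
    exact ⟨T, fun a ha => hT (mem_image_of_mem _ ha)⟩
  have hlarge : ∀ᶠ n in 𝒰, T < t n :=
    (ht.eventually_gt_atTop T).filter_mono Nat.hyperfilter_le_atTop
  have hall : ∀ᶠ n in 𝒰, ∀ a ∈ L, a ∈ A n := (eventually_all_finite hLfin).2 fun a ha => ha
  -- For such an `n`, `A n` contains `L`, and its late point arrives after every point of `L`. That
  -- point is not in `L`, so some point of `L ⊆ A n` blocks it, contradicting that `A n` is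
  -- edge-free.
  obtain ⟨n, hTn, hLn⟩ := (hlarge.and hall).exists
  obtain ⟨i, hiz, hit⟩ := hl n
  rcases hLdom (x n i) (hx n i) hiz with h | ⟨a, ha, h⟩
  · exact absurd (hit.trans (hT _ h)) (not_le.2 hTn)
  · obtain ⟨j, hj⟩ := hLn a ha
    exact hE n j i (hj ▸ h)

theorem lateCells_antitone (ζ : PointConfig (SpaceTime d)) :
    Antitone fun t => lateCells ρ₀ s t ζ := by
  rintro t t' htt' z ⟨n, x, hx, hn, hE, ⟨i, hi, hit⟩, hdom⟩
  exact ⟨n, x, hx, hn, hE, ⟨i, hi, htt'.trans hit⟩, hdom⟩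

/-- Eventually, the unsaturated cells do not percolate. -/
theorem HasPoissonVoids.exists_ae_hasLogReach_lateCells (h : HasPoissonVoids Q (lebesgue d))
    (hρ₀ : 0 < ρ₀) (hs : 0 < s) {t : ℕ → ℝ≥0} (ht : Tendsto t atTop atTop) (htm : Monotone t) :
    ∃ n, ∀ᵐ ζ ∂Q, HasLogReach (lateCells ρ₀ s (t n) ζ) := by
  have := h.prob
  let Λ : ℕ → Set (PointConfig (SpaceTime d)) := fun n =>
    {ζ | (0 : Cell d) ∈ lateCells ρ₀ s (t n) ζ}
  have hΛm : ∀ n, MeasurableSet (Λ n) := fun n => measurableSet_mem_lateCells (t n) 0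
  -- The events decrease to the empty set, so the density of late cells eventually falls below the
  -- Peierls threshold.
  have hlim : Tendsto (fun n => Q (Λ n)) atTop (𝓝 0) := by
    have h1 := tendsto_measure_iInter_atTop (μ := Q) (fun n => (hΛm n).nullMeasurableSet)
      (fun m n hmn ζ hζ => lateCells_antitone ζ (htm hmn) hζ) ⟨0, measure_ne_top _ _⟩
    have h2 : ⋂ n, Λ n = ∅ := by
      refine eq_empty_of_forall_notMem fun ζ hζ => ?_
      obtain ⟨n, hn⟩ := exists_notMem_lateCells hρ₀ hs ζ 0 ht
      exact hn (mem_iInter.1 hζ n)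
    rwa [h2, measure_empty] at h1
  have hlim' : Tendsto (fun n => Q (Λ n) * 7 ^ d) atTop (𝓝 0) := by
    have := ENNReal.Tendsto.mul_const (b := (7 : ℝ≥0∞) ^ d) hlim
      (Or.inr (ENNReal.pow_ne_top (by simp)))
    rwa [zero_mul] at this
  obtain ⟨n, hn⟩ := (hlim'.eventually (ge_mem_nhds (show (0 : ℝ≥0∞) < 2⁻¹ by simp))).exists
  refine ⟨n, ?_⟩
  have hsparse := h.isSparse hs (hΛm n) fun ζ => zero_mem_lateCells_restrict (t n) ζ
  filter_upwards [hsparse.ae_hasLogReach hn] with ζ hζ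
  exact hζ.mono fun z hz => mem_lateCells_shift hs hz

/-- There is a time scale `h` such that, almost surely, neither the cells with an arrival in
`[j * h, (j + 1) * h)` nor the cells which are unsaturated at time `M * h` percolate. -/
theorem HasPoissonVoids.exists_ae_hasLogReach (h : HasPoissonVoids Q (lebesgue d))
    (hρ₀ : 0 < ρ₀) (hs : 0 < s) : ∃ (τ : ℝ≥0) (M : ℕ), 0 < τ ∧ ∀ᵐ ζ ∂Q,
      (∀ j : ℕ, HasLogReach (arrivalCells s (j * τ) ((j + 1) * τ) ζ)) ∧
      HasLogReach (lateCells ρ₀ s (M * τ) ζ) := by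
  have hfin : volume {x : E d | cellOf s x = 0} ≠ ∞ := by
    refine ((isBounded_near hs 0 0).subset ?_).measure_lt_top.ne
    intro x hx
    have hx' : cellOf s x = 0 := hx
    change Near _ _ _
    rw [hx']
    exact near_self le_rfl 0
  set v := (volume {x : E d | cellOf s x = 0}).toNNReal with hv
  -- Chosen so that the arrival density `v * τ` satisfies `v * τ * 7 ^ d ≤ 1 / 2`.
  let τ : ℝ≥0 := ((v + 1) * 7 ^ d * 2)⁻¹
  have hτ : 0 < τ := by positivity
  have ht : Tendsto (fun n : ℕ => (n : ℝ≥0) * τ) atTop atTop :=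
    tendsto_natCast_atTop_atTop.atTop_mul_const hτ
  obtain ⟨M, hM⟩ := h.exists_ae_hasLogReach_lateCells hρ₀ hs ht fun m n hmn => by
    have : (m : ℝ≥0) ≤ n := by exact_mod_cast hmn
    gcongr
  refine ⟨τ, M, hτ, ?_⟩
  refine (ae_all_iff.2 fun j => h.ae_hasLogReach_arrivalCells hs ?_).and hM
  have h1 : ENNReal.ofReal ((((j + 1) * τ : ℝ≥0) : ℝ) - ((j * τ : ℝ≥0) : ℝ)) = τ := by
    push_cast
    rw [← ENNReal.ofReal_coe_nnreal]
    congr 1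
    ring
  rw [h1, ← ENNReal.coe_toNNReal hfin, ← hv]
  have h2 : v * τ * 7 ^ d ≤ 2⁻¹ := by
    calc v * τ * 7 ^ d ≤ (v + 1) * τ * 7 ^ d := by gcongr; exact le_self_add
      _ = 2⁻¹ := by
        simp only [τ]
        field_simp
  calc (v : ℝ≥0∞) * τ * 7 ^ d = ((v * τ * 7 ^ d : ℝ≥0) : ℝ≥0∞) := by push_cast; rfl
    _ ≤ ((2⁻¹ : ℝ≥0) : ℝ≥0∞) := ENNReal.coe_le_coe.2 h2
    _ = 2⁻¹ := by rw [ENNReal.coe_inv two_ne_zero]; rfl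

end Cells

/-! ### Finiteness of ancestries and stabilization of the acceptance rule. -/

section Stabilization

variable {d : ℕ}

/-- Backward chains which pass through the random sets `S 0, …, S M`, none of which has long paths,
do not go far. -/
theorem near_of_chain {X : Type*} {V : Set X} {c : X → Cell d} {ph : X → ℕ}
    {S : ℕ → Set (Cell d)} {r : X → X → Prop}
    (hr : ∀ q p, r q p → Near 1 (c p) (c q) ∧ ph p ≤ ph q) {M l : ℕ}
    (hph : ∀ p ∈ V, ph p ≤ M) (hS : ∀ p ∈ V, c p ∈ S (ph p)) {p : X} (hp : p ∈ V)
    (hreach : ∀ x, Near (M * (l + 1)) (c p) x → ∀ j ≤ M, ∀ y, x ∈ S j → Reach (S j) x y →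
      Near l x y) {q : X} (h : Relation.ReflTransGen (fun q p => q ∈ V ∧ r q p) q p) :
    q ∈ V ∧ Near ((M + 1) * (l + 1)) (c p) (c q) := by
  have hmul : ∀ j ≤ M, (j : ℤ) * (l + 1) ≤ M * (l + 1) := fun j hj => by gcongr
  -- The invariant remembers a cell `x` at which the chain entered its current phase. A completed
  -- phase costs at most `l`, and the edge leading to the next phase costs `1`; skipped phases cost
  -- nothing.
  have key : q ∈ V ∧ ∃ x ∈ S (ph q), Near (ph q * (l + 1)) (c p) x ∧
      Reach (S (ph q)) x (c q) := by
    induction h using Relation.ReflTransGen.head_induction_on with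
    | refl => exact ⟨hp, c p, hS p hp, near_self (by positivity) _, Relation.ReflTransGen.refl⟩
    | @head a b hab _ ih =>
      obtain ⟨ha, hab⟩ := hab
      obtain ⟨hb, x, hx, hpx, hxb⟩ := ih
      obtain ⟨hn, hle⟩ := hr a b hab
      refine ⟨ha, ?_⟩
      rcases hle.eq_or_lt with heq | hlt
      · rw [← heq]
        exact ⟨x, hx, hpx, hxb.tail ⟨hn, heq ▸ hS a ha⟩⟩
      · refine ⟨c a, hS a ha, ?_, Relation.ReflTransGen.refl⟩
        have h1 := hreach x (hpx.mono (hmul _ (hph b hb))) _ (hph b hb) _ hx hxb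
        refine ((hpx.trans h1).trans hn).mono ?_
        have : ((ph b : ℤ) + 1) * (l + 1) ≤ ph a * (l + 1) := by
          gcongr
          exact_mod_cast hlt
        linarith
  obtain ⟨hq, x, hx, hpx, hxq⟩ := key
  have h1 := hreach x (hpx.mono (hmul _ (hph q hq))) _ (hph q hq) _ hx hxq
  refine ⟨hq, (hpx.trans h1).mono ?_⟩
  have := hmul _ (hph q hq)
  linarith

/-- `Nat.clog` is within `1` of the real logarithm, which is negligible against any positive power.
-/
theorem reachBound_isLittleO {α : ℝ} (hα : 0 < α) :
    (fun n : ℕ => (reachBound d n : ℝ)) =o[atTop] fun n : ℕ => (n : ℝ) ^ α := by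
  have h1 : ∀ n : ℕ, (reachBound d n : ℝ) ≤
      3 * (d + 2) * (Real.log (n + 1) / Real.log 2 + 1) := by
    intro n
    have h2 : 0 ≤ Real.logb (2 : ℕ) ((n + 1 : ℕ) : ℝ) :=
      Real.logb_nonneg (by norm_num) (by push_cast; linarith [n.cast_nonneg (α := ℝ)])
    have h3 := (Nat.ceil_lt_add_one h2).le
    rw [Real.natCeil_logb_natCast, Real.logb] at h3
    push_cast at h3
    rw [reachBound]
    push_cast
    rw [mul_assoc]
    gcongr
  have h2 : (fun x : ℝ => Real.log x) =o[atTop] fun x => x ^ α := isLittleO_log_rpow_atTop hα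
  have hcast : Tendsto (fun n : ℕ => (n : ℝ)) atTop atTop := tendsto_natCast_atTop_atTop
  have h3 : (fun n : ℕ => Real.log ((n : ℝ) + 1)) =o[atTop] fun n : ℕ => (n : ℝ) ^ α := by
    have hb : (fun n : ℕ => ((n : ℝ) + 1) ^ α) =O[atTop] fun n : ℕ => (n : ℝ) ^ α := by
      refine Asymptotics.IsBigO.rpow hα.le (Eventually.of_forall fun n => by positivity) ?_
      refine Asymptotics.IsBigO.of_bound 2 ?_
      filter_upwards [eventually_ge_atTop 1] with n hn
      have : (1 : ℝ) ≤ n := by exact_mod_cast hn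
      rw [Real.norm_of_nonneg (by positivity), Real.norm_of_nonneg (by positivity)]
      linarith
    exact (h2.comp_tendsto (tendsto_atTop_add_const_right _ 1 hcast)).trans_isBigO hb
  have h4 : (fun _ : ℕ => (1 : ℝ)) =o[atTop] fun n : ℕ => (n : ℝ) ^ α := by
    refine Asymptotics.isLittleO_const_left.2 (Or.inr ?_)
    exact tendsto_norm_atTop_atTop.comp ((tendsto_rpow_atTop hα).comp hcast)
  have h5 : (fun n : ℕ => 3 * ((d : ℝ) + 2) * (Real.log (n + 1) / Real.log 2 + 1)) =o[atTop]
      fun n : ℕ => (n : ℝ) ^ α := by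
    refine Asymptotics.IsLittleO.const_mul_left (Asymptotics.IsLittleO.add ?_ h4) _
    simp_rw [div_eq_inv_mul]
    exact h3.const_mul_left _
  refine (Asymptotics.IsBigO.of_norm_le fun n => ?_).trans_isLittleO h5
  rw [Real.norm_of_nonneg (by positivity)]
  exact h1 n

theorem eventually_mul_reachBound_le {α : ℝ} (hα : 0 < α) {K c : ℝ} (hK : 0 ≤ K) (hc : 0 < c) :
    ∀ᶠ n : ℕ in atTop, K * (reachBound d n + 1) ≤ c * (n : ℝ) ^ α := by
  -- Half of the budget `c * n ^ α` is spent on `K * reachBound d n`, the other half on the constant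
  -- `K`.
  have h1 := (reachBound_isLittleO (d := d) hα).def (c := c / (2 * (K + 1))) (by positivity)
  have h2 := ((tendsto_rpow_atTop hα).comp tendsto_natCast_atTop_atTop).eventually_ge_atTop
    (2 * K / c)
  filter_upwards [h1, h2] with n hn hn'
  rw [Real.norm_of_nonneg (by positivity), Real.norm_of_nonneg (by positivity),
    div_mul_eq_mul_div, le_div_iff₀ (by positivity)] at hn
  simp only [Function.comp_apply] at hn'
  rw [div_le_iff₀' hc] at hn'
  nlinarith [(reachBound d n).cast_nonneg (α := ℝ)]

variable {ρ₀ : ℝ} {ζ : PointConfig (SpaceTime d)} {τ : ℝ≥0}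

theorem Edge.near (hρ₀ : 0 < ρ₀) {p q : SpaceTime d} (h : Edge ρ₀ q p) :
    Near 1 (cellOf (2 * ρ₀) p.1) (cellOf (2 * ρ₀) q.1) :=
  near_cellOf (by positivity) (dist_comm p.1 q.1 ▸ (edge_iff.1 h).1.le)

theorem mem_arrivalCells_floor (hτ : 0 < τ) (s : ℝ) {p : SpaceTime d} (hp : p ∈ ζ.carrier) :
    cellOf s p.1 ∈ arrivalCells s (⌊p.2 / τ⌋₊ * τ) ((⌊p.2 / τ⌋₊ + 1) * τ) ζ := by
  refine ⟨p, hp, rfl, ?_, ?_⟩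
  · exact (le_div_iff₀ hτ).1 (Nat.floor_le zero_le)
  · exact (div_lt_iff₀ hτ).1 (Nat.lt_floor_add_one _)

/-- A chain of ancestors runs backwards through the finitely many time slabs before `p` and moves
only a bounded distance in each. All ancestors thus lie in one compact region of space-time, and
local finiteness concludes. -/
theorem finite_ancestors (hρ₀ : 0 < ρ₀) (hτ : 0 < τ)
    (hζ : ∀ j : ℕ, HasLogReach (arrivalCells (2 * ρ₀) (j * τ) ((j + 1) * τ) ζ))
    {p : SpaceTime d} (hp : p ∈ ζ.carrier) : (ancestors ρ₀ ζ.carrier p).Finite := by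
  have hs : 0 < 2 * ρ₀ := by positivity
  let c : SpaceTime d → Cell d := fun q => cellOf (2 * ρ₀) q.1
  let M : ℕ := ⌊p.2 / τ⌋₊
  let V : Set (SpaceTime d) := {q | q ∈ ζ.carrier ∧ q.2 ≤ p.2}
  -- Phases are numbered backwards in time: phase `j` is the slab of index `M - j`, so phases
  -- increase along a chain of ancestors.
  let S : ℕ → Set (Cell d) := fun j =>
    arrivalCells (2 * ρ₀) ((M - j : ℕ) * τ) (((M - j : ℕ) + 1) * τ) ζ
  have hfloor : ∀ {q q' : SpaceTime d}, q.2 ≤ q'.2 → ⌊q.2 / τ⌋₊ ≤ ⌊q'.2 / τ⌋₊ := fun h =>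
    Nat.floor_le_floor (by gcongr)
  -- The logarithmic bound depends on the scale `n` within which the chain must remain. Sublinear
  -- growth leaves room: half of `n` covers the displacement, the other half the position of `p`.
  have hsmall : ∀ᶠ n : ℕ in atTop, M * (reachBound d n + 1 : ℝ) ≤ 1 / 2 * (n : ℝ) ^ (1 : ℝ) :=
    eventually_mul_reachBound_le one_pos (by positivity) (by positivity)
  obtain ⟨B, hB⟩ : ∃ B : ℕ, Near B 0 (c p) := by
    refine ⟨∑ i, (c p i).natAbs, fun i => ?_⟩
    have := Finset.single_le_sum (f := fun i => (c p i).natAbs) (fun _ _ => Nat.zero_le _)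
      (Finset.mem_univ i)
    simp only [Pi.zero_apply, zero_sub, abs_neg, Int.abs_eq_natAbs]
    exact_mod_cast this
  obtain ⟨n, hnS, hnM, hnB⟩ := (((eventually_all_finite (finite_Iic M)).2 fun j _ =>
    hζ j).and (hsmall.and (eventually_ge_atTop (2 * B)))).exists
  set l := reachBound d n
  have hchain : ∀ q, Relation.ReflTransGen (fun q p => q ∈ V ∧ Edge ρ₀ q p) q p →
      q ∈ V ∧ Near ((M + 1) * (l + 1)) (c p) (c q) := by
    intro q hq
    refine near_of_chain (V := V) (c := c) (r := Edge ρ₀) (ph := fun q => M - ⌊q.2 / τ⌋₊) (S := S) (fun q p h => ⟨h.near hρ₀, ?_⟩)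
      (fun q _ => Nat.sub_le _ _) (fun q hq => ?_) ⟨hp, le_rfl⟩ (fun x hx j hj y hxS hr => ?_) hq
    · have := hfloor (edge_iff.1 h).2.le
      omega
    · have h1 := mem_arrivalCells_floor hτ (2 * ρ₀) hq.1
      have h2 : M - (M - ⌊q.2 / τ⌋₊) = ⌊q.2 / τ⌋₊ := Nat.sub_sub_self (hfloor hq.2)
      simp only [S, h2]
      exact h1
    · refine hnS (M - j) (Nat.sub_le _ _) x y ((hB.trans hx).mono ?_) hxS hr
      have h3 : M * (l + 1 : ℝ) + B ≤ n := by
        have : (2 * B : ℝ) ≤ n := by exact_mod_cast hnB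
        rw [Real.rpow_one] at hnM
        linarith
      have h4 : M * (l + 1) + B ≤ n := by exact_mod_cast h3
      exact_mod_cast (by omega : B + M * (l + 1) ≤ n)
  have hsub : ancestors ρ₀ ζ.carrier p ⊆ ζ.carrier ∩
      (closure {x : E d | Near (((M + 1) * (l + 1) : ℕ) : ℤ) (c p) (cellOf (2 * ρ₀) x)} ×ˢ
        Icc 0 p.2) := by
    intro q hq
    have h1 : q.2 ≤ p.2 ∧ Relation.ReflTransGen (fun q p => q ∈ V ∧ Edge ρ₀ q p) q p := by
      have hq' : Relation.TransGen (fun a b => a ∈ ζ.carrier ∧ Edge ρ₀ a b) q p := hq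
      induction hq' using Relation.TransGen.head_induction_on with
      | single h =>
        have h2 := (edge_iff.1 h.2).2.le
        exact ⟨h2, Relation.ReflTransGen.single ⟨⟨h.1, h2⟩, h.2⟩⟩
      | head h h' ih =>
        have ih := ih h'
        have h2 := (edge_iff.1 h.2).2.le.trans ih.1
        exact ⟨h2, Relation.ReflTransGen.head ⟨⟨h.1, h2⟩, h.2⟩ ih.2⟩
    obtain ⟨h2, h3⟩ := hchain q h1.2
    refine ⟨h2.1, subset_closure ?_, zero_le, h2.2⟩
    push_cast
    exact h3
  exact (ζ.locallyFinite _ ((isBounded_near hs _ _).isCompact_closure.prod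
    isCompact_Icc)).subset hsub

/-- The points of `ζ` above `A`. -/
def above (ζ : PointConfig (SpaceTime d)) (A : Set (E d)) : Set (SpaceTime d) :=
  ζ.carrier ∩ A ×ˢ univ

theorem accepted_or_blocked_above {A : Set (E d)}
    (hfin : ∀ p ∈ ζ.carrier, (ancestors ρ₀ ζ.carrier p).Finite) {p : SpaceTime d}
    (hp : p ∈ ζ.carrier) (hpA : p.1 ∈ A) :
    p ∈ accepted ρ₀ (above ζ A) ∨ ∃ q ∈ accepted ρ₀ (above ζ A), Edge ρ₀ q p :=
  accepted_or_blocked ⟨hp, hpA, trivial⟩ ((hfin p hp).subset (ancestors_mono inter_subset_left p))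

/-- Inside `A`, accepted points of arrival time at least `t` belong to unsaturated cells. -/
theorem mem_lateCells_of_accepted (hρ₀ : 0 < ρ₀)
    (hfin : ∀ p ∈ ζ.carrier, (ancestors ρ₀ ζ.carrier p).Finite) {A : Set (E d)} {t : ℝ≥0}
    {q : SpaceTime d} (hq : q ∈ accepted ρ₀ (above ζ A)) (hqt : t ≤ q.2)
    (hA : ∀ y : E d, Near 1 (cellOf (2 * ρ₀) q.1) (cellOf (2 * ρ₀) y) → y ∈ A) :
    cellOf (2 * ρ₀) q.1 ∈ lateCells ρ₀ (2 * ρ₀) t ζ := by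
  have hs : 0 < 2 * ρ₀ := by positivity
  set z := cellOf (2 * ρ₀) q.1
  have hE : ∀ a ∈ accepted ρ₀ (above ζ A) ∩ {a | Near 1 z (cellOf (2 * ρ₀) a.1)},
      ∀ b ∈ accepted ρ₀ (above ζ A) ∩ {a | Near 1 z (cellOf (2 * ρ₀) a.1)}, ¬ Edge ρ₀ a b :=
    fun a ha b hb => accepted_not_edge ha.1 hb.1
  -- The accepted points in adjacent cells are the blocking set. As cells have side `2 * ρ₀`, every
  -- blocker of a point of the cell lies in an adjacent cell.
  refine mem_lateCells_of_finite
    (A := accepted ρ₀ (above ζ A) ∩ {a | Near 1 z (cellOf (2 * ρ₀) a.1)})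
    (finite_of_edge_free hρ₀ hE (isBounded_near hs 1 z) fun a ha => ha.2)
    (fun a ha => (accepted_subset _ ha.1).1) (fun a ha => ha.2) hE
    ⟨hq, near_self zero_le_one z⟩ rfl hqt fun p hp hpz => ?_
  have hpn : Near 1 z (cellOf (2 * ρ₀) p.1) := hpz ▸ near_self zero_le_one _
  rcases accepted_or_blocked_above hfin hp (hA p.1 hpn) with h | ⟨a, ha, h⟩
  · exact Or.inl ⟨h, hpn⟩
  · exact Or.inr ⟨a, ⟨ha, hpz ▸ h.near hρ₀⟩, h⟩

/-- A point at which the acceptance in `A` and in the whole space differ has a parent with the same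
property. -/
theorem exists_disagreeing_parent
    (hfin : ∀ p ∈ ζ.carrier, (ancestors ρ₀ ζ.carrier p).Finite) {A : Set (E d)}
    {p : SpaceTime d} (hp : p ∈ ζ.carrier) (hpA : p.1 ∈ A)
    (h : ¬ (p ∈ accepted ρ₀ (above ζ A) ↔ p ∈ accepted ρ₀ ζ.carrier)) :
    ∃ q ∈ ζ.carrier, Edge ρ₀ q p ∧
      ¬ (q ∈ accepted ρ₀ (above ζ A) ↔ q ∈ accepted ρ₀ ζ.carrier) := by
  by_cases h1 : p ∈ accepted ρ₀ ζ.carrier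
  · have h2 : p ∉ accepted ρ₀ (above ζ A) := fun h2 => h (iff_of_true h2 h1)
    rcases accepted_or_blocked_above hfin hp hpA with h3 | ⟨q, hq, hqp⟩
    · exact absurd h3 h2
    · exact ⟨q, (accepted_subset _ hq).1, hqp, fun h4 => accepted_not_edge (h4.1 hq) h1 hqp⟩
  · have h2 : p ∈ accepted ρ₀ (above ζ A) := by
      by_contra h2
      exact h (iff_of_false h2 h1)
    rcases accepted_or_blocked hp (hfin p hp) with h3 | ⟨q, hq, hqp⟩
    · exact absurd h3 h1
    · exact ⟨q, accepted_subset _ hq, hqp, fun h4 => accepted_not_edge (h4.2 hq) h2 hqp⟩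

theorem above_univ : above ζ univ = ζ.carrier := by
  rw [above, univ_prod_univ, inter_univ]

/-- Stabilization: far inside `A`, acceptance in `A` and in the whole space are the same. -/
theorem accepted_above_iff (hρ₀ : 0 < ρ₀) (hτ : 0 < τ)
    (hfin : ∀ p ∈ ζ.carrier, (ancestors ρ₀ ζ.carrier p).Finite) {M n l : ℕ}
    (harr : ∀ j < M, ∀ x y, Near n 0 x →
      x ∈ arrivalCells (2 * ρ₀) (j * τ) ((j + 1) * τ) ζ →
      Reach (arrivalCells (2 * ρ₀) (j * τ) ((j + 1) * τ) ζ) x y → Near l x y)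
    (hlate : ∀ x y, Near n 0 x → x ∈ lateCells ρ₀ (2 * ρ₀) (M * τ) ζ →
      Reach (lateCells ρ₀ (2 * ρ₀) (M * τ) ζ) x y → Near l x y)
    {A : Set (E d)} {p : SpaceTime d} (hp : p ∈ ζ.carrier) {B : ℕ}
    (hB : Near B 0 (cellOf (2 * ρ₀) p.1)) (hBn : B + M * (l + 1) ≤ n)
    (hA : ∀ y : E d, Near ((M + 1) * (l + 1) + 2) (cellOf (2 * ρ₀) p.1) (cellOf (2 * ρ₀) y) →
      y ∈ A) :
    p ∈ accepted ρ₀ (above ζ A) ↔ p ∈ accepted ρ₀ ζ.carrier := by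
  by_contra hdis
  have hs : 0 < 2 * ρ₀ := by positivity
  let c : SpaceTime d → Cell d := fun q => cellOf (2 * ρ₀) q.1
  -- The points of disagreement all of whose adjacent cells are contained in `A`, which is what
  -- `mem_lateCells_of_accepted` needs.
  let V : Set (SpaceTime d) := {q | q ∈ ζ.carrier ∧
    ¬ (q ∈ accepted ρ₀ (above ζ A) ↔ q ∈ accepted ρ₀ ζ.carrier) ∧
    ∀ y : E d, Near 1 (c q) (cellOf (2 * ρ₀) y) → y ∈ A}
  -- Phase `0` collects all times from `M * τ` on, matching the truncated subtraction in `M - ⌊q.2 /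
  -- τ⌋₊`; the other phases are the slabs before `M * τ`, backwards in time.
  let S : ℕ → Set (Cell d) := fun j => if j = 0 then lateCells ρ₀ (2 * ρ₀) (M * τ) ζ else
    arrivalCells (2 * ρ₀) ((M - j : ℕ) * τ) (((M - j : ℕ) + 1) * τ) ζ
  have hpV : p ∈ V := ⟨hp, hdis, fun y hy => hA y (hy.mono (by nlinarith))⟩
  have hchain : ∀ q, Relation.ReflTransGen (fun q p => q ∈ V ∧ Edge ρ₀ q p) q p →
      q ∈ V ∧ Near ((M + 1) * (l + 1)) (c p) (c q) := by
    intro q hq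
    refine near_of_chain (V := V) (c := c) (r := Edge ρ₀) (ph := fun q => M - ⌊q.2 / τ⌋₊) (S := S) (fun q p h => ⟨h.near hρ₀, ?_⟩)
      (fun q _ => Nat.sub_le _ _) (fun q hq => ?_) hpV (fun x hx j hj y hxS hr => ?_) hq
    · have : ⌊q.2 / τ⌋₊ ≤ ⌊p.2 / τ⌋₊ := by
        have := (edge_iff.1 h).2.le
        exact Nat.floor_le_floor (by gcongr)
      omega
    · by_cases h0 : M - ⌊q.2 / τ⌋₊ = 0
      · simp only [S, h0, if_true]
        have hle : (M : ℝ≥0) * τ ≤ q.2 := by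
          rw [← le_div_iff₀ hτ]
          exact (Nat.cast_le.2 (by omega : M ≤ ⌊q.2 / τ⌋₊)).trans (Nat.floor_le zero_le)
        -- A point of disagreement is accepted in exactly one of the two constructions; in either
        -- case its cell is late.
        by_cases h1 : q ∈ accepted ρ₀ (above ζ A)
        · exact mem_lateCells_of_accepted hρ₀ hfin h1 hle hq.2.2
        · have h2 : q ∈ accepted ρ₀ ζ.carrier := by
            by_contra h2
            exact hq.2.1 (iff_of_false h1 h2)
          rw [← above_univ (ζ := ζ)] at h2
          exact mem_lateCells_of_accepted hρ₀ hfin h2 hle fun _ _ => trivial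
      · simp only [S, h0, if_false]
        have h2 : M - (M - ⌊q.2 / τ⌋₊) = ⌊q.2 / τ⌋₊ := Nat.sub_sub_self (by omega)
        rw [h2]
        exact mem_arrivalCells_floor hτ (2 * ρ₀) hq.1
    · have hx0 : Near n 0 x := by
        refine (hB.trans hx).mono ?_
        exact_mod_cast hBn
      by_cases h0 : j = 0
      · simp only [S, h0, if_true] at hxS hr
        exact hlate x y hx0 hxS hr
      · simp only [S, h0, if_false] at hxS hr
        exact harr (M - j) (by omega) x y hx0 hxS hr
  let R : Set (SpaceTime d) :=
    {q | Relation.ReflTransGen (fun q p => q ∈ V ∧ Edge ρ₀ q p) q p}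
  -- Among the points reached by the chains, take one with fewest ancestors. It has a disagreeing
  -- parent, which is again in `V` by the distance bound and has fewer ancestors.
  obtain ⟨q, hq, hmin⟩ := exists_minimalFor_of_wellFoundedLT (· ∈ R)
    (fun q => (ancestors ρ₀ ζ.carrier q).ncard) ⟨p, Relation.ReflTransGen.refl⟩
  obtain ⟨hqV, hqn⟩ := hchain q hq
  obtain ⟨q', hq', hE, hdis'⟩ := exists_disagreeing_parent hfin hqV.1
    (hqV.2.2 q.1 (near_self zero_le_one _)) hqV.2.1
  have hq'V : q' ∈ V := by
    refine ⟨hq', hdis', fun y hy => hA y ?_⟩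
    -- The `2` in the margin: one cell for the edge to the parent, one for the cells adjacent to the
    -- parent.
    exact ((hqn.trans (hE.near hρ₀)).trans hy).mono (by linarith)
  have hanc : q' ∈ ancestors ρ₀ ζ.carrier q := Relation.TransGen.single ⟨hq', hE⟩
  have hlt := ncard_lt_ncard (ancestors_ssubset hanc) (hfin q hqV.1)
  exact absurd (hmin (Relation.ReflTransGen.head ⟨hq'V, hE⟩ hq) hlt.le) (not_le.2 hlt)

/-- Apply `accepted_above_iff` at a scale proportional to `R`: the margin it needs is a constant
times `log R`, below the depth `R ^ α` available. -/
theorem eventually_accepted_above_iff (hρ₀ : 0 < ρ₀) (hτ : 0 < τ)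
    (hfin : ∀ p ∈ ζ.carrier, (ancestors ρ₀ ζ.carrier p).Finite) {M : ℕ}
    (harr : ∀ j : ℕ, HasLogReach (arrivalCells (2 * ρ₀) (j * τ) ((j + 1) * τ) ζ))
    (hlate : HasLogReach (lateCells ρ₀ (2 * ρ₀) (M * τ) ζ)) {D : Set (E d)}
    (hD : Bornology.IsBounded D) {α : ℝ} (hα : 0 < α) :
    ∀ᶠ R : ℝ in atTop, ∀ p ∈ ζ.carrier, p.1 ∈ shrink D R (R ^ α) →
      (p ∈ accepted ρ₀ (above ζ (R • D)) ↔ p ∈ accepted ρ₀ ζ.carrier) := by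
  obtain ⟨C, hC0, hC⟩ := hD.exists_pos_norm_le
  set s := 2 * ρ₀ with hsdef
  have hs : 0 < s := by positivity
  -- `B R` bounds the cell indices met by `R • D`, and the scale is `2 * B R`. The constant `κ` is
  -- such that `2 * B R ≤ κ * R` once `R ≥ 1`.
  let B : ℝ → ℕ := fun R => ⌈C * R / s⌉₊ + 1
  let κ : ℝ := 2 * C / s + 4
  have hκ : 0 < κ := by positivity
  have hn : Tendsto (fun R => 2 * B R) atTop atTop := by
    refine tendsto_atTop_mono (f := fun R : ℝ => ⌈C * R / s⌉₊) (fun R => by simp only [B]; omega) ?_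
    refine tendsto_nat_ceil_atTop.comp ?_
    simp_rw [mul_div_right_comm]
    exact tendsto_id.const_mul_atTop (by positivity)
  have hc : 0 < (κ ^ α)⁻¹ / 2 := by positivity
  filter_upwards [eventually_ge_atTop 1,
    hn.eventually ((eventually_all_finite (finite_Iio M)).2 fun j _ => harr j),
    hn.eventually hlate,
    hn.eventually (eventually_mul_reachBound_le (d := d) one_pos (K := M) (c := 1 / 2)
      (by positivity) (by positivity)),
    hn.eventually (eventually_mul_reachBound_le (d := d) hα (K := d * s * (M + 4))
      (by positivity) hc)] with R hR h1 h2 h3 h4 p hp hpR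
  set l := reachBound d (2 * B R)
  have hR0 : 0 < R := by linarith
  have hRα : 0 < R ^ α := Real.rpow_pos_of_pos hR0 α
  rw [shrink, if_neg hRα.ne'] at hpR
  obtain ⟨⟨x, hx, hxp⟩, hdist⟩ := hpR
  refine accepted_above_iff (n := 2 * B R) (l := l) (B := B R) hρ₀ hτ hfin
    (fun j hj x y h0 hx hr => h1 j hj x y h0 hx hr) (fun x y h0 hx hr => h2 x y h0 hx hr) hp
    ?_ ?_ ?_
  · have hnorm : ‖p.1‖ ≤ C * R := by
      rw [← hxp]
      simp only [norm_smul, Real.norm_of_nonneg hR0.le]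
      rw [mul_comm]
      gcongr
      exact hC x hx
    intro i
    have h5 : |p.1 i| ≤ C * R := (PiLp.norm_apply_le p.1 i).trans hnorm
    have h6 : |p.1 i / s| ≤ C * R / s := by
      rw [abs_div, abs_of_pos hs]
      gcongr
    have h7 := Nat.le_ceil (C * R / s)
    rw [abs_le] at h6
    have h8 : ⌊p.1 i / s⌋ ≤ (⌈C * R / s⌉₊ : ℤ) := by
      rw [Int.floor_le_iff]
      push_cast
      linarith
    have h9 : -(⌈C * R / s⌉₊ : ℤ) ≤ ⌊p.1 i / s⌋ := by
      rw [Int.le_floor]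
      push_cast
      linarith
    simp only [Pi.zero_apply, zero_sub, abs_neg, cellOf, B, abs_le, ← hsdef]
    push_cast
    omega
  · rw [Real.rpow_one] at h3
    push_cast at h3
    have : (M : ℝ) * (l + 1) ≤ B R := by linarith
    have : M * (l + 1) ≤ B R := by exact_mod_cast this
    omega
  · intro y hy
    by_contra hyD
    have h5 : dist p.1 y ≤ d * (s * (((M + 1) * (l + 1) + 2 : ℕ) + 1)) := by
      refine dist_le_of_near hs ?_
      push_cast
      exact hy
    have h6 : R ^ α < dist p.1 y := hdist.trans_le (Metric.infDist_le_dist_of_mem hyD)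
    have h7 : ((2 * B R : ℕ) : ℝ) ≤ κ * R := by
      have := (Nat.ceil_lt_add_one (show 0 ≤ C * R / s by positivity)).le
      simp only [B, κ]
      push_cast
      have h8 : 2 * C / s * R = 2 * (C * R / s) := by ring
      nlinarith
    have h8 : ((2 * B R : ℕ) : ℝ) ^ α ≤ κ ^ α * R ^ α := by
      rw [← Real.mul_rpow hκ.le hR0.le]
      exact Real.rpow_le_rpow (by positivity) h7 hα.le
    have h9 : (κ ^ α)⁻¹ / 2 * ((2 * B R : ℕ) : ℝ) ^ α ≤ R ^ α / 2 := by
      calc _ ≤ (κ ^ α)⁻¹ / 2 * (κ ^ α * R ^ α) := by gcongr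
        _ = R ^ α / 2 := by field_simp
    -- The `2` is the margin in `accepted_above_iff` and the `1` comes from `dist_le_of_near`; both
    -- are absorbed since `3 ≤ 3 * (l + 1)`.
    have h10 : d * (s * (((M + 1) * (l + 1) + 2 : ℕ) + 1)) ≤ d * s * (M + 4) * ((l : ℝ) + 1) := by
      have hX : ((((M + 1) * (l + 1) + 2 : ℕ) : ℝ) + 1) ≤ (M + 4) * ((l : ℝ) + 1) := by
        push_cast
        nlinarith [l.cast_nonneg (α := ℝ)]
      rw [← mul_assoc, mul_assoc ((d : ℝ) * s)]
      exact mul_le_mul_of_nonneg_left hX (by positivity)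
    linarith

end Stabilization

/-! ### Dilations and erosions of Lipschitz sets. -/

section LipschitzSets

variable {d : ℕ} {D : Set (E d)}

theorem compl_nonempty_of_isBounded (hd : 1 ≤ d) (hD : Bornology.IsBounded D) : Dᶜ.Nonempty := by
  obtain ⟨C, hC⟩ := hD.exists_norm_le
  obtain ⟨x, hx⟩ := exists_norm_gt hd C
  exact ⟨x, fun h => (hC x h).not_gt hx⟩

theorem shrink_eq {R r : ℝ} (hr : 0 < r) :
    shrink D R r = {x | r < Metric.infDist x (R • D)ᶜ} := by
  rw [shrink, if_neg hr.ne']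
  ext x
  refine ⟨fun h => h.2, fun h => ⟨?_, h⟩⟩
  by_contra hx
  have h' : r < Metric.infDist x (R • D)ᶜ := h
  rw [Metric.infDist_zero_of_mem hx] at h'
  exact absurd h' (not_lt.2 hr.le)

theorem smul_compl {R : ℝ} (hR : R ≠ 0) (A : Set (E d)) : R • Aᶜ = (R • A)ᶜ := by
  have := Set.smul_set_compl (s := A) (a := Units.mk0 R hR)
  exact this

/-- Rescaling turns depth `r` in `R • D` into depth `r / R` in the fixed set `D`; for `r = R ^ α`
with `α < 1` this depth tends to `0`. -/
theorem shrink_eq_smul {R r : ℝ} (hR : 0 < R) (hr : 0 < r) :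
    shrink D R r = R • {x | r / R < Metric.infDist x Dᶜ} := by
  rw [shrink_eq hr, ← smul_compl hR.ne']
  ext x
  rw [Set.mem_smul_set_iff_inv_smul_mem₀ hR.ne']
  simp only [mem_ofPred_eq]
  have : x = R • R⁻¹ • x := by rw [smul_inv_smul₀ hR.ne']
  conv_lhs => rw [this, infDist_smul₀ hR.ne', Real.norm_of_nonneg hR.le]
  rw [div_lt_iff₀' hR]

theorem IsLipschitzSet.smul {A : Set (E d)} (hA : IsLipschitzSet A) {R : ℝ} (hR : 0 < R) :
    IsLipschitzSet (R • A) := by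
  obtain ⟨hne, hb, hm, hloc⟩ := hA
  refine ⟨hne.smul_set, hb.smul₀ R, hm.const_smul_of_ne_zero hR.ne', fun x hx => ?_⟩
  have hfr : frontier (R • A) = R • frontier A :=
    ((Homeomorph.smulOfNeZero R hR.ne').image_frontier A).symm
  rw [hfr] at hx
  obtain ⟨y, hy, rfl⟩ := hx
  obtain ⟨e, K, g, he, hg, U, hU, hUp⟩ := hloc y hy
  refine ⟨e, K, fun u => R * g (R⁻¹ • u), he, ?_, R • U, ?_, ?_⟩
  · refine LipschitzWith.of_dist_le_mul fun u v => ?_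
    have h1 := hg.dist_le_mul (R⁻¹ • u) (R⁻¹ • v)
    rw [dist_smul₀, Real.norm_of_nonneg (inv_nonneg.2 hR.le)] at h1
    rw [Real.dist_eq, ← mul_sub, abs_mul, abs_of_pos hR, ← Real.dist_eq]
    calc R * dist (g (R⁻¹ • u)) (g (R⁻¹ • v)) ≤ R * (K * (R⁻¹ * dist u v)) := by gcongr
      _ = K * dist u v := by field_simp
  · exact smul_mem_nhds_smul₀ hR.ne' hU
  · rintro _ ⟨q, hq, rfl⟩
    simp only [map_smul, inner_smul_right, inv_smul_smul₀ hR.ne',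
      Set.smul_mem_smul_set_iff₀ hR.ne']
    obtain ⟨h1, h2⟩ := hUp q hq
    exact ⟨fun h => h1 (lt_of_mul_lt_mul_left h hR.le), fun h => h2 (lt_of_mul_lt_mul_left h hR.le)⟩

/-- The local charts of a Lipschitz set can be taken on balls of a common radius. -/
theorem IsLipschitzSet.exists_uniform (hD : IsLipschitzSet D) :
    ∃ δ > 0, ∀ x ∈ frontier D, ∃ (e : E d) (K : ℝ≥0) (g : (ℝ ∙ e)ᗮ → ℝ), ‖e‖ = 1 ∧
      LipschitzWith K g ∧ ∀ p ∈ Metric.ball x δ,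
      (inner ℝ e p < g ((ℝ ∙ e)ᗮ.orthogonalProjectionOnto p) → p ∈ D) ∧
      (g ((ℝ ∙ e)ᗮ.orthogonalProjectionOnto p) < inner ℝ e p → p ∉ D) := by
  obtain ⟨-, hb, -, hloc⟩ := hD
  have hc : IsCompact (frontier D) :=
    hb.isCompact_closure.of_isClosed_subset isClosed_frontier frontier_subset_closure
  choose! e K g he hg U hU hUp using hloc
  obtain ⟨δ, hδ, hδU⟩ := lebesgue_number_lemma_of_metric (ι := frontier D)
    (c := fun x => interior (U x)) hc (fun _ => isOpen_interior) fun x hx =>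
      mem_iUnion.2 ⟨⟨x, hx⟩, mem_interior_iff_mem_nhds.2 (hU x hx)⟩
  refine ⟨δ, hδ, fun x hx => ?_⟩
  obtain ⟨y, hy⟩ := hδU x hx
  exact ⟨e y, K y, g y, he y y.2, hg y y.2, fun p hp => hUp y y.2 p (interior_subset (hy hp))⟩

theorem orthogonalProjectionOnto_smul_self (e : E d) (c : ℝ) :
    (ℝ ∙ e)ᗮ.orthogonalProjectionOnto (c • e) = 0 := by
  rw [Submodule.orthogonalProjectionOnto_eq_zero_iff]
  exact Submodule.le_orthogonal_orthogonal _ (Submodule.smul_mem _ _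
    (Submodule.mem_span_singleton_self e))

theorem IsLipschitzSet.interior_nonempty (hd : 1 ≤ d) (hD : IsLipschitzSet D) :
    (interior D).Nonempty := by
  obtain ⟨δ, hδ, hloc⟩ := hD.exists_uniform
  obtain ⟨x, hx⟩ := nonempty_frontier_iff.2 ⟨hD.1,
    fun h => (compl_nonempty_of_isBounded hd hD.2.1).ne_empty (h ▸ compl_univ)⟩
  obtain ⟨e, K, g, he, hg, hp⟩ := hloc x hx
  have hπ : Continuous fun p : E d => g ((ℝ ∙ e)ᗮ.orthogonalProjectionOnto p) :=
    hg.continuous.comp (ContinuousLinearMap.continuous _)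
  have hi : Continuous fun p : E d => inner ℝ e p := by fun_prop
  rcases le_or_gt (inner ℝ e x) (g ((ℝ ∙ e)ᗮ.orthogonalProjectionOnto x)) with h | h
  · refine ⟨x - (δ / 2) • e, mem_interior.2 ⟨Metric.ball x δ ∩
      {p | inner ℝ e p < g ((ℝ ∙ e)ᗮ.orthogonalProjectionOnto p)}, fun p h => (hp p h.1).1 h.2,
      Metric.isOpen_ball.inter (isOpen_lt hi hπ), ?_, ?_⟩⟩
    · rw [mem_ball_iff_norm, sub_sub_cancel_left, norm_neg, norm_smul, he, mul_one,
        Real.norm_of_nonneg (by positivity)]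
      linarith
    · rw [mem_ofPred_eq, map_sub, orthogonalProjectionOnto_smul_self, sub_zero, inner_sub_right,
        inner_smul_right, real_inner_self_eq_norm_sq, he]
      linarith
  -- A boundary point cannot lie strictly above the graph, since it would have a neighbourhood
  -- disjoint from `D`.
  · have hx' : x ∈ closure D := frontier_subset_closure hx
    obtain ⟨q, ⟨hq1, hq2⟩, hqD⟩ := mem_closure_iff.1 hx' (Metric.ball x δ ∩
      {p | g ((ℝ ∙ e)ᗮ.orthogonalProjectionOnto p) < inner ℝ e p})
      (Metric.isOpen_ball.inter (isOpen_lt hπ hi)) ⟨Metric.mem_ball_self hδ, h⟩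
    exact absurd hqD ((hp q hq1).2 hq2)

/-- Lower envelope of the translates of a graph by the vectors of norm at most `ε`. -/
def erodedGraph (e : E d) (g : (ℝ ∙ e)ᗮ → ℝ) (ε : ℝ) (u : (ℝ ∙ e)ᗮ) : ℝ :=
  ⨅ w : Metric.closedBall (0 : E d) ε,
    (g (u + (ℝ ∙ e)ᗮ.orthogonalProjectionOnto (w : E d)) - inner ℝ e (w : E d))

theorem bddBelow_erodedGraph {e : E d} (he : ‖e‖ = 1) {K : ℝ≥0} {g : (ℝ ∙ e)ᗮ → ℝ}
    (hg : LipschitzWith K g) (ε : ℝ) (u : (ℝ ∙ e)ᗮ) :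
    BddBelow (range fun w : Metric.closedBall (0 : E d) ε =>
      (g (u + (ℝ ∙ e)ᗮ.orthogonalProjectionOnto (w : E d)) - inner ℝ e (w : E d))) := by
  refine ⟨g u - K * ε - ε, ?_⟩
  rintro _ ⟨⟨w, hw⟩, rfl⟩
  rw [mem_closedBall_zero_iff] at hw
  have h1 := hg.dist_le_mul u (u + (ℝ ∙ e)ᗮ.orthogonalProjectionOnto w)
  have h2 : ‖(ℝ ∙ e)ᗮ.orthogonalProjectionOnto w‖ ≤ ‖w‖ :=
    Submodule.norm_orthogonalProjectionOnto_apply_le _ _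
  have h3 : inner ℝ e w ≤ ε := (real_inner_le_norm e w).trans (by rw [he, one_mul]; exact hw)
  rw [dist_self_add_right] at h1
  have h4 := (abs_le.1 ((Real.dist_eq _ _).symm.trans_le h1)).2
  have h5 : (K : ℝ) * ‖(ℝ ∙ e)ᗮ.orthogonalProjectionOnto w‖ ≤ K * ε := by
    gcongr
    exact h2.trans hw
  simp only
  linarith

theorem lipschitzWith_erodedGraph {e : E d} (he : ‖e‖ = 1) {K : ℝ≥0} {g : (ℝ ∙ e)ᗮ → ℝ}
    (hg : LipschitzWith K g) {ε : ℝ} (hε : 0 ≤ ε) : LipschitzWith K (erodedGraph e g ε) := by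
  have : Nonempty (Metric.closedBall (0 : E d) ε) := ⟨⟨0, Metric.mem_closedBall_self hε⟩⟩
  refine LipschitzWith.of_le_add_mul K fun u v => ?_
  rw [← sub_le_iff_le_add]
  refine le_ciInf fun w => ?_
  have h1 := ciInf_le (bddBelow_erodedGraph he hg ε u) w
  have h2 := hg.dist_le_mul (u + (ℝ ∙ e)ᗮ.orthogonalProjectionOnto (w : E d))
    (v + (ℝ ∙ e)ᗮ.orthogonalProjectionOnto (w : E d))
  rw [dist_add_right] at h2
  have h3 := (abs_le.1 ((Real.dist_eq _ _).symm.trans_le h2)).2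
  rw [erodedGraph]
  linarith

/-- Small erosions of a bounded Lipschitz set are Lipschitz sets. -/
theorem IsLipschitzSet.exists_erosion (hd : 1 ≤ d) (hD : IsLipschitzSet D) :
    ∃ ε₀ > 0, ∀ ε, 0 < ε → ε < ε₀ → IsLipschitzSet {x | ε < Metric.infDist x Dᶜ} := by
  have hcne := compl_nonempty_of_isBounded hd hD.2.1
  obtain ⟨δ, hδ, hloc⟩ := hD.exists_uniform
  obtain ⟨x₁, hx₁⟩ := hD.interior_nonempty hd
  have hpos : 0 < Metric.infDist x₁ Dᶜ := by
    refine (Metric.infDist_pos_iff_notMem_closure hcne).1 ?_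
    rw [closure_compl]
    exact not_not_intro hx₁
  have hcont : Continuous fun x : E d => Metric.infDist x Dᶜ := Metric.continuous_infDist_pt _
  have hsub : ∀ ε : ℝ, 0 ≤ ε → {x | ε < Metric.infDist x Dᶜ} ⊆ D := by
    intro ε hε x hx
    by_contra hxD
    have hx' : ε < Metric.infDist x Dᶜ := hx
    rw [Metric.infDist_zero_of_mem hxD] at hx'
    exact absurd hx' (not_lt.2 hε)
  -- The second bound keeps `x₁` in the erosion. For the first: a chart is centred within `2 * ε` of
  -- `x₀`, and points within `ε` of the ball of radius `ε` about `x₀` must stay in it.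
  refine ⟨min (δ / 4) (Metric.infDist x₁ Dᶜ), by positivity, fun ε hε hεlt => ?_⟩
  obtain ⟨hε1, hε2⟩ := lt_min_iff.1 hεlt
  have hopen : IsOpen {x | ε < Metric.infDist x Dᶜ} := isOpen_lt continuous_const hcont
  refine ⟨⟨x₁, hε2⟩, hD.2.1.subset (hsub ε hε.le), hopen.measurableSet, fun x₀ hx₀ => ?_⟩
  have hx₀ε : Metric.infDist x₀ Dᶜ = ε := (frontier_lt_subset_eq continuous_const hcont hx₀).symm
  have hx₀D : x₀ ∈ D := hsub 0 le_rfl (show 0 < Metric.infDist x₀ Dᶜ by rw [hx₀ε]; exact hε)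
  obtain ⟨y, hy, hyd⟩ := (Metric.infDist_lt_iff hcne (r := 2 * ε)).1 (by rw [hx₀ε]; linarith)
  -- The ball is connected and contains both a point of `D` and a point of its complement.
  obtain ⟨x, hxb, hxf⟩ : (Metric.ball x₀ (2 * ε) ∩ frontier D).Nonempty := by
    by_contra hcon
    have hcov : Metric.ball x₀ (2 * ε) ⊆ interior D ∪ interior Dᶜ := by
      intro z hz
      rw [← compl_frontier_eq_union_interior]
      exact fun hzf => hcon ⟨z, hz, hzf⟩
    have hy' : y ∈ Metric.ball x₀ (2 * ε) := by rwa [Metric.mem_ball, dist_comm]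
    have hx₀' : x₀ ∈ Metric.ball x₀ (2 * ε) := Metric.mem_ball_self (by positivity)
    obtain ⟨z, -, hz, hz'⟩ := (convex_ball x₀ (2 * ε)).isPreconnected _ _ isOpen_interior
      isOpen_interior hcov
      ⟨x₀, hx₀', (hcov hx₀').resolve_right fun h => interior_subset h hx₀D⟩
      ⟨y, hy', (hcov hy').resolve_left fun h => hy (interior_subset h)⟩
    exact interior_subset hz' (interior_subset hz)
  obtain ⟨e, K, g, he, hg, hp⟩ := hloc x hxf
  have : Nonempty (Metric.closedBall (0 : E d) ε) := ⟨⟨0, Metric.mem_closedBall_self hε.le⟩⟩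
  have hπ : Continuous fun p : E d => g ((ℝ ∙ e)ᗮ.orthogonalProjectionOnto p) :=
    hg.continuous.comp (ContinuousLinearMap.continuous _)
  have hi : Continuous fun p : E d => inner ℝ e p := by fun_prop
  have hball : ∀ p ∈ Metric.ball x₀ ε, ∀ q, dist p q ≤ ε → q ∈ Metric.ball x δ := by
    intro p hpb q hpq
    rw [Metric.mem_ball] at *
    have h1 := dist_triangle4 q p x₀ x
    rw [dist_comm q p, dist_comm x₀ x] at h1
    linarith
  refine ⟨e, K, erodedGraph e g ε, he, lipschitzWith_erodedGraph he hg hε.le, Metric.ball x₀ ε,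
    Metric.ball_mem_nhds x₀ hε, fun p hpb => ⟨fun hlt => ?_, fun hlt => ?_⟩⟩
  -- Otherwise a nearest point `q` of the closure of the complement is within `ε`. As `p` is below
  -- all translated graphs, `q` is strictly below the graph, hence in the interior of `D`.
  · by_contra hcon
    have hcon' : Metric.infDist p Dᶜ ≤ ε := not_lt.1 hcon
    obtain ⟨q, hq, hqd⟩ := isClosed_closure.exists_infDist_eq_dist hcne.closure p
    rw [Metric.infDist_closure] at hqd
    have hqε : dist p q ≤ ε := hqd ▸ hcon'
    have hw : q - p ∈ Metric.closedBall (0 : E d) ε := by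
      rw [mem_closedBall_zero_iff, ← dist_eq_norm, dist_comm]
      exact hqε
    have h1 := hlt.trans_le (ciInf_le (bddBelow_erodedGraph he hg ε _) ⟨q - p, hw⟩)
    simp only [← map_add, add_sub_cancel, inner_sub_right] at h1
    have h2 : inner ℝ e q < g ((ℝ ∙ e)ᗮ.orthogonalProjectionOnto q) := by linarith
    obtain ⟨r, ⟨hr1, hr2⟩, hrD⟩ := mem_closure_iff.1 hq (Metric.ball x δ ∩
      {p | inner ℝ e p < g ((ℝ ∙ e)ᗮ.orthogonalProjectionOnto p)})
      (Metric.isOpen_ball.inter (isOpen_lt hi hπ)) ⟨hball p hpb q hqε, h2⟩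
    exact hrD ((hp r hr1).1 hr2)
  -- Some translation by at most `ε` carries `p` strictly above the graph, that is, out of `D`.
  · obtain ⟨⟨w, hw⟩, hwlt⟩ := exists_lt_of_ciInf_lt hlt
    simp only [← map_add] at hwlt
    rw [mem_closedBall_zero_iff] at hw
    have hpw : dist p (p + w) ≤ ε := by rwa [dist_self_add_right]
    have h1 : p + w ∉ D := by
      refine (hp (p + w) (hball p hpb _ hpw)).2 ?_
      rw [inner_add_right]
      linarith
    intro hmem
    have h2 : ε < Metric.infDist p Dᶜ := hmem
    exact absurd (h2.trans_le (Metric.infDist_le_dist_of_mem h1)) (not_lt.2 hpw)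

/-- Locality is only assumed on `dilates D`, so the eroded domains have to be shown to belong to it.
-/
theorem IsLipschitzSet.eventually_shrink_mem_dilates (hd : 1 ≤ d) (hD : IsLipschitzSet D) {α : ℝ}
    (hα : α < 1) : ∀ᶠ R : ℝ in atTop, shrink D R (R ^ α) ∈ dilates D := by
  obtain ⟨ε₀, hε₀, h⟩ := hD.exists_erosion hd
  have hlim : Tendsto (fun R : ℝ => R ^ α / R) atTop (𝓝 0) := by
    refine (tendsto_rpow_neg_atTop (y := 1 - α) (by linarith)).congr' ?_
    filter_upwards [eventually_gt_atTop 0] with R hR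
    rw [neg_sub, Real.rpow_sub hR, Real.rpow_one]
  filter_upwards [eventually_gt_atTop 0, hlim.eventually (gt_mem_nhds hε₀)] with R hR hRε
  have hRα : 0 < R ^ α := Real.rpow_pos_of_pos hR α
  refine ⟨R, R ^ α, hR, hRα.le, rfl, ?_⟩
  rw [shrink_eq_smul hR hRα]
  exact (h _ (by positivity) hRε).smul hR

theorem IsLipschitzSet.volume_real_pos (hd : 1 ≤ d) (hD : IsLipschitzSet D) :
    0 < volume.real D := by
  refine ENNReal.toReal_pos ?_ hD.2.1.measure_lt_top.ne
  exact ((isOpen_interior.measure_pos volume (hD.interior_nonempty hd)).trans_le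
    (measure_mono interior_subset)).ne'

theorem volume_real_smul {R : ℝ} (hR : 0 ≤ R) : volume.real (R • D) = R ^ d * volume.real D := by
  rw [measureReal_def, Measure.addHaar_smul, ENNReal.toReal_mul, measureReal_def,
    ENNReal.toReal_ofReal (abs_nonneg _), finrank_euclideanSpace, Fintype.card_fin,
    abs_of_nonneg (by positivity)]

end LipschitzSets

/-! ### Admissibility of parking sets and comparison of the functionals. -/

section Main

variable {d : ℕ} {ρ₀ ρ₁ ρ₂ : ℝ} {ζ : PointConfig (SpaceTime d)}

theorem parking_carrier (hρ₀ : 0 < ρ₀) (A : Set (E d)) (ζ : PointConfig (SpaceTime d)) :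
    (parking hρ₀ A ζ).carrier = Prod.fst '' accepted ρ₀ (above ζ A) := rfl

/-- Every random parking point set in `A` extends to an admissible point set. -/
theorem exists_isExtension (hρ₀ : 0 < ρ₀) (h₁₀ : ρ₁ < 2 * ρ₀) (h₀₂ : 2 * ρ₀ < ρ₂)
    (hfin : ∀ p ∈ ζ.carrier, (ancestors ρ₀ ζ.carrier p).Finite)
    (hdense : ∀ (x : E d) (r : ℝ), 0 < r → ∃ p ∈ ζ.carrier, dist p.1 x < r)
    (hgen : IsGeneral (Prod.fst '' ζ.carrier)) (A : Set (E d)) :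
    ∃ ζ', IsExtension ρ₁ ρ₂ A (parking hρ₀ A ζ) ζ' := by
  set B := (parking hρ₀ A ζ).carrier with hBdef
  have hBA : B ⊆ A := by
    rintro _ ⟨p, hp, rfl⟩
    exact (accepted_subset _ hp).2.1
  have hBζ : B ⊆ Prod.fst '' ζ.carrier := by
    rintro _ ⟨p, hp, rfl⟩
    exact mem_image_of_mem _ (accepted_subset _ hp).1
  have hBsep : B.Pairwise fun x y => 2 * ρ₀ ≤ dist x y := by
    rintro _ ⟨p, hp, rfl⟩ _ ⟨q, hq, rfl⟩ hpq
    exact two_mul_le_dist (fun _ h _ h' => accepted_not_edge h h') hp hq fun h => hpq (h ▸ rfl)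
  -- A maximal separated set containing `B`, whose new points are projected Poisson points outside
  -- `A`: general position and the trace on `A` are then preserved automatically.
  obtain ⟨Z, hBZ, hZ⟩ := zorn_subset_nonempty
    {Z : Set (E d) | Z ⊆ B ∪ (Prod.fst '' ζ.carrier) \ A ∧ Z.Pairwise fun x y => 2 * ρ₀ ≤ dist x y}
    (fun c hc hchain _ => ⟨⋃₀ c, ⟨sUnion_subset fun Z hZ => (hc hZ).1,
      (pairwise_sUnion hchain.directedOn).2 fun Z hZ => (hc hZ).2⟩,
      fun Z hZ => subset_sUnion_of_mem hZ⟩) B ⟨subset_union_left, hBsep⟩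
  obtain ⟨hZsub, hZsep⟩ := hZ.prop
  have hZζ : Z ⊆ Prod.fst '' ζ.carrier := hZsub.trans (union_subset hBζ sdiff_subset)
  have hZA : Z ∩ A = B := by
    refine Subset.antisymm ?_ (subset_inter hBZ hBA)
    rintro x ⟨hx, hxA⟩
    exact (hZsub hx).resolve_right fun h => h.2 hxA
  refine ⟨⟨Z, fun K hK => finite_inter_of_separated (r := 2 * ρ₀) (by positivity)
    (fun x hx y hy hxy => hZsep hx hy hxy) hK⟩, ⟨?_, ?_, ?_⟩, hZA⟩
  · exact ⟨fun t ht => hgen.1 t (ht.trans hZζ), fun t ht => hgen.2 t (ht.trans hZζ)⟩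
  · exact fun x hx y hy hxy => h₁₀.le.trans (hZsep hx hy hxy)
  · intro z
    -- Every Poisson point is within `2 * ρ₀` of `Z`: in `A` because it is accepted or blocked,
    -- outside `A` by maximality. The slack `ρ₂ - 2 * ρ₀` pays for moving from `z` to a Poisson
    -- point.
    obtain ⟨p, hp, hpz⟩ := hdense z (ρ₂ - 2 * ρ₀) (by linarith)
    suffices h : ∃ x ∈ Z, dist x p.1 < 2 * ρ₀ by
      obtain ⟨x, hx, hxp⟩ := h
      refine ⟨x, ?_, hx⟩
      rw [Metric.mem_ball]
      linarith [dist_triangle x p.1 z]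
    by_cases hpA : p.1 ∈ A
    · rcases accepted_or_blocked_above hfin hp hpA with h | ⟨q, hq, hqp⟩
      · exact ⟨p.1, hBZ (mem_image_of_mem _ h), by simpa using hρ₀⟩
      · exact ⟨q.1, hBZ (mem_image_of_mem _ hq), (edge_iff.1 hqp).1⟩
    · by_contra! hcon
      have hins : insert p.1 Z ⊆ Z := hZ.le_of_ge ⟨insert_subset
        (Or.inr ⟨mem_image_of_mem _ hp, hpA⟩) hZsub, hZsep.insert fun x hx _ =>
          ⟨dist_comm x p.1 ▸ hcon x hx, hcon x hx⟩⟩ (subset_insert _ _)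
      have := hcon p.1 (hins (mem_insert _ _))
      rw [dist_self] at this
      linarith

/-- A measurable set of admissible point sets. -/
def strictlyAdmissible (d : ℕ) (ρ₁ r : ℝ) : Set (PointConfig (E d)) :=
  {ζ | (GenPos hyperplaneLift d ζ.carrier ∧ GenPos sphereLift (d + 1) ζ.carrier) ∧
    (∀ x ∈ ζ.carrier, ∀ y ∈ ζ.carrier, x ≠ y → ρ₁ ≤ dist x y) ∧
    ∀ k : ℕ, ∃ x ∈ ζ.carrier, dist x (TopologicalSpace.denseSeq (E d) k) < r}

theorem measurableSet_strictlyAdmissible (d : ℕ) (ρ₁ r : ℝ) :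
    MeasurableSet (strictlyAdmissible d ρ₁ r) := by
  refine ((measurableSet_genPos continuous_hyperplaneLift d).inter
    (measurableSet_genPos continuous_sphereLift (d + 1))).inter (MeasurableSet.inter ?_ ?_)
  · refine PointConfig.measurableSet_forall_mem measurable_id
      (U := fun x ζ => ∀ y ∈ ζ.carrier, x ≠ y → ρ₁ ≤ dist x y) ?_
    refine PointConfig.measurableSet_forall_mem (X := E d) (Y := E d × PointConfig (E d))
      measurable_snd (U := fun y p => p.1 ≠ y → ρ₁ ≤ dist p.1 y) ?_
    exact (measurableSet_eq_fun (by fun_prop) (by fun_prop)).compl.imp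
      (measurableSet_le (by fun_prop) (by fun_prop))
  · change MeasurableSet {ζ : PointConfig (E d) | ∀ k : ℕ,
      ∃ x ∈ ζ.carrier, dist x (TopologicalSpace.denseSeq (E d) k) < r}
    simp only [ofPred_forall]
    refine MeasurableSet.iInter fun k => PointConfig.measurableSet_exists_mem measurable_id
      (U := fun x _ => dist x (TopologicalSpace.denseSeq (E d) k) < r) ?_
    exact measurableSet_lt (by fun_prop) (by fun_prop)

/-- The strict inequality allows the empty space condition to be tested on a countable dense set of
centres, which keeps the smaller set measurable. -/
theorem strictlyAdmissible_subset {r : ℝ} (hr : r < ρ₂) :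
    strictlyAdmissible d ρ₁ r ⊆ admissible d ρ₁ ρ₂ := by
  rintro ζ ⟨⟨h1, h2⟩, h3, h4⟩
  refine ⟨isGeneral_of_genPos h1 h2, h3, fun z => ?_⟩
  obtain ⟨k, hk⟩ := (TopologicalSpace.denseRange_denseSeq (E d)).exists_dist_lt z
    (show 0 < ρ₂ - r by linarith)
  obtain ⟨x, hx, hxk⟩ := h4 k
  refine ⟨x, ?_, hx⟩
  rw [Metric.mem_ball]
  linarith [dist_triangle x (TopologicalSpace.denseSeq (E d) k) z,
    dist_comm z (TopologicalSpace.denseSeq (E d) k)]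

/-- An extension from the whole space is the set itself, so this is the case `A = univ` of
`exists_isExtension`. -/
theorem parking_univ_mem_admissible (hρ₀ : 0 < ρ₀) (h₁₀ : ρ₁ < 2 * ρ₀) (h₀₂ : 2 * ρ₀ < ρ₂)
    (hfin : ∀ p ∈ ζ.carrier, (ancestors ρ₀ ζ.carrier p).Finite)
    (hdense : ∀ (x : E d) (r : ℝ), 0 < r → ∃ p ∈ ζ.carrier, dist p.1 x < r)
    (hgen : IsGeneral (Prod.fst '' ζ.carrier)) :
    parking hρ₀ univ ζ ∈ admissible d ρ₁ ρ₂ := by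
  obtain ⟨ζ', h, h'⟩ := exists_isExtension hρ₀ h₁₀ h₀₂ hfin hdense hgen univ
  rw [inter_univ] at h'
  exact PointConfig.ext h' ▸ h

theorem parking_univ_mem_strictlyAdmissible (hρ₀ : 0 < ρ₀) (h₁₀ : ρ₁ < 2 * ρ₀) {r : ℝ}
    (hr : 2 * ρ₀ < r)
    (hfin : ∀ p ∈ ζ.carrier, (ancestors ρ₀ ζ.carrier p).Finite)
    (hdense : ∀ (x : E d) (r : ℝ), 0 < r → ∃ p ∈ ζ.carrier, dist p.1 x < r)
    (h1 : GenPos hyperplaneLift d (Prod.fst '' ζ.carrier))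
    (h2 : GenPos sphereLift (d + 1) (Prod.fst '' ζ.carrier)) :
    parking hρ₀ univ ζ ∈ strictlyAdmissible d ρ₁ r := by
  have hsub : (parking hρ₀ univ ζ).carrier ⊆ Prod.fst '' ζ.carrier := by
    rw [parking_univ_carrier]
    exact image_mono (accepted_subset _)
  obtain ⟨-, h3, h4⟩ := parking_univ_mem_admissible hρ₀ h₁₀ hr hfin hdense
    (isGeneral_of_genPos h1 h2)
  refine ⟨⟨h1.mono hsub, h2.mono hsub⟩, h3, fun k => ?_⟩
  obtain ⟨x, hx, hxζ⟩ := h4 (TopologicalSpace.denseSeq (E d) k)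
  exact ⟨x, hxζ, hx⟩

/-- Functionals which are local and insensitive to the boundary have the same asymptotics on point
sets which coincide in the bulk. -/
theorem tendsto_sub_div_volume (hd : 1 ≤ d) {D : Set (E d)} (hD : IsLipschitzSet D)
    {S : Set (E d) → PointConfig (E d) → ℝ} (hS_local : IsLocal ρ₁ ρ₂ D S) {α : ℝ}
    (hα : α < 1)
    (hlim : limsup (fun R : ℝ => ⨆ ζ ∈ admissible d ρ₁ ρ₂,
      ENNReal.ofReal (|S (R • D) ζ - S (shrink D R (R ^ α)) ζ| / R ^ d)) atTop = 0)
    {ξ : PointConfig (E d)} (hξ : ξ ∈ admissible d ρ₁ ρ₂) {ζ : ℝ → PointConfig (E d)}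
    (hζ : ∀ᶠ R in atTop, ζ R ∈ admissible d ρ₁ ρ₂ ∧
      (ζ R).carrier ∩ shrink D R (R ^ α) = ξ.carrier ∩ shrink D R (R ^ α)) :
    Tendsto (fun R : ℝ => (S (R • D) (ζ R) - S (R • D) ξ) / volume.real (R • D)) atTop (𝓝 0) := by
  have ht : Tendsto (fun R : ℝ => ⨆ ζ ∈ admissible d ρ₁ ρ₂,
      ENNReal.ofReal (|S (R • D) ζ - S (shrink D R (R ^ α)) ζ| / R ^ d)) atTop (𝓝 0) :=
    tendsto_of_le_liminf_of_limsup_le bot_le hlim.le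
  have hv := hD.volume_real_pos hd
  rw [Metric.tendsto_nhds]
  intro ε hε
  -- Half of the error is spent on each of the two replacements of `R • D` by its erosion; on the
  -- erosion the two values coincide by locality.
  have hε' : 0 < ε * volume.real D / 2 := by positivity
  filter_upwards [hζ, ht.eventually (gt_mem_nhds (ENNReal.ofReal_pos.2 hε')),
    hD.eventually_shrink_mem_dilates hd hα, eventually_gt_atTop 0] with R ⟨h1, h2⟩ h3 h4 hR
  have hRd : 0 < R ^ d := by positivity
  have hbound : ∀ η ∈ admissible d ρ₁ ρ₂,
      |S (R • D) η - S (shrink D R (R ^ α)) η| < ε * volume.real D / 2 * R ^ d := by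
    intro η hη
    rw [← div_lt_iff₀ hRd]
    exact (ENNReal.ofReal_lt_ofReal_iff hε').1 ((le_iSup₂_of_le η hη le_rfl).trans_lt h3)
  have h5 := hbound _ h1
  have h6 := hbound _ hξ
  rw [hS_local _ h4 _ h1 _ hξ h2] at h5
  rw [dist_zero_right, Real.norm_eq_abs, abs_div, volume_real_smul hR.le,
    abs_of_pos (mul_pos hRd hv), div_lt_iff₀ (mul_pos hRd hv)]
  have h7 := abs_sub_le (S (R • D) (ζ R)) (S (shrink D R (R ^ α)) ξ) (S (R • D) ξ)
  rw [abs_sub_comm (S (shrink D R (R ^ α)) ξ)] at h7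
  linarith

theorem valueIn_eq {S : Set (E d) → PointConfig (E d) → ℝ} {A : Set (E d)}
    {ζ : PointConfig (E d)} (h : ∃ ζ', IsExtension ρ₁ ρ₂ A ζ ζ') :
    valueIn ρ₁ ρ₂ S A ζ = S A h.choose := dif_pos h

theorem carrier_inter_shrink_eq (hρ₀ : 0 < ρ₀) {D : Set (E d)} {R r : ℝ}
    (hr : 0 < r) (h : ∀ p ∈ ζ.carrier, p.1 ∈ shrink D R r →
      (p ∈ accepted ρ₀ (above ζ (R • D)) ↔ p ∈ accepted ρ₀ ζ.carrier))
    {ζ' : PointConfig (E d)} (hζ' : IsExtension ρ₁ ρ₂ (R • D) (parking hρ₀ (R • D) ζ) ζ') :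
    ζ'.carrier ∩ shrink D R r = (parking hρ₀ univ ζ).carrier ∩ shrink D R r := by
  have hsub : shrink D R r ⊆ R • D := by
    rw [shrink, if_neg hr.ne']
    exact sep_subset _ _
  have h1 : ζ'.carrier ∩ shrink D R r = (parking hρ₀ (R • D) ζ).carrier ∩ shrink D R r := by
    rw [← hζ'.2, inter_assoc, inter_eq_self_of_subset_right hsub]
  rw [h1, parking_carrier, parking_univ_carrier]
  ext x
  constructor
  · rintro ⟨⟨p, hp, rfl⟩, hx⟩
    exact ⟨⟨p, (h p (accepted_subset _ hp).1 hx).1 hp, rfl⟩, hx⟩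
  · rintro ⟨⟨p, hp, rfl⟩, hx⟩
    exact ⟨⟨p, (h p (accepted_subset _ hp) hx).2 hp, rfl⟩, hx⟩

end Main

end RandomParking

end

/-! ### The theorem. -/

theorem mainTheorem1 {d : ℕ} (hd : 1 ≤ d) {ρ₀ ρ₁ ρ₂ : ℝ}
    (hρ₁ : 0 < ρ₁) (hρ₀ : 0 < ρ₀) (h₁₀ : ρ₁ < 2 * ρ₀) (h₀₂ : 2 * ρ₀ < ρ₂)
    {Ω : Type*} [MeasurableSpace Ω] (P : Measure Ω) [IsProbabilityMeasure P]
    (N : Ω → RandomParking.PointConfig (RandomParking.SpaceTime d))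
    (hN : RandomParking.IsPoissonProcess N (RandomParking.lebesgue d) P)
    (D : Set (RandomParking.E d)) (hD : RandomParking.IsLipschitzSet D)
    (S : Set (RandomParking.E d) → RandomParking.PointConfig (RandomParking.E d) → ℝ)
    (hS_nonneg : ∀ A ∈ RandomParking.dilates D, ∀ ζ ∈ RandomParking.admissible d ρ₁ ρ₂,
      0 ≤ S A ζ)
    (hS_meas : RandomParking.IsMeasurableFunctional ρ₁ ρ₂ D S)
    (hS_local : RandomParking.IsLocal ρ₁ ρ₂ D S)
    (hS_bdry : RandomParking.IsInsensitiveToBoundary ρ₁ ρ₂ D S)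
    (hS_avg : RandomParking.HasAveragingProperty ρ₁ ρ₂ D S) :
    ∃ Sbar : ℝ,
      RandomParking.HasAverage D S (P.map fun ω => RandomParking.parking hρ₀ univ (N ω)) Sbar ∧
      ∀ᵐ ω ∂P,
        RandomParking.parking hρ₀ univ (N ω) ∈ RandomParking.admissible d ρ₁ ρ₂ ∧
        (∀ R : ℝ, 0 < R → ∃ ζ', RandomParking.IsExtension ρ₁ ρ₂ (R • D)
          (RandomParking.parking hρ₀ (R • D) (N ω)) ζ') ∧
        Tendsto (fun R : ℝ =>
          RandomParking.valueIn ρ₁ ρ₂ S (R • D) (RandomParking.parking hρ₀ (R • D) (N ω)) /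
            volume.real (R • D)) atTop (𝓝 Sbar) ∧
        Tendsto (fun R : ℝ =>
          S (R • D) (RandomParking.parking hρ₀ univ (N ω)) / volume.real (R • D))
          atTop (𝓝 Sbar) := by
  have hV := hN.hasPoissonVoids
  have hNm := hN.measurable
  have hπ := RandomParking.measurable_parking (d := d) hρ₀
  have hlaw : P.map (fun ω => RandomParking.parking hρ₀ univ (N ω)) =
      (P.map N).map (RandomParking.parking hρ₀ univ) := (Measure.map_map hπ hNm).symm
  obtain ⟨τ, M, hτ, hfields⟩ := hV.exists_ae_hasLogReach hρ₀ (s := 2 * ρ₀) (by positivity)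
  have hplane := hV.ae_genPos RandomParking.continuous_hyperplaneLift
    (RandomParking.volume_hyperplaneLift_preimage hd) (m := d) (by simp)
  have hsphere := hV.ae_genPos RandomParking.continuous_sphereLift
    (RandomParking.volume_sphereLift_preimage hd) (m := d + 1) (by simp)
  have hadm : ∀ᵐ ξ ∂(P.map N).map (RandomParking.parking hρ₀ univ),
      ξ ∈ RandomParking.admissible d ρ₁ ρ₂ := by
    have hr : (2 * ρ₀ + ρ₂) / 2 < ρ₂ := by linarith
    -- Passing from the Poisson law to its image requires a measurable set; any radius strictly
    -- between `2 * ρ₀` and `ρ₂` would do.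
    have : ∀ᵐ ξ ∂(P.map N).map (RandomParking.parking hρ₀ univ),
        ξ ∈ RandomParking.strictlyAdmissible d ρ₁ ((2 * ρ₀ + ρ₂) / 2) := by
      refine (ae_map_iff hπ.aemeasurable
        (RandomParking.measurableSet_strictlyAdmissible d ρ₁ _)).2 ?_
      filter_upwards [hfields, hplane, hsphere, hV.ae_dense] with ζ h1 h2 h3 h4
      exact RandomParking.parking_univ_mem_strictlyAdmissible hρ₀ h₁₀ (by linarith)
        (fun p hp => RandomParking.finite_ancestors hρ₀ hτ h1.1 hp) h4 h2 h3
    exact this.mono fun ξ hξ => RandomParking.strictlyAdmissible_subset hr hξ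
  have hprob := hV.prob
  obtain ⟨Sbar, hSbar⟩ := hS_avg _ (Measure.isProbabilityMeasure_map hπ.aemeasurable)
    (RandomParking.isStationary_parking hV hρ₀) (RandomParking.isErgodic_parking hd hV hρ₀) hadm
  refine ⟨Sbar, hlaw ▸ hSbar, ?_⟩
  obtain ⟨α, hα0, hα1, hlim⟩ := hS_bdry
  filter_upwards [ae_of_ae_map hNm.aemeasurable hfields, ae_of_ae_map hNm.aemeasurable hplane,
    ae_of_ae_map hNm.aemeasurable hsphere, ae_of_ae_map hNm.aemeasurable hV.ae_dense,
    ae_of_ae_map hNm.aemeasurable (ae_of_ae_map hπ.aemeasurable hSbar)]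
    with ω ⟨harr, hlate⟩ h2 h3 hdense hlimξ
  have hfin := fun p hp => RandomParking.finite_ancestors hρ₀ hτ harr (p := p) hp
  have hgen := RandomParking.isGeneral_of_genPos h2 h3
  have hξ := RandomParking.parking_univ_mem_admissible hρ₀ h₁₀ h₀₂ hfin hdense hgen
  have hext := fun R : ℝ =>
    RandomParking.exists_isExtension hρ₀ h₁₀ h₀₂ hfin hdense hgen (R • D)
  refine ⟨hξ, fun R _ => hext R, ?_, hlimξ⟩
  -- The comparison is made with the very extensions chosen in `valueIn`, so no independence of that
  -- choice has to be proved.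
  have hdiff := RandomParking.tendsto_sub_div_volume hd hD hS_local hα1 hlim hξ
    (ζ := fun R => (hext R).choose) (by
      filter_upwards [RandomParking.eventually_accepted_above_iff hρ₀ hτ hfin harr hlate hD.2.1
        hα0, eventually_gt_atTop 0] with R hR hR0
      exact ⟨(hext R).choose_spec.1, RandomParking.carrier_inter_shrink_eq hρ₀
        (Real.rpow_pos_of_pos hR0 α) hR (hext R).choose_spec⟩)
  simpa [sub_div, RandomParking.valueIn_eq (hext _)] using hdiff.add hlimξ
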